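/- Let $n\ge 1$, let $P\subset\mathbb{R}^n$ be a compact convex set of Lebesgue measure $1$, with support function $\phi_P(x)=\sup_{p\in P}\langle x,p\rangle$, and fix $\beta>0$. Let $\mu_0=\rho_0\,dx$ with $\rho_0:\mathbb{R}^n\to(0,\infty)$ measurable, and let $\phi_0:\mathbb{R}^n\to\mathbb{R}$ be a continuous function (not necessarily convex) such that $\phi_0(x)-\phi_P(x)\to\infty$ as $|x|\to\infty$ and $\int e^{\beta(\phi_P-\phi_0)}\,d\mu_0<\infty$. For a positive integer $k$ let $p_1,\dots,p_N$, with $N=N_k$, be the points of $kP\cap\mathbb{Z}^n$, let $$\mathrm{Per}(x_1,\dots,x_N)=\sum_{\sigma\in S_N}\prod_{i=1}^N e^{\langle x_i,p_{\sigma(i)}\rangle}$$ be the permanent of the matrix $(e^{\langle x_i,p_j\rangle})_{i,j}$, and set $$Z_N=\int_{(\mathbb{R}^n)^N}\mathrm{Per}(x_1,\dots,x_N)^{\beta/k}\,(e^{-\beta\phi_0}\mu_0)^{\otimes N},$$ $$\phi_\beta^{(N)}(x)=\frac1\beta\log\int_{(\mathbb{R}^n)^{N-1}}\frac1{Z_N}\,\mathrm{Per}(x,x_2,\dots,x_N)^{\beta/k}\,(e^{-\beta\phi_0}\mu_0)^{\otimes(N-1)}.$$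 For a convex function $\phi$ on $\mathbb{R}^n$ let $\partial\phi$ be its (multivalued) subgradient map and let $MA(\phi)(A)=|\partial\phi(A)|$ (Lebesgue measure, $A$ Borel) be its Monge--Ampère measure in the sense of Alexandrov. A convex function $\phi:\mathbb{R}^n\to\mathbb{R}$ is said to solve the second boundary value problem with target $P$ for the equation $$MA(\phi)=e^{\beta(\phi-\phi_0)}\mu_0 \qquad (*)$$ if $(*)$ holds as an equality of measures and $\operatorname{int}P\subset\partial\phi(\mathbb{R}^n)\subset P$. Then: 1. For every $k\ge1$ with $N_k\ge1$ the integrals above are finite, $Z_N>0$, and $\phi_\beta^{(N)}$ is a convex function whose gradient image lies in $P$, i.e. $\partial\phi_\beta^{(N)}(\mathbb{R}^n)\subset P$. 2. The second boundary value problem with target $P$ for $(*)$ has exactly one solution $\phi$, and $\phi_\beta^{(N_k)}\to\phi$ locally uniformly on $\mathbb{R}^n$ as $k\to\infty$. -/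

import Mathlib

open MeasureTheory Filter Topology
open scoped Pointwise

namespace PermanentMA

/-- The support function `φ_P(x) = sup_{p ∈ P} ⟨x, p⟩` of a convex body `P` in `ℝⁿ`. -/
noncomputable def supportFunction {n : ℕ} (P : ConvexBody (EuclideanSpace ℝ (Fin n)))
    (x : EuclideanSpace ℝ (Fin n)) : ℝ :=
  ⨆ p : (P : Set (EuclideanSpace ℝ (Fin n))), inner ℝ x (p : EuclideanSpace ℝ (Fin n))

/-- A weight function on `ℝⁿ`: a continuous function, not necessarily convex, such that
`φ₀ - φ_P → ∞` at infinity. -/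
structure IsWeightFunction {n : ℕ} (P : ConvexBody (EuclideanSpace ℝ (Fin n)))
    (φ₀ : EuclideanSpace ℝ (Fin n) → ℝ) : Prop where
  continuous : Continuous φ₀
  growth : Tendsto (fun x => φ₀ x - supportFunction P x)
    (cocompact (EuclideanSpace ℝ (Fin n))) atTop

/-- The set of subgradients of `φ` at `x`. -/
def subgradient {n : ℕ} (φ : EuclideanSpace ℝ (Fin n) → ℝ) (x : EuclideanSpace ℝ (Fin n)) :
    Set (EuclideanSpace ℝ (Fin n)) :=
  {p | ∀ y, φ x + inner ℝ p (y - x) ≤ φ y}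

/-- The image of a set `A` under the multivalued subgradient map of `φ`. -/
def subgradientImage {n : ℕ} (φ : EuclideanSpace ℝ (Fin n) → ℝ)
    (A : Set (EuclideanSpace ℝ (Fin n))) : Set (EuclideanSpace ℝ (Fin n)) :=
  ⋃ x ∈ A, subgradient φ x

/-- The Monge-Ampère measure (in the sense of Alexandrov) of a convex function `φ`,
evaluated at a Borel set `A`: the Lebesgue measure of the subgradient image of `A`. -/
noncomputable def mongeAmpere {n : ℕ} (φ : EuclideanSpace ℝ (Fin n) → ℝ)
    (A : Set (EuclideanSpace ℝ (Fin n))) : ENNReal :=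
  volume (subgradientImage φ A)

/-- `φ` is convex and its gradient maps `ℝⁿ` into `P`, in the sense of subgradients. -/
structure HasGradientImageIn {n : ℕ} (P : ConvexBody (EuclideanSpace ℝ (Fin n)))
    (φ : EuclideanSpace ℝ (Fin n) → ℝ) : Prop where
  convexOn : ConvexOn ℝ Set.univ φ
  subset : subgradientImage φ Set.univ ⊆ (P : Set (EuclideanSpace ℝ (Fin n)))

/-- `φ` solves the second boundary value problem with target `P` for the equation
`MA(φ) = e^{β(φ - φ₀)} μ₀`: it is convex, its subgradient image lies in `P` and covers the
interior of `P`, and the two measures agree on all Borel sets. -/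
structure SolvesSecondBVP {n : ℕ} (P : ConvexBody (EuclideanSpace ℝ (Fin n))) (β : ℝ)
    (φ₀ : EuclideanSpace ℝ (Fin n) → ℝ) (μ₀ : Measure (EuclideanSpace ℝ (Fin n)))
    (φ : EuclideanSpace ℝ (Fin n) → ℝ) : Prop where
  gradient : HasGradientImageIn P φ
  onto : interior (P : Set (EuclideanSpace ℝ (Fin n))) ⊆ subgradientImage φ Set.univ
  equation : ∀ A : Set (EuclideanSpace ℝ (Fin n)), MeasurableSet A →
    mongeAmpere φ A = ∫⁻ x in A, ENNReal.ofReal (Real.exp (β * (φ x - φ₀ x))) ∂μ₀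

/-- The lattice points `kP ∩ ℤⁿ`. -/
def latticePoints {n : ℕ} (P : ConvexBody (EuclideanSpace ℝ (Fin n))) (k : ℕ) :
    Set (EuclideanSpace ℝ (Fin n)) :=
  {p | p ∈ (k : ℝ) • (P : Set (EuclideanSpace ℝ (Fin n))) ∧ ∀ i, ∃ m : ℤ, p i = m}

theorem finite_latticePoints {n : ℕ} (P : ConvexBody (EuclideanSpace ℝ (Fin n))) (k : ℕ) :
    (latticePoints P k).Finite := by
  obtain ⟨C, hC⟩ := (P.isCompact.smul (k : ℝ)).isBounded.exists_norm_le
  have hbox : (Set.pi Set.univ (fun _ : Fin n => ((Int.cast : ℤ → ℝ) '' Set.Icc (-⌈C⌉) ⌈C⌉))).Finite :=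
    Set.Finite.pi' (fun _ => (Set.finite_Icc _ _).image _) |>.subset (by
      intro f hf i; exact hf i (Set.mem_univ i))
  refine (hbox.image (WithLp.toLp 2)).subset ?_
  rintro p ⟨hp, hm⟩
  refine ⟨fun i => p i, ?_, rfl⟩
  intro i _
  obtain ⟨m, hm⟩ := hm i
  have h1 : |(m : ℝ)| ≤ C := by
    rw [← hm, ← Real.norm_eq_abs]
    exact (PiLp.norm_apply_le p i).trans (hC p hp)
  have h2 : |(m : ℝ)| ≤ (⌈C⌉ : ℝ) := h1.trans (Int.le_ceil C)
  rw [abs_le] at h2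
  exact ⟨m, ⟨by exact_mod_cast h2.1, by exact_mod_cast h2.2⟩, hm.symm⟩

/-- `N = N_k`, the number of lattice points in `kP`. -/
noncomputable def latticeNumber {n : ℕ} (P : ConvexBody (EuclideanSpace ℝ (Fin n))) (k : ℕ) : ℕ :=
  Nat.card (latticePoints P k)

/-- An auxiliary ordering `p₁, …, p_N` of the lattice points in `kP`. -/
noncomputable def latticeOrdering {n : ℕ} (P : ConvexBody (EuclideanSpace ℝ (Fin n))) (k : ℕ) :
    Fin (latticeNumber P k) ≃ latticePoints P k :=
  haveI := (finite_latticePoints P k).to_subtype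
  (Finite.equivFin (latticePoints P k)).symm

/-- `Per(x₁, …, x_N)`, the permanent of the matrix `(e^{⟨x_i, p_j⟩})`, where `p_j` runs over the
`N` lattice points in `kP`. -/
noncomputable def per {n : ℕ} (P : ConvexBody (EuclideanSpace ℝ (Fin n))) (k : ℕ)
    (x : Fin (latticeNumber P k) → EuclideanSpace ℝ (Fin n)) : ℝ :=
  Matrix.permanent (Matrix.of fun i j =>
    Real.exp (inner ℝ (x i) (latticeOrdering P k j : EuclideanSpace ℝ (Fin n))))

/-- The measure `e^{-βφ₀} μ₀`. -/
noncomputable def weightedMeasure {n : ℕ} (β : ℝ) (φ₀ : EuclideanSpace ℝ (Fin n) → ℝ)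
    (μ₀ : Measure (EuclideanSpace ℝ (Fin n))) : Measure (EuclideanSpace ℝ (Fin n)) :=
  μ₀.withDensity fun x => ENNReal.ofReal (Real.exp (-(β * φ₀ x)))

/-- The normalizing constant `Z_N = ∫ Per(x₁, …, x_N)^{β/k} (e^{-βφ₀} μ₀)^{⊗N}`. -/
noncomputable def partitionFunction {n : ℕ} (P : ConvexBody (EuclideanSpace ℝ (Fin n))) (β : ℝ)
    (φ₀ : EuclideanSpace ℝ (Fin n) → ℝ) (μ₀ : Measure (EuclideanSpace ℝ (Fin n))) (k : ℕ) : ℝ :=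
  ∫ x, per P k x ^ (β / k)
    ∂(Measure.pi fun _ : Fin (latticeNumber P k) => weightedMeasure β φ₀ μ₀)

/-- The configuration `(x, x₂, …, x_N)` (the empty one if `N = 0`). -/
def consConfig {α : Type*} : {N : ℕ} → α → (Fin (N - 1) → α) → (Fin N → α)
  | 0, _, _ => Fin.elim0
  | N + 1, x, y => Fin.cons (n := N) (α := fun _ => α) x y

/-- The function `φ_β^(N)(x) = (1/β) log ∫ Z_N⁻¹ Per(x, x₂, …, x_N)^{β/k} (e^{-βφ₀} μ₀)^{⊗(N-1)}`
with `N = N_k`. -/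
noncomputable def approxPotential {n : ℕ} (P : ConvexBody (EuclideanSpace ℝ (Fin n))) (β : ℝ)
    (φ₀ : EuclideanSpace ℝ (Fin n) → ℝ) (μ₀ : Measure (EuclideanSpace ℝ (Fin n))) (k : ℕ)
    (x : EuclideanSpace ℝ (Fin n)) : ℝ :=
  1 / β * Real.log (∫ y, 1 / partitionFunction P β φ₀ μ₀ k * per P k (consConfig x y) ^ (β / k)
    ∂(Measure.pi fun _ : Fin (latticeNumber P k - 1) => weightedMeasure β φ₀ μ₀))

end PermanentMA

/-!
The proof is variational. Write `ν = e^{-βφ₀} μ₀`, let `q_j = p_j / k ∈ P`, and let `κ` be Lebesgue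
measure on `P`. The permanent raised to the power `β / k` is a Gibbs weight on configurations of `N`
points; its normalization is `Z_N`, and `e^{β φ_N}` is the density of its one-point marginal with
respect to `ν`. Convexity of `φ_N` is Hölder's inequality (`convexOn_log_integral`), and the
gradient bound holds since moving one point from `x` to `z` multiplies the weight by at most
`e^{β φ_P(z - x)}`.

**Dual functional.** On a closed ball `B` consider `ψ ↦ log ∫_B e^{βψ} dν + β ∫ ψ* dκ`, where `ψ*`
is the conjugate (`conjOn`) over `B`. By Arzelà-Ascoli it has a minimizer `χ`, which may be taken to
be a conjugate over `P` and normalized by `∫_B e^{βχ} dν = 1` (`exists_isOptimalPotential`). As the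
balls grow, the `χ` subconverge to a convex `φ` with `∫ e^{βφ} dν = 1`
(`exists_limit_optimalPotential`).

**Convergence.** For the minimizer `⟨x_i, q_j⟩ ≤ χ(x_i) + χ*(q_j)`, so the Gibbs weight is at most
`N!^{β/k}` times `e^{β ∑ χ*(q_j)}` times a product of the densities `e^{βχ(x_i)}`. Conversely
`log Z_N` is bounded below by Jensen's inequality for the product of these densities: the permanent
dominates its largest term, the optimal value of an assignment problem, which by duality
(`exists_perm_dual`) is nearly `∑ ψ(x_i) + ∑ ψ*(q_j)` for some Lipschitz `ψ` depending on the
points; up to a small error `ψ` ranges over a finite set, so the law of large numbers replaces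
`∑ ψ(x_i)` by its mean, and the optimality of `χ` bounds the result from below. Since `log N = o(k)`
and `∑ f(q_j) / N → ∫ f dκ`, the two bounds match up to `e^{o(N)}`, so the Gibbs density is at most
`e^{εN}` times the product density (`eventually_gibbsWeight_le_prod`). Jensen's inequality then shows that the one-point marginals
converge to `e^{βφ} ν`, and compactness of the class of functions with a fixed Lipschitz constant
upgrades this to locally uniform convergence of the potentials (`tendsto_gibbsPotential`).

**The equation.** Lowering `χ` by a small bump near a compact set `K` and using minimality bounds
`∫_K e^{βχ} dν` by the `κ`-measure of the slopes at which the conjugate changes. In the limit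
`∫_K e^{βφ} dν ≤ |∂φ(K)|` (`IsLimitOfOptimal.setIntegral_le_measure_subgradientImage`). The left
side has total mass `1`, the right side is at most `|P| = 1`, and slopes shared by two points form a
null set by Rademacher's theorem, so equality holds on all Borel sets
(`mongeAmpere_eq_of_le_on_compacts`).

**Uniqueness.** If two solutions satisfied `ψ₁ > ψ₂` on a nonempty open set `U`, then up to a null
set `∂ψ₁(U) ⊆ ∂ψ₂(U)`, while the equation makes `MA(ψ₁)(U) > MA(ψ₂)(U)` (`SolvesSecondBVP.le`).
-/

namespace PermanentMA

/-! ### Conjugates over compact sets -/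

section Conjugate

variable {E : Type*} [NormedAddCommGroup E] [InnerProductSpace ℝ E]

/-- The convex conjugate of the restriction of `f` to `S`, i.e. `y ↦ sup_{s ∈ S} (⟨y, s⟩ - f s)`.
It is meaningful when `S` is compact and nonempty and `f` is continuous. -/
noncomputable def conjOn (S : Set E) (f : E → ℝ) (y : E) : ℝ :=
  ⨆ s : S, (inner ℝ y (s : E) - f s)

variable {S : Set E} {f g : E → ℝ}

theorem exists_conjOn_eq (hS : IsCompact S) (hne : S.Nonempty) (hf : Continuous f) (y : E) :
    ∃ s ∈ S, conjOn S f y = inner ℝ y s - f s ∧ ∀ t ∈ S, inner ℝ y t - f t ≤ conjOn S f y := by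
  have hc : ContinuousOn (fun s => inner ℝ y s - f s) S := by fun_prop
  obtain ⟨s, hs, hmax⟩ := hS.exists_isMaxOn hne hc
  have := hne.to_subtype
  have hle : ∀ t : S, inner ℝ y (t : E) - f t ≤ inner ℝ y s - f s := fun t => hmax t.2
  have hbdd : BddAbove (Set.range fun t : S => inner ℝ y (t : E) - f t) :=
    ⟨_, by rintro _ ⟨t, rfl⟩; exact hle t⟩
  have heq : conjOn S f y = inner ℝ y s - f s :=
    le_antisymm (ciSup_le hle) (le_ciSup hbdd ⟨s, hs⟩)
  exact ⟨s, hs, heq, fun t ht => heq ▸ hle ⟨t, ht⟩⟩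

theorem le_conjOn (hS : IsCompact S) (hf : Continuous f) {s : E} (hs : s ∈ S) (y : E) :
    inner ℝ y s - f s ≤ conjOn S f y := by
  obtain ⟨_, _, _, h⟩ := exists_conjOn_eq hS ⟨s, hs⟩ hf y
  exact h s hs

theorem conjOn_le (hne : S.Nonempty) {y : E} {a : ℝ}
    (h : ∀ s ∈ S, inner ℝ y s - f s ≤ a) : conjOn S f y ≤ a := by
  have := hne.to_subtype
  exact ciSup_le fun s => h s s.2

theorem conjOn_le_conjOn_add (hS : IsCompact S) (hne : S.Nonempty) (hg : Continuous g)
    {ε : ℝ} (h : ∀ s ∈ S, g s ≤ f s + ε) (y : E) : conjOn S f y ≤ conjOn S g y + ε := by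
  refine conjOn_le hne fun s hs => ?_
  have := le_conjOn hS hg hs y
  linarith [h s hs]

theorem conjOn_sub_const (hS : IsCompact S) (hne : S.Nonempty) (hf : Continuous f) (c : ℝ) (y : E) :
    conjOn S (fun x => f x - c) y = conjOn S f y + c := by
  apply le_antisymm
  · exact conjOn_le_conjOn_add hS hne hf (fun s _ => by linarith) y
  · have := conjOn_le_conjOn_add (f := f) (g := fun x => f x - c) (ε := -c) hS hne (by fun_prop)
      (fun s _ => by linarith) y
    linarith

theorem conjOn_convexCombination_le (hS : IsCompact S) (hne : S.Nonempty) (hf : Continuous f)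
    (hg : Continuous g) {t : ℝ} (ht0 : 0 ≤ t) (ht1 : t ≤ 1) (y : E) :
    conjOn S (fun x => f x + t * (g x - f x)) y
      ≤ conjOn S f y + t * (conjOn S g y - conjOn S f y) := by
  refine conjOn_le hne fun s hs => ?_
  have h1 := le_conjOn hS hf hs y
  have h2 := le_conjOn hS hg hs y
  nlinarith

theorem conjOn_sub_le (hS : IsCompact S) (hne : S.Nonempty) (hf : Continuous f) (y z : E) :
    conjOn S f y - conjOn S f z ≤ conjOn S (fun _ => 0) (y - z) := by
  rw [sub_le_iff_le_add]
  refine conjOn_le hne fun s hs => ?_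
  have h1 := le_conjOn hS hf hs z
  have h2 := le_conjOn (f := fun _ => (0 : ℝ)) hS continuous_const hs (y - z)
  rw [inner_sub_left] at h2
  linarith

theorem convexOn_conjOn (hS : IsCompact S) (hne : S.Nonempty) (hf : Continuous f) :
    ConvexOn ℝ Set.univ (conjOn S f) := by
  refine ⟨convex_univ, fun y _ z _ a b ha hb hab => conjOn_le hne fun s hs => ?_⟩
  have h1 := le_conjOn hS hf hs y
  have h2 := le_conjOn hS hf hs z
  rw [inner_add_left, real_inner_smul_left, real_inner_smul_left, smul_eq_mul, smul_eq_mul]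
  have : f s = a * f s + b * f s := by rw [← add_mul, hab, one_mul]
  nlinarith

theorem conjOn_zero_le {C : ℝ} (hne : S.Nonempty) (hC : ∀ s ∈ S, ‖s‖ ≤ C) (y : E) :
    conjOn S (fun _ => 0) y ≤ C * ‖y‖ := by
  refine conjOn_le hne fun s hs => ?_
  rw [sub_zero]
  calc inner ℝ y s ≤ ‖y‖ * ‖s‖ := real_inner_le_norm _ _
    _ ≤ C * ‖y‖ := by rw [mul_comm]; gcongr; exact hC s hs

/-- A function whose increments are dominated by the support function of a bounded set is
Lipschitz. -/
theorem lipschitzWith_of_increments {C : NNReal} (hne : S.Nonempty) (hC : ∀ s ∈ S, ‖s‖ ≤ C)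
    (h : ∀ x y, f y - f x ≤ conjOn S (fun _ => 0) (y - x)) : LipschitzWith C f := by
  refine LipschitzWith.of_le_add_mul C fun x y => ?_
  have := (h y x).trans (conjOn_zero_le hne hC _)
  rw [dist_eq_norm]
  linarith

theorem lipschitzWith_conjOn {C : NNReal} (hS : IsCompact S) (hne : S.Nonempty)
    (hC : ∀ s ∈ S, ‖s‖ ≤ C) (hf : Continuous f) : LipschitzWith C (conjOn S f) :=
  lipschitzWith_of_increments hne hC fun x y => conjOn_sub_le hS hne hf y x

theorem continuous_conjOn (hS : IsCompact S) (hne : S.Nonempty) (hf : Continuous f) :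
    Continuous (conjOn S f) := by
  obtain ⟨C, hC⟩ := hS.isBounded.exists_norm_le
  obtain ⟨s, hs⟩ := id hne
  have h0 : 0 ≤ C := (norm_nonneg s).trans (hC s hs)
  exact (lipschitzWith_conjOn (C := ⟨C, h0⟩) hS hne hC hf).continuous

/-- Double conjugation lowers a function. -/
theorem conjOn_conjOn_le {T : Set E} (hS : IsCompact S) (hT : T.Nonempty)
    (hf : Continuous f) {x : E} (hx : x ∈ S) : conjOn T (conjOn S f) x ≤ f x := by
  refine conjOn_le hT fun p _ => ?_
  have := le_conjOn hS hf hx p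
  rw [real_inner_comm]
  linarith

end Conjugate

theorem supportFunction_eq_conjOn {n : ℕ} (P : ConvexBody (EuclideanSpace ℝ (Fin n)))
    (x : EuclideanSpace ℝ (Fin n)) :
    supportFunction P x = conjOn (P : Set (EuclideanSpace ℝ (Fin n))) (fun _ => 0) x := by
  simp [supportFunction, conjOn]

/-! ### Functions whose increments are dominated by a support function -/

/-- A slope `p ∉ P` is separated from `P` by some direction, along which the growth bound
would fail. -/
theorem HasGradientImageIn.of_increments {n : ℕ} {P : ConvexBody (EuclideanSpace ℝ (Fin n))}
    {φ : EuclideanSpace ℝ (Fin n) → ℝ} (hconv : ConvexOn ℝ Set.univ φ)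
    (h : ∀ x y, φ y - φ x ≤ conjOn (P : Set (EuclideanSpace ℝ (Fin n))) (fun _ => 0) (y - x)) :
    HasGradientImageIn P φ := by
  refine ⟨hconv, ?_⟩
  intro p hp
  simp only [subgradientImage, Set.mem_iUnion] at hp
  obtain ⟨x, -, hp⟩ := hp
  by_contra hpP
  obtain ⟨l, u, hl, hu⟩ := geometric_hahn_banach_closed_point P.convex P.isCompact.isClosed hpP
  set v := (InnerProductSpace.toDual ℝ (EuclideanSpace ℝ (Fin n))).symm l with hv
  have hlv : ∀ q, l q = inner ℝ v q := fun q => by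
    rw [hv, InnerProductSpace.toDual_symm_apply]
  have h1 := hp (x + v)
  have h2 := h x (x + v)
  rw [add_sub_cancel_left] at h1 h2
  have h3 : conjOn (P : Set (EuclideanSpace ℝ (Fin n))) (fun _ => 0) v ≤ u :=
    conjOn_le P.nonempty fun s hs => by rw [sub_zero, ← hlv]; exact (hl s hs).le
  rw [hlv, real_inner_comm] at hu
  linarith

/-! ### Compactness of Lipschitz classes -/

section LipschitzClass

variable {E : Type*} [NormedAddCommGroup E]

/-- The `C`-Lipschitz functions with `|ψ 0| ≤ M`. -/
def lipClass (E : Type*) [NormedAddCommGroup E] (C M : NNReal) : Set C(E, ℝ) :=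
  {ψ | LipschitzWith C ψ ∧ |ψ 0| ≤ M}

theorem abs_le_of_mem_lipClass {C M : NNReal} {ψ : C(E, ℝ)} (hψ : ψ ∈ lipClass E C M) (x : E) :
    |ψ x| ≤ M + C * ‖x‖ := by
  have h1 := hψ.1.dist_le_mul x 0
  rw [dist_zero_right, Real.dist_eq] at h1
  have h2 := hψ.2
  rw [abs_le] at *
  constructor <;> linarith

theorem isCompact_lipClass (C M : NNReal) : IsCompact (lipClass E C M) := by
  refine ArzelaAscoli.isCompact_of_equicontinuous _ ?_ ?_
  · have : ContinuousMap.toFun '' lipClass E C M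
        = {f : E → ℝ | (∀ x y, dist (f x) (f y) ≤ C * dist x y) ∧ |f 0| ≤ M} := by
      ext f
      constructor
      · rintro ⟨ψ, hψ, rfl⟩
        exact ⟨hψ.1.dist_le_mul, hψ.2⟩
      · rintro ⟨h1, h2⟩
        have hL : LipschitzWith C f := LipschitzWith.of_dist_le_mul h1
        exact ⟨⟨f, hL.continuous⟩, ⟨hL, h2⟩, rfl⟩
    rw [this]
    have hbox : IsCompact (Set.pi Set.univ fun x : E => Set.Icc (-(M + C * ‖x‖ : ℝ)) (M + C * ‖x‖)) :=
      isCompact_univ_pi fun _ => isCompact_Icc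
    refine hbox.of_isClosed_subset ?_ ?_
    · refine IsClosed.inter (s₁ := {f : E → ℝ | ∀ x y, dist (f x) (f y) ≤ C * dist x y}) ?_ ?_
      · simp only [Set.ofPred_forall]
        refine isClosed_iInter fun x => isClosed_iInter fun y => ?_
        exact isClosed_le (by fun_prop) continuous_const
      · exact isClosed_le (continuous_apply (0 : E)).abs continuous_const
    · rintro f ⟨h1, h2⟩ x -
      have hL : LipschitzWith C f := LipschitzWith.of_dist_le_mul h1
      exact abs_le.1 (abs_le_of_mem_lipClass (ψ := ⟨f, hL.continuous⟩) ⟨hL, h2⟩ x)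
  · exact (LipschitzWith.uniformEquicontinuous (fun ψ : lipClass E C M => (ψ : E → ℝ)) C
      fun ψ => ψ.2.1).equicontinuous

theorem eventually_nhds_dist_lt {X : Type*} [TopologicalSpace X] {K : Set X} (hK : IsCompact K)
    (ψ : C(X, ℝ)) {ε : ℝ} (hε : 0 < ε) :
    ∀ᶠ ψ' in 𝓝 ψ, ∀ x ∈ K, |ψ' x - ψ x| < ε := by
  have h := (ContinuousMap.tendsto_iff_forall_isCompact_tendstoUniformlyOn
    (F := fun ψ' : C(X, ℝ) => ψ') (p := 𝓝 ψ) (f := ψ)).1 tendsto_id K hK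
  filter_upwards [Metric.tendstoUniformlyOn_iff.1 h ε hε] with ψ' h' x hx
  rw [← Real.dist_eq, dist_comm]
  exact h' x hx

end LipschitzClass

/-! ### The dual variational problem on a compact set -/

section Variational

variable {E : Type*} [NormedAddCommGroup E] [MeasurableSpace E] [BorelSpace E]

theorem integrable_of_ae_mem_isCompact [SecondCountableTopology E] {m : Measure E}
    [IsFiniteMeasure m] {B : Set E} (hB : IsCompact B) (hm : ∀ᵐ x ∂m, x ∈ B) {f : E → ℝ} (hf : Continuous f) :
    Integrable f m := by
  obtain ⟨C, hC⟩ := hB.exists_bound_of_continuousOn hf.continuousOn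
  exact Integrable.of_bound hf.aestronglyMeasurable C (hm.mono hC)

variable [InnerProductSpace ℝ E]

/-- The functional `ψ ↦ log ∫ e^{βψ} dm + β ∫ ψ* dκ`, where `ψ*` is the conjugate of the restriction
of `ψ` to `B`. -/
noncomputable def dualEnergy (B : Set E) (m κ : Measure E) (β : ℝ) (ψ : E → ℝ) : ℝ :=
  Real.log (∫ x, Real.exp (β * ψ x) ∂m) + β * ∫ p, conjOn B ψ p ∂κ

/-- A normalized minimizer `χ` of the dual energy that is moreover a conjugate of a function on `P`.
Hence it is convex with increments dominated by the support function of `P`, and the inequality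
`inner_le`, which for `x ∈ B` is the definition of the conjugate, holds for all `x`. The field
`optimal` is the first-order optimality condition. -/
structure IsOptimalPotential (P B : Set E) (m κ : Measure E) (β : ℝ) (χ : E → ℝ) : Prop where
  continuous : Continuous χ
  convexOn : ConvexOn ℝ Set.univ χ
  increments : ∀ x y, χ y - χ x ≤ conjOn P (fun _ => 0) (y - x)
  inner_le : ∀ x, ∀ p ∈ P, inner ℝ x p ≤ χ x + conjOn B χ p
  normalized : ∫ x, Real.exp (β * χ x) ∂m = 1
  optimal : ∀ ψ : E → ℝ, Continuous ψ →
    ∫ x, χ x * Real.exp (β * χ x) ∂m + ∫ p, conjOn B χ p ∂κ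
      ≤ ∫ x, ψ x * Real.exp (β * χ x) ∂m + ∫ p, conjOn B ψ p ∂κ

variable {B P : Set E} {m κ : Measure E} {β : ℝ}

variable [FiniteDimensional ℝ E] [IsFiniteMeasure m] [NeZero m] [IsProbabilityMeasure κ]
  (hB : IsCompact B) (hBne : B.Nonempty) (hP : IsCompact P) (hPne : P.Nonempty)
  (hm : ∀ᵐ x ∂m, x ∈ B) (hκ : ∀ᵐ p ∂κ, p ∈ P) (hβ : 0 < β)

include hB hm hβ in
theorem log_integral_exp_le {ψ ψ' : E → ℝ} (h : Continuous ψ) (h' : Continuous ψ') {ε : ℝ}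
    (hle : ∀ x ∈ B, ψ x ≤ ψ' x + ε) :
    Real.log (∫ x, Real.exp (β * ψ x) ∂m) ≤ Real.log (∫ x, Real.exp (β * ψ' x) ∂m) + β * ε := by
  have hi : ∀ {ψ : E → ℝ}, Continuous ψ → Integrable (fun x => Real.exp (β * ψ x)) m := fun h =>
    integrable_of_ae_mem_isCompact hB hm (by fun_prop)
  rw [← Real.log_exp (β * ε), ← Real.log_mul (integral_exp_pos (hi h')).ne' (Real.exp_pos _).ne',
    ← integral_mul_const]
  refine Real.log_le_log (integral_exp_pos (hi h)) (integral_mono_ae (hi h) ((hi h').mul_const _) ?_)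
  filter_upwards [hm] with x hx
  rw [← Real.exp_add, ← mul_add]
  have := hle x hx
  gcongr

include hB hBne hP hm hκ hβ in
theorem dualEnergy_le_add {ψ ψ' : E → ℝ} (h : Continuous ψ) (h' : Continuous ψ') {ε : ℝ}
    (hle : ∀ x ∈ B, |ψ x - ψ' x| ≤ ε) :
    dualEnergy B m κ β ψ ≤ dualEnergy B m κ β ψ' + 2 * β * ε := by
  have h1 := log_integral_exp_le (m := m) hB hm hβ h h' (ε := ε)
    (fun x hx => by linarith [(abs_le.1 (hle x hx)).2])
  have hi : ∀ {ψ : E → ℝ}, Continuous ψ → Integrable (conjOn B ψ) κ := fun h =>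
    integrable_of_ae_mem_isCompact hP hκ (continuous_conjOn hB hBne h)
  have h2 : ∫ p, conjOn B ψ p ∂κ ≤ ∫ p, conjOn B ψ' p ∂κ + ε := by
    have : ∫ p, (conjOn B ψ' p + ε) ∂κ = ∫ p, conjOn B ψ' p ∂κ + ε := by
      rw [integral_add (hi h') (integrable_const _)]; simp
    rw [← this]
    refine integral_mono (hi h) ((hi h').add (integrable_const _)) fun p => ?_
    exact conjOn_le_conjOn_add hB hBne h'
      (fun s hs => by linarith [(abs_le.1 (hle s hs)).1]) p
  unfold dualEnergy
  nlinarith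

include hB hBne hP hm hκ in
theorem dualEnergy_sub_const {ψ : E → ℝ} (h : Continuous ψ) (c : ℝ) :
    dualEnergy B m κ β (fun x => ψ x - c) = dualEnergy B m κ β ψ := by
  have hi : Integrable (fun x => Real.exp (β * ψ x)) m :=
    integrable_of_ae_mem_isCompact hB hm (by fun_prop)
  have h1 : ∫ x, Real.exp (β * (ψ x - c)) ∂m
      = (∫ x, Real.exp (β * ψ x) ∂m) * Real.exp (-(β * c)) := by
    rw [← integral_mul_const]
    congr 1 with x
    rw [← Real.exp_add]; ring_nf
  have h2 : ∫ p, conjOn B (fun x => ψ x - c) p ∂κ = ∫ p, conjOn B ψ p ∂κ + c := by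
    have hc : Integrable (conjOn B ψ) κ :=
      integrable_of_ae_mem_isCompact hP hκ (continuous_conjOn hB hBne h)
    simp_rw [conjOn_sub_const hB hBne h]
    rw [integral_add hc (integrable_const _)]; simp
  unfold dualEnergy
  rw [h1, h2, Real.log_mul (integral_exp_pos hi).ne' (Real.exp_pos _).ne', Real.log_exp]
  ring

include hB hBne hP hPne hm hκ hβ in
/-- Double conjugation through `P` lowers the energy. -/
theorem dualEnergy_conjOn_conjOn_le {ψ : E → ℝ} (h : Continuous ψ) :
    dualEnergy B m κ β (conjOn P (conjOn B ψ)) ≤ dualEnergy B m κ β ψ := by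
  have hc := continuous_conjOn hB hBne h
  have hcc := continuous_conjOn hP hPne hc
  have h1 := log_integral_exp_le (m := m) hB hm hβ hcc h (ε := 0)
    (fun x hx => by linarith [conjOn_conjOn_le hB hPne h hx])
  have h2 : ∫ p, conjOn B (conjOn P (conjOn B ψ)) p ∂κ ≤ ∫ p, conjOn B ψ p ∂κ := by
    refine integral_mono_ae (integrable_of_ae_mem_isCompact hP hκ (continuous_conjOn hB hBne hcc))
      (integrable_of_ae_mem_isCompact hP hκ hc) ?_
    filter_upwards [hκ] with p hp
    exact conjOn_conjOn_le hP hBne hc hp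
  unfold dualEnergy
  nlinarith

include hB hBne hP hPne hm hκ hβ in
theorem exists_dualEnergy_minimizer :
    ∃ ψ : E → ℝ, Continuous ψ ∧
      ∀ ψ' : E → ℝ, Continuous ψ' → dualEnergy B m κ β ψ ≤ dualEnergy B m κ β ψ' := by
  obtain ⟨C, hC⟩ := hP.isBounded.exists_norm_le
  obtain ⟨p₀, hp₀⟩ := id hPne
  have h0 : 0 ≤ C := (norm_nonneg p₀).trans (hC p₀ hp₀)
  set L := lipClass E ⟨C, h0⟩ 0
  have hne : L.Nonempty := ⟨0, LipschitzWith.const' 0, by simp⟩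
  have hcont : ContinuousOn (fun ψ : C(E, ℝ) => dualEnergy B m κ β ψ) L := by
    refine continuousOn_of_forall_continuousAt fun ψ _ => ?_
    refine Metric.tendsto_nhds.2 fun ε hε => ?_
    have hε' : 0 < ε / (4 * β) := by positivity
    filter_upwards [eventually_nhds_dist_lt hB ψ hε'] with ψ' hψ'
    have h1 := dualEnergy_le_add (m := m) (κ := κ) hB hBne hP hm hκ hβ ψ'.continuous ψ.continuous
      (fun x hx => (hψ' x hx).le)
    have h2 := dualEnergy_le_add (m := m) (κ := κ) hB hBne hP hm hκ hβ ψ.continuous ψ'.continuous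
      (fun x hx => by rw [abs_sub_comm]; exact (hψ' x hx).le)
    have h3 : 2 * β * (ε / (4 * β)) = ε / 2 := by field_simp; norm_num
    rw [h3] at h1 h2
    rw [Real.dist_eq, abs_lt]
    constructor <;> linarith
  obtain ⟨ψ, -, hmin⟩ := (isCompact_lipClass _ _).exists_isMinOn hne hcont
  refine ⟨ψ, ψ.continuous, fun ψ' hψ' => ?_⟩
  have hc := continuous_conjOn hB hBne hψ'
  have hcc := continuous_conjOn hP hPne hc
  have hmem : (⟨fun x => conjOn P (conjOn B ψ') x - conjOn P (conjOn B ψ') 0, by fun_prop⟩ : C(E, ℝ))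
      ∈ L := by
    refine ⟨lipschitzWith_of_increments hPne hC fun x y => ?_, by simp⟩
    have := conjOn_sub_le hP hPne hc y x
    simpa using this
  refine (hmin hmem).trans ?_
  change dualEnergy B m κ β (fun x => _) ≤ _
  simp only [ContinuousMap.coe_mk]
  rw [dualEnergy_sub_const hB hBne hP hm hκ hcc]
  exact dualEnergy_conjOn_conjOn_le hB hBne hP hPne hm hκ hβ hψ'

include hB hBne hP hm hκ hβ in
/-- First-order optimality: the conjugate is convex in the function, so along the segment from a
minimizer `χ` to `ψ` the energy grows at most by its linear part plus a quadratic error. -/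
theorem integral_add_integral_conjOn_le_of_minimizer {χ : E → ℝ} (hχ : Continuous χ)
    (hmin : ∀ ψ : E → ℝ, Continuous ψ → dualEnergy B m κ β χ ≤ dualEnergy B m κ β ψ)
    (hnorm : ∫ x, Real.exp (β * χ x) ∂m = 1) {ψ : E → ℝ} (hψ : Continuous ψ) :
    ∫ x, χ x * Real.exp (β * χ x) ∂m + ∫ p, conjOn B χ p ∂κ
      ≤ ∫ x, ψ x * Real.exp (β * χ x) ∂m + ∫ p, conjOn B ψ p ∂κ := by
  have hi : ∀ {f : E → ℝ}, Continuous f → Integrable f m := fun h =>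
    integrable_of_ae_mem_isCompact hB hm h
  have hj : ∀ {f : E → ℝ}, Continuous f → Integrable (conjOn B f) κ := fun h =>
    integrable_of_ae_mem_isCompact hP hκ (continuous_conjOn hB hBne h)
  obtain ⟨M₀, hM₀⟩ := hB.exists_bound_of_continuousOn (hψ.sub hχ).continuousOn
  set M := max M₀ 1
  have hM : ∀ x ∈ B, |ψ x - χ x| ≤ M := fun x hx => (hM₀ x hx).trans (le_max_left _ _)
  have hM1 : 1 ≤ M := le_max_right _ _
  set a := ∫ x, (ψ x - χ x) * Real.exp (β * χ x) ∂m with ha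
  set b := ∫ p, conjOn B ψ p ∂κ - ∫ p, conjOn B χ p ∂κ with hb
  have hab : a = ∫ x, ψ x * Real.exp (β * χ x) ∂m - ∫ x, χ x * Real.exp (β * χ x) ∂m := by
    rw [ha, ← integral_sub (hi (by fun_prop)) (hi (by fun_prop))]
    simp_rw [sub_mul]
  suffices h : 0 ≤ a + b by linarith
  have key : ∀ t : ℝ, 0 < t → t ≤ 1 / (β * M) → t ≤ 1 → 0 ≤ (a + b) + t * (β * M ^ 2) := by
    intro t ht htM ht1
    have h1 := hmin (fun x => χ x + t * (ψ x - χ x)) (by fun_prop)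
    have h2 : ∫ p, conjOn B (fun x => χ x + t * (ψ x - χ x)) p ∂κ
        ≤ ∫ p, conjOn B χ p ∂κ + t * b := by
      calc _ ≤ ∫ p, (conjOn B χ p + t * (conjOn B ψ p - conjOn B χ p)) ∂κ :=
            integral_mono (hj (by fun_prop)) ((hj hχ).add (((hj hψ).sub (hj hχ)).const_mul t))
              fun p => conjOn_convexCombination_le hB hBne hχ hψ ht.le ht1 p
        _ = _ := by
            have hd : Integrable (fun p => t * (conjOn B ψ p - conjOn B χ p)) κ :=
              ((hj hψ).sub (hj hχ)).const_mul t
            rw [integral_add (hj hχ) hd, integral_const_mul, integral_sub (hj hψ) (hj hχ)]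
    have h3 : ∫ x, Real.exp (β * (χ x + t * (ψ x - χ x))) ∂m
        ≤ 1 + (t * β * a + t ^ 2 * β ^ 2 * M ^ 2) := by
      have hexp : Integrable (fun x => Real.exp (β * χ x)) m := hi (by fun_prop)
      have hlin : Integrable (fun x => (ψ x - χ x) * Real.exp (β * χ x)) m := hi (by fun_prop)
      calc _ ≤ ∫ x, (Real.exp (β * χ x) + (t * β) * ((ψ x - χ x) * Real.exp (β * χ x))
              + (t ^ 2 * β ^ 2 * M ^ 2) * Real.exp (β * χ x)) ∂m := by
            refine integral_mono_ae (hi (by fun_prop)) (hi (by fun_prop)) ?_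
            filter_upwards [hm] with x hx
            have hd := hM x hx
            set d := ψ x - χ x
            have hs : |t * β * d| ≤ 1 := by
              rw [abs_mul, abs_of_pos (by positivity : 0 < t * β)]
              calc t * β * |d| ≤ t * β * M := by gcongr
                _ ≤ 1 / (β * M) * β * M := by gcongr
                _ = 1 := by field_simp
            have hq : Real.exp (t * β * d) ≤ 1 + t * β * d + (t * β * d) ^ 2 := by
              have := (abs_le.1 (Real.abs_exp_sub_one_sub_id_le hs)).2
              linarith
            have hd2 : d ^ 2 ≤ M ^ 2 := sq_le_sq' (by linarith [(abs_le.1 hd).1]) (abs_le.1 hd).2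
            have hq2 : Real.exp (t * β * d) ≤ 1 + t * β * d + t ^ 2 * β ^ 2 * M ^ 2 := by
              have : (t * β * d) ^ 2 ≤ t ^ 2 * β ^ 2 * M ^ 2 := by
                rw [mul_pow, mul_pow]; gcongr
              linarith
            have he : β * (χ x + t * d) = β * χ x + t * β * d := by ring
            rw [he, Real.exp_add]
            nlinarith [Real.exp_pos (β * χ x)]
        _ = _ := by
            have hsum : Integrable (fun x => Real.exp (β * χ x)
                + (t * β) * ((ψ x - χ x) * Real.exp (β * χ x))) m := hexp.add (hlin.const_mul _)
            rw [integral_add hsum (hexp.const_mul _),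
              integral_add hexp (hlin.const_mul _), integral_const_mul, integral_const_mul, hnorm]
            ring
    have h4 : Real.log (∫ x, Real.exp (β * (χ x + t * (ψ x - χ x))) ∂m)
        ≤ t * β * a + t ^ 2 * β ^ 2 * M ^ 2 := by
      have hpos := integral_exp_pos (μ := m) (hi (f := fun x =>
        Real.exp (β * (χ x + t * (ψ x - χ x)))) (by fun_prop))
      linarith [Real.log_le_sub_one_of_pos hpos]
    unfold dualEnergy at h1
    rw [hnorm, Real.log_one] at h1
    have h5 : 0 ≤ (t * β) * ((a + b) + t * (β * M ^ 2)) := by nlinarith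
    exact nonneg_of_mul_nonneg_right h5 (by positivity)
  have hlim : Tendsto (fun t : ℝ => (a + b) + t * (β * M ^ 2)) (𝓝[>] 0) (𝓝 (a + b)) := by
    have : Tendsto (fun t : ℝ => (a + b) + t * (β * M ^ 2)) (𝓝 0) (𝓝 ((a + b) + 0 * (β * M ^ 2))) :=
      Continuous.tendsto (by fun_prop) 0
    rw [zero_mul, add_zero] at this
    exact this.mono_left nhdsWithin_le_nhds
  refine ge_of_tendsto hlim ?_
  have hpos : 0 < min (1 / (β * M)) 1 := by positivity
  filter_upwards [Ioo_mem_nhdsGT hpos] with t ht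
  exact key t ht.1 (ht.2.le.trans (min_le_left _ _)) (ht.2.le.trans (min_le_right _ _))

include hB hBne hP hPne hm hκ hβ in
theorem exists_isOptimalPotential : ∃ χ : E → ℝ, IsOptimalPotential P B m κ β χ := by
  obtain ⟨ψ, hψ, hmin⟩ := exists_dualEnergy_minimizer (m := m) (κ := κ) hB hBne hP hPne hm hκ hβ
  have hf := continuous_conjOn hB hBne hψ
  set f := conjOn B ψ
  have hg := continuous_conjOn hP hPne hf
  set I := ∫ x, Real.exp (β * conjOn P f x) ∂m
  have hI : 0 < I := integral_exp_pos (integrable_of_ae_mem_isCompact hB hm (by fun_prop))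
  set c := Real.log I / β with hc
  have hχ : Continuous fun x => conjOn P f x - c := by fun_prop
  have hnorm : ∫ x, Real.exp (β * (conjOn P f x - c)) ∂m = 1 := by
    have : ∀ x, Real.exp (β * (conjOn P f x - c)) = Real.exp (β * conjOn P f x) * I⁻¹ := fun x => by
      rw [mul_sub, hc, mul_div_cancel₀ _ hβ.ne', Real.exp_sub, Real.exp_log hI, div_eq_mul_inv]
    simp_rw [this]
    rw [integral_mul_const]
    exact mul_inv_cancel₀ hI.ne'
  refine ⟨fun x => conjOn P f x - c, hχ, ?_, ?_, ?_, hnorm, ?_⟩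
  · have := (convexOn_conjOn hP hPne hf).add_const (-c)
    simp only [sub_eq_add_neg]
    exact this
  · intro x y
    have := conjOn_sub_le hP hPne hf y x
    simpa using this
  · intro x p hp
    rw [conjOn_sub_const hB hBne hg]
    have h1 := le_conjOn hP hf hp x
    -- on `P` the triple conjugate dominates the simple one
    have h2 : f p ≤ conjOn B (conjOn P f) p := by
      have := conjOn_le_conjOn_add (f := ψ) (ε := 0) hB hBne hg
        (fun s hs => by linarith [conjOn_conjOn_le hB hPne hψ hs]) p
      simpa using this
    linarith
  · intro ψ' hψ'
    refine integral_add_integral_conjOn_le_of_minimizer hB hBne hP hm hκ hβ hχ ?_ hnorm hψ'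
    intro ψ'' hψ''
    rw [dualEnergy_sub_const hB hBne hP hm hκ hg]
    exact (dualEnergy_conjOn_conjOn_le hB hBne hP hPne hm hκ hβ hψ).trans (hmin ψ'' hψ'')

end Variational

/-! ### Duality for the assignment problem -/

section Assignment

variable {ι : Type*} [Fintype ι] [DecidableEq ι]

/-- Integral linear programming duality for the assignment problem. A feasible pair `(a, b)` of least
total value satisfies Hall's condition for the graph of tight pairs `c i j = a i + b j`: otherwise
lowering `a` by one on a violating set and raising `b` by one on its neighbours would lower the
total value. -/
theorem exists_perm_dual_int (c : ι → ι → ℤ) :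
    ∃ (σ : Equiv.Perm ι) (a b : ι → ℤ), (∀ i j, c i j ≤ a i + b j) ∧
      ∀ i, c i (σ i) = a i + b (σ i) := by
  obtain ⟨z, ⟨a, b, hab, rfl⟩, hmin⟩ := Int.exists_least_of_bdd
    (P := fun z => ∃ a b : ι → ℤ, (∀ i j, c i j ≤ a i + b j) ∧ z = ∑ i, a i + ∑ j, b j)
    ⟨∑ i, c i i, by
      rintro _ ⟨a, b, h, rfl⟩
      rw [← Finset.sum_add_distrib]
      exact Finset.sum_le_sum fun i _ => h i i⟩
    ⟨_, fun i => ∑ j, |c i j|, 0, fun i j => by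
      have := Finset.single_le_sum (f := fun j => |c i j|) (fun j _ => abs_nonneg _)
        (Finset.mem_univ j)
      simpa using (le_abs_self (c i j)).trans this, rfl⟩
  have hall := (Finset.all_card_le_biUnion_card_iff_exists_injective
    (fun i => Finset.univ.filter fun j => c i j = a i + b j)).1 (by
      intro S
      by_contra! hlt
      set T := S.biUnion fun i => Finset.univ.filter fun j => c i j = a i + b j with hT
      have hle := hmin _ ⟨fun i => a i - if i ∈ S then 1 else 0,
        fun j => b j + if j ∈ T then 1 else 0, ?_, rfl⟩
      · simp only [Finset.sum_sub_distrib, Finset.sum_add_distrib, Finset.sum_boole] at hle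
        simp only [Finset.filter_mem_eq_inter, Finset.univ_inter] at hle
        omega
      · intro i j
        have h := hab i j
        by_cases hi : i ∈ S <;> by_cases hj : j ∈ T <;> simp only [hi, hj, if_true, if_false]
        · omega
        · have : c i j ≠ a i + b j := fun he => hj (by
            rw [hT, Finset.mem_biUnion]
            exact ⟨i, hi, by simpa using he⟩)
          omega
        · omega
        · omega)
  obtain ⟨f, hinj, hf⟩ := hall
  refine ⟨Equiv.ofBijective f (Finite.injective_iff_bijective.1 hinj), a, b, hab, fun i => ?_⟩
  simpa using hf i

/-- Real version of assignment duality, up to an arbitrarily small error. -/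
theorem exists_perm_dual (c : ι → ι → ℝ) {δ : ℝ} (hδ : 0 < δ) :
    ∃ (σ : Equiv.Perm ι) (a b : ι → ℝ), (∀ i j, c i j ≤ a i + b j) ∧
      ∑ i, a i + ∑ j, b j ≤ ∑ i, c i (σ i) + Fintype.card ι * δ := by
  obtain ⟨σ, a, b, hab, hσ⟩ := exists_perm_dual_int fun i j => ⌈c i j / δ⌉
  refine ⟨σ, fun i => δ * a i, fun j => δ * b j, fun i j => ?_, ?_⟩
  · have h1 : c i j / δ ≤ a i + b j := (Int.le_ceil _).trans (by exact_mod_cast hab i j)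
    rw [div_le_iff₀ hδ] at h1
    linarith
  · rw [← Equiv.sum_comp σ fun j => δ * (b j : ℝ), ← Finset.sum_add_distrib]
    have : (∑ i, c i (σ i)) + Fintype.card ι * δ = ∑ i, (c i (σ i) + δ) := by
      rw [Finset.sum_add_distrib]; simp
    rw [this]
    refine Finset.sum_le_sum fun i _ => ?_
    have h1 : ((⌈c i (σ i) / δ⌉ : ℤ) : ℝ) = a i + b (σ i) := by exact_mod_cast hσ i
    have h2 := Int.ceil_lt_add_one (c i (σ i) / δ)
    rw [h1] at h2
    have h3 : (a i + b (σ i) : ℝ) * δ ≤ (c i (σ i) / δ + 1) * δ := by gcongr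
    rw [add_mul (c i (σ i) / δ), div_mul_cancel₀ _ hδ.ne'] at h3
    linarith

variable {E : Type*} [NormedAddCommGroup E] [InnerProductSpace ℝ E]

/-- The optimal dual variables of a finite transport problem come from a Lipschitz function and
its conjugate. -/
theorem exists_perm_sum_conjOn_le [Nonempty ι] {B : Set E} (hBne : B.Nonempty)
    {C : NNReal} {x q : ι → E} (hq : ∀ j, ‖q j‖ ≤ C) {δ : ℝ} (hδ : 0 < δ) :
    ∃ σ : Equiv.Perm ι, ∃ ψ ∈ lipClass E C 0,
      ∑ i, ψ (x i) + ∑ j, conjOn B ψ (q j)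
        ≤ ∑ i, inner ℝ (x i) (q (σ i)) + Fintype.card ι * δ := by
  obtain ⟨σ, a, b, hab, hσ⟩ := exists_perm_dual (fun i j => inner ℝ (x i) (q j)) hδ
  set g : E → ℝ := fun y => ⨆ j, (inner ℝ y (q j) - b j) with hg
  have hle : ∀ y j, inner ℝ y (q j) - b j ≤ g y := fun y j =>
    le_ciSup (f := fun j => inner ℝ y (q j) - b j) (Set.finite_range _).bddAbove j
  have hlip : LipschitzWith C g := by
    refine LipschitzWith.of_le_add_mul C fun y z => ciSup_le fun j => ?_
    have h1 := hle z j
    have h2 : inner ℝ (y - z) (q j) ≤ C * dist y z := by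
      rw [dist_eq_norm, mul_comm]
      exact (real_inner_le_norm _ _).trans (by gcongr; exact hq j)
    rw [inner_sub_left] at h2
    linarith
  have hψlip : LipschitzWith C fun y => g y - g 0 := by
    simpa using hlip.sub (LipschitzWith.const (g 0))
  refine ⟨σ, ⟨_, hψlip.continuous⟩, ⟨hψlip, by simp⟩, ?_⟩
  refine le_trans ?_ hσ
  have h1 : ∑ i, (g (x i) - g 0) ≤ ∑ i, (a i - g 0) := Finset.sum_le_sum fun i _ => by
    have : g (x i) ≤ a i := ciSup_le fun j => by linarith [hab i j]
    linarith
  have h2 : ∑ j, conjOn B (fun y => g y - g 0) (q j) ≤ ∑ j, (b j + g 0) :=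
    Finset.sum_le_sum fun j _ => conjOn_le hBne fun y _ => by
      have := hle y j
      rw [real_inner_comm] at this
      linarith
  have h3 : ∑ i, (a i - g 0) + ∑ j, (b j + g 0) = ∑ i, a i + ∑ j, b j := by
    rw [Finset.sum_sub_distrib, Finset.sum_add_distrib]; ring
  rw [← h3]
  exact add_le_add h1 h2

/-! ### Bounds for permanents of exponentials -/

/-- The permanent of the matrix `(e^{⟨x_i, p_j⟩})`. -/
noncomputable def expPermanent (p x : ι → E) : ℝ :=
  Matrix.permanent (Matrix.of fun i j => Real.exp (inner ℝ (x i) (p j)))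

theorem expPermanent_eq (p x : ι → E) :
    expPermanent p x = ∑ σ : Equiv.Perm ι, Real.exp (∑ i, inner ℝ (x i) (p (σ i))) := by
  simp only [expPermanent, Matrix.permanent, Matrix.of_apply, ← Real.exp_sum]
  rw [← Equiv.sum_comp (Equiv.inv (Equiv.Perm ι))]
  refine Finset.sum_congr rfl fun σ _ => ?_
  rw [← Equiv.sum_comp σ]
  simp

theorem expPermanent_pos (p x : ι → E) : 0 < expPermanent p x := by
  rw [expPermanent_eq]
  exact Finset.sum_pos (fun _ _ => Real.exp_pos _) Finset.univ_nonempty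

theorem continuous_expPermanent (p : ι → E) : Continuous (expPermanent p) := by
  have : expPermanent p
      = fun x => ∑ σ : Equiv.Perm ι, Real.exp (∑ i, inner ℝ (x i) (p (σ i))) :=
    funext (expPermanent_eq p)
  rw [this]
  fun_prop

theorem sum_inner_le_log_expPermanent (p x : ι → E) (σ : Equiv.Perm ι) :
    ∑ i, inner ℝ (x i) (p (σ i)) ≤ Real.log (expPermanent p x) := by
  rw [Real.le_log_iff_exp_le (expPermanent_pos p x), expPermanent_eq]
  exact Finset.single_le_sum
    (f := fun σ : Equiv.Perm ι => Real.exp (∑ i, inner ℝ (x i) (p (σ i))))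
    (fun _ _ => (Real.exp_pos _).le) (Finset.mem_univ σ)

theorem expPermanent_le {p x : ι → E} {a b : ι → ℝ} (h : ∀ i j, inner ℝ (x i) (p j) ≤ a i + b j) :
    expPermanent p x ≤ (Fintype.card ι).factorial * Real.exp (∑ i, a i + ∑ j, b j) := by
  rw [expPermanent_eq]
  calc _ ≤ ∑ _σ : Equiv.Perm ι, Real.exp (∑ i, a i + ∑ j, b j) := by
        refine Finset.sum_le_sum fun σ _ => Real.exp_le_exp.2 ?_
        rw [← Equiv.sum_comp σ b, ← Finset.sum_add_distrib]
        exact Finset.sum_le_sum fun i _ => h i (σ i)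
    _ = _ := by simp [Fintype.card_perm]

theorem expPermanent_comp_perm (p x : ι → E) (τ : Equiv.Perm ι) :
    expPermanent p (x ∘ τ) = expPermanent p x := by
  rw [expPermanent_eq, expPermanent_eq, ← Equiv.sum_comp (Equiv.mulRight τ)]
  refine Finset.sum_congr rfl fun σ _ => ?_
  rw [← Equiv.sum_comp τ fun i => inner ℝ (x i) (p (σ i))]
  rfl

/-- Moving every point by at most `d` in the sense of all slopes `p j` changes the permanent by a
factor of at most `e^d`. -/
theorem expPermanent_le_exp_mul {p x y : ι → E} {d : ℝ}
    (h : ∀ σ : Equiv.Perm ι, ∑ i, inner ℝ (y i) (p (σ i)) ≤ d + ∑ i, inner ℝ (x i) (p (σ i))) :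
    expPermanent p y ≤ Real.exp d * expPermanent p x := by
  rw [expPermanent_eq, expPermanent_eq, Finset.mul_sum]
  refine Finset.sum_le_sum fun σ _ => ?_
  rw [← Real.exp_add]
  exact Real.exp_le_exp.2 (h σ)

end Assignment

/-! ### Log-convexity and growth of marginals -/

section LogConvex

variable {E : Type*} [AddCommGroup E] [Module ℝ E] {Ω : Type*} [MeasurableSpace Ω]

/-- A form of Hölder's inequality: integrals of log-convex functions are log-convex. -/
theorem convexOn_log_integral {m : Measure Ω} [NeZero m] {G : E → Ω → ℝ}
    (hpos : ∀ x ω, 0 < G x ω) (hint : ∀ x, Integrable (G x) m)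
    (hconv : ∀ ω, ConvexOn ℝ Set.univ fun x => Real.log (G x ω)) :
    ConvexOn ℝ Set.univ fun x => Real.log (∫ ω, G x ω ∂m) := by
  have hI : ∀ x, 0 < ∫ ω, G x ω ∂m := fun x => by
    have he : G x = fun ω => Real.exp (Real.log (G x ω)) :=
      funext fun ω => (Real.exp_log (hpos x ω)).symm
    have h := hint x
    rw [he] at h ⊢
    exact integral_exp_pos h
  refine ⟨convex_univ, fun x _ y _ a b ha hb hab => ?_⟩
  rw [Real.log_le_iff_le_exp (hI _)]
  set X := ∫ ω, G x ω ∂m with hX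
  set Y := ∫ ω, G y ω ∂m with hY
  simp only [smul_eq_mul]
  have hpt : ∀ ω, G (a • x + b • y) ω
      ≤ Real.exp (a * Real.log X + b * Real.log Y) * (a * (G x ω / X) + b * (G y ω / Y)) := by
    intro ω
    have h1 := (hconv ω).2 (Set.mem_univ x) (Set.mem_univ y) ha hb hab
    rw [Real.log_le_iff_le_exp (hpos _ _)] at h1
    refine h1.trans ?_
    have h2 := convexOn_exp.2 (Set.mem_univ (Real.log (G x ω) - Real.log X))
      (Set.mem_univ (Real.log (G y ω) - Real.log Y)) ha hb hab
    simp only [smul_eq_mul] at h2 ⊢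
    rw [Real.exp_sub, Real.exp_sub, Real.exp_log (hpos x ω), Real.exp_log (hpos y ω),
      Real.exp_log (hI x), Real.exp_log (hI y)] at h2
    calc _ = Real.exp (a * Real.log X + b * Real.log Y)
          * Real.exp (a * (Real.log (G x ω) - Real.log X)
            + b * (Real.log (G y ω) - Real.log Y)) := by
          rw [← Real.exp_add]; ring_nf
      _ ≤ _ := by gcongr
  have hi : Integrable (fun ω => a * (G x ω / X) + b * (G y ω / Y)) m :=
    (((hint x).div_const X).const_mul a).add (((hint y).div_const Y).const_mul b)
  calc _ ≤ ∫ ω, Real.exp (a * Real.log X + b * Real.log Y)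
        * (a * (G x ω / X) + b * (G y ω / Y)) ∂m :=
        integral_mono (hint _) (hi.const_mul _) hpt
    _ = Real.exp (a * Real.log X + b * Real.log Y) := by
        rw [integral_const_mul, integral_add (((hint x).div_const X).const_mul a)
          (((hint y).div_const Y).const_mul b), integral_const_mul, integral_const_mul,
          integral_div, integral_div, div_self (hI x).ne', div_self (hI y).ne', mul_one, mul_one,
          hab, mul_one]

theorem convexOn_log_sum {α : Type*} [Fintype α] [Nonempty α] {G : E → α → ℝ}
    (hpos : ∀ x a, 0 < G x a) (hconv : ∀ a, ConvexOn ℝ Set.univ fun x => Real.log (G x a)) :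
    ConvexOn ℝ Set.univ fun x => Real.log (∑ a, G x a) := by
  let : MeasurableSpace α := ⊤
  have := convexOn_log_integral (m := Measure.count) hpos (fun x => Integrable.of_finite) hconv
  simpa [integral_fintype, Integrable.of_finite] using this

end LogConvex

/-! ### The Gibbs weight -/

section Gibbs

variable {E : Type*} [NormedAddCommGroup E] [InnerProductSpace ℝ E]

section Fintype

variable {ι : Type*} [Fintype ι] [DecidableEq ι]

/-- The weight `Per(x)^{β/k}`, where `Per` is the permanent of the matrix `(e^{⟨x_i, k q_j⟩})`. -/
noncomputable def gibbsWeight (q : ι → E) (k β : ℝ) (x : ι → E) : ℝ :=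
  expPermanent (fun j => k • q j) x ^ (β / k)

variable {q : ι → E} {k β : ℝ}

theorem gibbsWeight_pos (q : ι → E) (k β : ℝ) (x : ι → E) : 0 < gibbsWeight q k β x :=
  Real.rpow_pos_of_pos (expPermanent_pos _ _) _

theorem log_gibbsWeight (q : ι → E) (k β : ℝ) (x : ι → E) :
    Real.log (gibbsWeight q k β x) = β / k * Real.log (expPermanent (fun j => k • q j) x) :=
  Real.log_rpow (expPermanent_pos _ _) _

theorem continuous_gibbsWeight (q : ι → E) (k β : ℝ) : Continuous (gibbsWeight q k β) :=
  (continuous_expPermanent _).rpow_const fun x => Or.inl (expPermanent_pos _ x).ne'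

theorem gibbsWeight_comp_perm (x : ι → E) (τ : Equiv.Perm ι) :
    gibbsWeight q k β (x ∘ τ) = gibbsWeight q k β x := by
  rw [gibbsWeight, expPermanent_comp_perm]; rfl

theorem sum_inner_le_log_gibbsWeight (hk : 0 < k) (hβ : 0 < β) (x : ι → E) (σ : Equiv.Perm ι) :
    β * ∑ i, inner ℝ (x i) (q (σ i)) ≤ Real.log (gibbsWeight q k β x) := by
  rw [log_gibbsWeight]
  calc _ = β / k * ∑ i, inner ℝ (x i) (k • q (σ i)) := by
        simp_rw [real_inner_smul_right, ← Finset.mul_sum]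
        field_simp
    _ ≤ _ := by
        gcongr
        exact sum_inner_le_log_expPermanent (fun j => k • q j) x σ

theorem gibbsWeight_le (hk : 0 < k) (hβ : 0 < β) {x : ι → E} {a b : ι → ℝ}
    (h : ∀ i j, inner ℝ (x i) (q j) ≤ a i + b j) :
    gibbsWeight q k β x ≤ ((Fintype.card ι).factorial : ℝ) ^ (β / k)
      * Real.exp (β * ∑ j, b j) * ∏ i, Real.exp (β * a i) := by
  have h1 := expPermanent_le (p := fun j => k • q j) (x := x) (a := fun i => k * a i)
    (b := fun j => k * b j) (fun i j => by
      rw [real_inner_smul_right, ← mul_add]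
      exact mul_le_mul_of_nonneg_left (h i j) hk.le)
  refine (Real.rpow_le_rpow (expPermanent_pos _ _).le h1 (by positivity)).trans (le_of_eq ?_)
  rw [Real.mul_rpow (by positivity) (by positivity), ← Real.exp_mul, mul_assoc, ← Real.exp_sum,
    ← Real.exp_add]
  simp_rw [← Finset.mul_sum]
  congr 2
  field_simp
  ring

end Fintype

variable {m : ℕ} {q : Fin (m + 1) → E} {k β : ℝ}

theorem convexOn_log_gibbsWeight_cons (hk : 0 < k) (hβ : 0 < β) (y : Fin m → E) :
    ConvexOn ℝ Set.univ fun x =>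
      Real.log (gibbsWeight q k β (Fin.cons x y : Fin (m + 1) → E)) := by
  simp_rw [log_gibbsWeight, expPermanent_eq]
  refine ConvexOn.smul (c := β / k) (by positivity) ?_
  refine convexOn_log_sum (fun _ _ => Real.exp_pos _) fun σ => ?_
  simp_rw [Real.log_exp, Fin.sum_univ_succ, Fin.cons_zero, Fin.cons_succ]
  refine ConvexOn.add_const ?_ _
  refine ⟨convex_univ, fun x _ z _ a b _ _ _ => le_of_eq ?_⟩
  simp only [inner_add_left, real_inner_smul_left, smul_eq_mul]

theorem gibbsWeight_cons_le {P : Set E} (hP : IsCompact P) (hq : ∀ j, q j ∈ P) (hk : 0 < k)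
    (hβ : 0 < β) (x z : E) (y : Fin m → E) :
    gibbsWeight q k β (Fin.cons z y : Fin (m + 1) → E)
      ≤ Real.exp (β * conjOn P (fun _ => 0) (z - x))
        * gibbsWeight q k β (Fin.cons x y : Fin (m + 1) → E) := by
  have h1 := expPermanent_le_exp_mul (p := fun j => k • q j) (x := (Fin.cons x y : Fin (m + 1) → E))
    (y := (Fin.cons z y : Fin (m + 1) → E)) (d := k * conjOn P (fun _ => 0) (z - x)) (fun σ => by
      simp only [Fin.sum_univ_succ, Fin.cons_zero, Fin.cons_succ, ← add_assoc]
      gcongr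
      have := le_conjOn (f := fun _ => (0 : ℝ)) hP continuous_const (hq (σ 0)) (z - x)
      rw [inner_sub_left, sub_zero] at this
      rw [real_inner_smul_right, real_inner_smul_right, ← mul_add]
      exact mul_le_mul_of_nonneg_left (by linarith) hk.le)
  refine (Real.rpow_le_rpow (expPermanent_pos _ _).le h1 (by positivity)).trans (le_of_eq ?_)
  rw [Real.mul_rpow (by positivity) (expPermanent_pos _ _).le, ← Real.exp_mul]
  congr 2
  field_simp

end Gibbs

/-! ### The Gibbs measure and its one-point marginal -/

section Marginal

variable {E : Type*} [NormedAddCommGroup E] [InnerProductSpace ℝ E] [FiniteDimensional ℝ E]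
  [MeasurableSpace E] [BorelSpace E]

variable {N : ℕ} {q : Fin N → E} {k β : ℝ} {P : Set E} {ν : Measure E}

/-- The normalizing constant of the Gibbs weight. -/
noncomputable def gibbsZ (q : Fin N → E) (k β : ℝ) (ν : Measure E) : ℝ :=
  ∫ x, gibbsWeight q k β x ∂(Measure.pi fun _ => ν)

/-- The function `φ` such that `e^{βφ}` is the density of the one-point marginal of the Gibbs
measure with respect to `ν`. -/
noncomputable def gibbsPotential (q : Fin N → E) (k β : ℝ) (ν : Measure E) (x : E) : ℝ :=
  1 / β * Real.log (∫ y, 1 / gibbsZ q k β ν * gibbsWeight q k β (consConfig x y)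
    ∂(Measure.pi fun _ : Fin (N - 1) => ν))

variable (hP : IsCompact P) (hq : ∀ j, q j ∈ P) (hk : 0 < k) (hβ : 0 < β)

omit [FiniteDimensional ℝ E] [MeasurableSpace E] [BorelSpace E] in
include hP hq hk hβ in
theorem gibbsWeight_le_prod_supportFunction (x : Fin N → E) :
    gibbsWeight q k β x ≤ (N.factorial : ℝ) ^ (β / k)
      * ∏ i, Real.exp (β * conjOn P (fun _ => 0) (x i)) := by
  have := gibbsWeight_le (q := q) (k := k) (β := β) (x := x)
    (a := fun i => conjOn P (fun _ => 0) (x i)) (b := fun _ => 0) hk hβ (fun i j => by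
      have := le_conjOn (f := fun _ => (0 : ℝ)) hP continuous_const (hq j) (x i)
      simpa using this)
  simpa using this

variable [SigmaFinite ν] (hint : Integrable (fun x => Real.exp (β * conjOn P (fun _ => 0) x)) ν)

include hP hq hk hβ hint in
theorem integrable_gibbsWeight :
    Integrable (gibbsWeight q k β) (Measure.pi fun _ => ν) := by
  refine Integrable.mono' ((Integrable.fintype_prod fun _ => hint).const_mul
    ((N.factorial : ℝ) ^ (β / k))) (continuous_gibbsWeight q k β).aestronglyMeasurable ?_
  refine ae_of_all _ fun x => ?_
  rw [Real.norm_of_nonneg (gibbsWeight_pos q k β x).le]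
  exact gibbsWeight_le_prod_supportFunction hP hq hk hβ x

include hP hq hk hβ hint in
theorem gibbsZ_pos [NeZero ν] : 0 < gibbsZ q k β ν := by
  have h := integrable_gibbsWeight hP hq hk hβ hint
  have : NeZero (Measure.pi fun _ : Fin N => ν) := ⟨by
    rw [← Measure.measure_univ_ne_zero, Measure.pi_univ]
    exact Finset.prod_ne_zero_iff.2 fun _ _ => Measure.measure_univ_ne_zero.2 (NeZero.ne ν)⟩
  have he : gibbsWeight q k β = fun x => Real.exp (Real.log (gibbsWeight q k β x)) :=
    funext fun x => (Real.exp_log (gibbsWeight_pos q k β x)).symm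
  unfold gibbsZ
  rw [he] at h ⊢
  exact integral_exp_pos h

omit [InnerProductSpace ℝ E] [FiniteDimensional ℝ E] [MeasurableSpace E] [BorelSpace E] in
theorem continuous_consConfig_right (x : E) :
    Continuous (consConfig x : (Fin (N - 1) → E) → (Fin N → E)) := by
  cases N with
  | zero => exact continuous_pi fun i => i.elim0
  | succ m =>
    refine continuous_pi fun i => ?_
    refine Fin.cases ?_ (fun j => ?_) i
    · exact continuous_const
    · exact continuous_apply j

include hP hq hk hβ hint in
theorem integrable_gibbsWeight_consConfig (hN : 0 < N) (x : E) :
    Integrable (fun y => gibbsWeight q k β (consConfig x y))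
      (Measure.pi fun _ : Fin (N - 1) => ν) := by
  refine Integrable.mono' ((Integrable.fintype_prod fun _ => hint).const_mul
    ((N.factorial : ℝ) ^ (β / k) * Real.exp (β * conjOn P (fun _ => 0) x)))
    ((continuous_gibbsWeight q k β).comp (continuous_consConfig_right x)).aestronglyMeasurable ?_
  refine ae_of_all _ fun y => ?_
  rw [Real.norm_of_nonneg (gibbsWeight_pos q k β _).le]
  refine (gibbsWeight_le_prod_supportFunction hP hq hk hβ _).trans (le_of_eq ?_)
  obtain ⟨m, rfl⟩ : ∃ m, N = m + 1 := ⟨N - 1, by omega⟩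
  rw [Fin.prod_univ_succ, mul_assoc]
  rfl

include hP hq hk hβ hint in
theorem integral_gibbsWeight_consConfig_pos [NeZero ν] (hN : 0 < N) (x : E) :
    0 < ∫ y, 1 / gibbsZ q k β ν * gibbsWeight q k β (consConfig x y)
      ∂(Measure.pi fun _ : Fin (N - 1) => ν) := by
  have h := integrable_gibbsWeight_consConfig hP hq hk hβ hint hN x
  have : NeZero (Measure.pi fun _ : Fin (N - 1) => ν) := ⟨by
    rw [← Measure.measure_univ_ne_zero, Measure.pi_univ]
    exact Finset.prod_ne_zero_iff.2 fun _ _ => Measure.measure_univ_ne_zero.2 (NeZero.ne ν)⟩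
  have he : (fun y => gibbsWeight q k β (consConfig x y))
      = fun y => Real.exp (Real.log (gibbsWeight q k β (consConfig x y))) :=
    funext fun y => (Real.exp_log (gibbsWeight_pos q k β _)).symm
  rw [integral_const_mul]
  refine mul_pos (one_div_pos.2 (gibbsZ_pos hP hq hk hβ hint)) ?_
  rw [he] at h ⊢
  exact integral_exp_pos h

include hP hq hk hβ hint in
theorem exp_gibbsPotential [NeZero ν] (hN : 0 < N) (x : E) :
    Real.exp (β * gibbsPotential q k β ν x)
      = ∫ y, 1 / gibbsZ q k β ν * gibbsWeight q k β (consConfig x y)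
        ∂(Measure.pi fun _ : Fin (N - 1) => ν) := by
  rw [gibbsPotential, ← mul_assoc, mul_one_div_cancel hβ.ne', one_mul,
    Real.exp_log (integral_gibbsWeight_consConfig_pos hP hq hk hβ hint hN x)]

include hP hq hk hβ hint in
theorem convexOn_gibbsPotential [NeZero ν] (hN : 0 < N) :
    ConvexOn ℝ Set.univ (gibbsPotential q k β ν) := by
  obtain ⟨m, rfl⟩ : ∃ m, N = m + 1 := ⟨N - 1, by omega⟩
  have : NeZero (Measure.pi fun _ : Fin (m + 1 - 1) => ν) := ⟨by
    rw [← Measure.measure_univ_ne_zero, Measure.pi_univ]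
    exact Finset.prod_ne_zero_iff.2 fun _ _ => Measure.measure_univ_ne_zero.2 (NeZero.ne ν)⟩
  have hZ := gibbsZ_pos hP hq hk hβ hint
  refine ConvexOn.smul (c := 1 / β) (by positivity) ?_
  refine convexOn_log_integral (fun x y => ?_) (fun x => ?_) fun y => ?_
  · exact mul_pos (one_div_pos.2 hZ) (gibbsWeight_pos _ _ _ _)
  · exact (integrable_gibbsWeight_consConfig hP hq hk hβ hint hN x).const_mul _
  · have h := (convexOn_log_gibbsWeight_cons (q := q) hk hβ y).add_const
      (Real.log (1 / gibbsZ q k β ν))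
    refine h.congr fun x _ => ?_
    rw [Real.log_mul (one_div_pos.2 hZ).ne' (gibbsWeight_pos _ _ _ _).ne', add_comm]
    rfl

include hP hq hk hβ hint in
theorem gibbsPotential_sub_le [NeZero ν] (hN : 0 < N) (x z : E) :
    gibbsPotential q k β ν z - gibbsPotential q k β ν x ≤ conjOn P (fun _ => 0) (z - x) := by
  have h : Real.exp (β * gibbsPotential q k β ν z)
      ≤ Real.exp (β * conjOn P (fun _ => 0) (z - x) + β * gibbsPotential q k β ν x) := by
    rw [Real.exp_add, exp_gibbsPotential hP hq hk hβ hint hN,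
      exp_gibbsPotential hP hq hk hβ hint hN, integral_const_mul, integral_const_mul,
      mul_left_comm,
      ← integral_const_mul (Real.exp (β * conjOn P (fun _ => 0) (z - x)))]
    refine mul_le_mul_of_nonneg_left ?_ (one_div_pos.2 (gibbsZ_pos hP hq hk hβ hint)).le
    refine integral_mono (integrable_gibbsWeight_consConfig hP hq hk hβ hint hN z)
      ((integrable_gibbsWeight_consConfig hP hq hk hβ hint hN x).const_mul _) fun y => ?_
    obtain ⟨m, rfl⟩ : ∃ m, N = m + 1 := ⟨N - 1, by omega⟩
    exact gibbsWeight_cons_le hP hq hk hβ x z y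
  rw [Real.exp_le_exp, ← mul_add] at h
  linarith [le_of_mul_le_mul_left h hβ]

end Marginal

/-! ### Product measures with densities and fluctuations of empirical sums -/

section Product

variable {Ω : Type*} [MeasurableSpace Ω] {ι : Type*} [Fintype ι]

theorem pi_withDensity_ofReal {m : Measure Ω} [SigmaFinite m] {g : Ω → ℝ} (hg : Integrable g m)
    (hg0 : ∀ x, 0 ≤ g x) :
    Measure.pi (fun _ : ι => m.withDensity fun x => ENNReal.ofReal (g x))
      = (Measure.pi fun _ : ι => m).withDensity fun x => ENNReal.ofReal (∏ i, g (x i)) := by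
  have := isFiniteMeasure_withDensity_ofReal hg.2
  refine Measure.pi_eq fun s hs => ?_
  have hi : Integrable (fun x : ι → Ω => ∏ i, g (x i))
      (Measure.pi fun i => m.restrict (s i)) := Integrable.fintype_prod fun i => hg.restrict
  rw [withDensity_apply _ (MeasurableSet.univ_pi hs), Measure.restrict_pi_pi,
    ← ofReal_integral_eq_lintegral_ofReal hi
      (ae_of_all _ fun x => Finset.prod_nonneg fun i _ => hg0 _),
    integral_fintype_prod_eq_prod fun _ => g, ENNReal.ofReal_prod_of_nonneg
      fun i _ => integral_nonneg hg0]
  refine Finset.prod_congr rfl fun i _ => ?_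
  rw [withDensity_apply _ (hs i), ofReal_integral_eq_lintegral_ofReal hg.restrict
    (ae_of_all _ hg0)]

/-- A quantitative weak law of large numbers: the expected deviation of a sum of `N` independent
copies of a bounded variable is of order `√N`. -/
theorem integral_abs_sum_sub_le {μ : Measure Ω} [IsProbabilityMeasure μ] {f : Ω → ℝ} {M : ℝ}
    (hf : Measurable f) (hM : ∀ᵐ x ∂μ, |f x| ≤ M) :
    ∫ x : ι → Ω, |∑ i, (f (x i) - ∫ y, f y ∂μ)| ∂(Measure.pi fun _ => μ)
      ≤ √(Fintype.card ι) * (1 + M ^ 2) := by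
  classical
  have hMem : MemLp f 2 μ := MemLp.of_bound hf.aestronglyMeasurable M hM
  set c := ∫ y, f y ∂μ with hc
  set S : (ι → Ω) → ℝ := fun x => ∑ i, (f (x i) - c) with hS
  have hSmem : MemLp S 2 (Measure.pi fun _ : ι => μ) := by
    have h : ∀ i : ι, MemLp (fun x : ι → Ω => f (x i) - c) 2 (Measure.pi fun _ : ι => μ) := fun i =>
      (hMem.comp_measurePreserving (measurePreserving_eval _ i)).sub (memLp_const c)
    exact memLp_finsetSum _ fun i _ => h i
  have hmean : ∫ x, S x ∂(Measure.pi fun _ : ι => μ) = 0 := by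
    rw [hS, integral_finsetSum]
    · refine Finset.sum_eq_zero fun i _ => ?_
      refine (integral_comp_eval (μ := fun _ : ι => μ) (i := i) (f := fun y => f y - c)
        (by fun_prop)).trans ?_
      rw [integral_sub (hMem.integrable (by norm_num)) (integrable_const _)]
      simp [hc]
    · intro i _
      exact integrable_comp_eval (μ := fun _ : ι => μ) (f := fun y => f y - c)
        ((hMem.integrable (by norm_num)).sub (integrable_const _))
  have hvar : ∫ x, S x ^ 2 ∂(Measure.pi fun _ : ι => μ) ≤ Fintype.card ι * M ^ 2 := by
    have h1 := ProbabilityTheory.variance_of_integral_eq_zero hSmem.aemeasurable hmean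
    have h2 := ProbabilityTheory.variance_sum_pi (μ := fun _ : ι => μ)
      (X := fun _ y => f y - c) (fun i => hMem.sub (memLp_const c))
    have h3 : (∑ i : ι, fun x : ι → Ω => f (x i) - c) = S := by
      ext x; simp [hS]
    rw [h3] at h2
    rw [← h1, h2]
    calc _ ≤ ∑ _i : ι, M ^ 2 := Finset.sum_le_sum fun i _ => ?_
      _ = _ := by simp
    have h4 : ProbabilityTheory.variance (fun y => f y - c) μ = ProbabilityTheory.variance f μ :=
      ProbabilityTheory.variance_sub_const hf.aestronglyMeasurable c
    rw [h4]
    refine (ProbabilityTheory.variance_le_expectation_sq hf.aestronglyMeasurable).trans ?_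
    calc _ ≤ ∫ _, M ^ 2 ∂μ := by
          refine integral_mono_ae hMem.integrable_sq (integrable_const _) ?_
          filter_upwards [hM] with x hx
          exact sq_le_sq' (by linarith [(abs_le.1 hx).1]) (abs_le.1 hx).2
      _ = _ := by simp
  rcases isEmpty_or_nonempty ι with he | hne
  · simp
  have hN : 0 < √(Fintype.card ι : ℝ) := Real.sqrt_pos.2 (by exact_mod_cast Fintype.card_pos)
  have hN2 : √(Fintype.card ι : ℝ) ^ 2 = Fintype.card ι := Real.sq_sqrt (by positivity)
  set r := √(Fintype.card ι : ℝ)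
  -- `|S| ≤ r + S² / r` for every positive `r`
  calc ∫ x, |S x| ∂(Measure.pi fun _ : ι => μ)
      ≤ ∫ x, (r + S x ^ 2 / r) ∂(Measure.pi fun _ : ι => μ) := by
        refine integral_mono (hSmem.integrable (by norm_num)).abs
          ((integrable_const _).add (hSmem.integrable_sq.div_const r)) fun x => ?_
        have h : |S x| * r ≤ r * r + S x ^ 2 := by
          have := sq_abs (S x)
          nlinarith [sq_nonneg (|S x| - r), abs_nonneg (S x)]
        have h2 : r + S x ^ 2 / r = (r * r + S x ^ 2) / r := by field_simp
        change |S x| ≤ r + S x ^ 2 / r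
        rw [h2, le_div_iff₀ hN]
        exact h
    _ = r + (∫ x, S x ^ 2 ∂(Measure.pi fun _ : ι => μ)) / r := by
        rw [integral_add (integrable_const _) (hSmem.integrable_sq.div_const r), integral_div]
        simp
    _ ≤ r + (Fintype.card ι * M ^ 2) / r := by gcongr
    _ = _ := by rw [← hN2]; field_simp

/-- Jensen's inequality for the exponential. -/
theorem integral_le_log_integral_exp {μ : Measure Ω} [IsProbabilityMeasure μ] {Y : Ω → ℝ}
    (hY : Integrable Y μ) (he : Integrable (fun x => Real.exp (Y x)) μ) :
    ∫ x, Y x ∂μ ≤ Real.log (∫ x, Real.exp (Y x) ∂μ) := by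
  rw [Real.le_log_iff_exp_le (integral_exp_pos he)]
  exact convexOn_exp.map_integral_le Real.continuous_exp.continuousOn isClosed_univ
    (ae_of_all _ fun _ => Set.mem_univ _) hY he

end Product

/-! ### Lower bound for the partition function -/

section LowerBound

variable {E : Type*} [NormedAddCommGroup E] [InnerProductSpace ℝ E]

omit [InnerProductSpace ℝ E] in
theorem exists_finset_lipClass_net (C M : NNReal) {B : Set E} (hB : IsCompact B) {ε : ℝ}
    (hε : 0 < ε) :
    ∃ F : Finset C(E, ℝ), ∀ ψ ∈ lipClass E C M, ∃ ψ' ∈ F, ∀ y ∈ B, |ψ y - ψ' y| < ε := by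
  obtain ⟨F, -, hF⟩ := (isCompact_lipClass (E := E) C M).elim_nhds_subcover
    (fun ψ' => {ψ | ∀ y ∈ B, |ψ y - ψ' y| < ε}) fun ψ' _ => eventually_nhds_dist_lt hB ψ' hε
  refine ⟨F, fun ψ hψ => ?_⟩
  have := hF hψ
  simp only [Set.mem_iUnion] at this
  obtain ⟨ψ', hψ', h⟩ := this
  exact ⟨ψ', hψ', h⟩

/-- By assignment duality the logarithm of the largest term of the permanent is nearly the dual value
at some Lipschitz potential, which may be taken from a finite `ε`-net `F`. -/
theorem exists_le_log_gibbsWeight {ι : Type*} [Fintype ι] [DecidableEq ι] [Nonempty ι]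
    {B : Set E} (hB : IsCompact B) (hBne : B.Nonempty) {C : NNReal} {q : ι → E}
    (hq : ∀ j, ‖q j‖ ≤ C) {k β : ℝ} (hk : 0 < k) (hβ : 0 < β) {ε : ℝ} (hε : 0 < ε)
    {F : Finset C(E, ℝ)}
    (hF : ∀ ψ ∈ lipClass E C 0, ∃ ψ' ∈ F, ∀ y ∈ B, |ψ y - ψ' y| < ε)
    {x : ι → E} (hx : ∀ i, x i ∈ B) :
    ∃ ψ ∈ F, β * (∑ i, ψ (x i) + ∑ j, conjOn B ψ (q j) - 3 * Fintype.card ι * ε)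
      ≤ Real.log (gibbsWeight q k β x) := by
  obtain ⟨σ, ψ, hψ, hσ⟩ := exists_perm_sum_conjOn_le (x := x) hBne hq hε
  obtain ⟨ψ', hψ', hd⟩ := hF ψ hψ
  refine ⟨ψ', hψ', le_trans ?_ (sum_inner_le_log_gibbsWeight hk hβ x σ)⟩
  gcongr
  have h1 : ∑ i, ψ' (x i) ≤ ∑ i, (ψ (x i) + ε) :=
    Finset.sum_le_sum fun i _ => by linarith [(abs_lt.1 (hd _ (hx i))).1]
  have h2 : ∑ j, conjOn B ψ' (q j) ≤ ∑ j, (conjOn B ψ (q j) + ε) :=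
    Finset.sum_le_sum fun j _ => conjOn_le_conjOn_add hB hBne ψ.continuous
      (fun s hs => by linarith [(abs_lt.1 (hd s hs)).2]) _
  simp only [Finset.sum_add_distrib, Finset.sum_const, Finset.card_univ, nsmul_eq_mul] at h1 h2
  linarith

variable [FiniteDimensional ℝ E] [MeasurableSpace E] [BorelSpace E]

/-- Jensen's inequality for the Gibbs weight with respect to the trial measure `(e^{βχ} m)^{⊗N}`. -/
theorem integral_log_gibbsWeight_le {N : ℕ} (q : Fin N → E) (k : ℝ) {β : ℝ} {B : Set E}
    (hB : IsCompact B) {m : Measure E} [IsFiniteMeasure m] (hm : ∀ᵐ x ∂m, x ∈ B)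
    {χ : E → ℝ} (hχ : Continuous χ) {μ : Measure E} [IsProbabilityMeasure μ]
    (hμ : μ = m.withDensity fun x => ENNReal.ofReal (Real.exp (β * χ x))) :
    ∫ x : Fin N → E, (Real.log (gibbsWeight q k β x) - β * ∑ i, χ (x i)) ∂(Measure.pi fun _ => μ)
      ≤ Real.log (gibbsZ q k β m) := by
  have hlog : Continuous fun x => Real.log (gibbsWeight q k β x) :=
    (continuous_gibbsWeight q k β).log fun x => (gibbsWeight_pos q k β x).ne'
  have hμB : ∀ᵐ x ∂μ, x ∈ B := by
    rw [hμ]; exact (withDensity_absolutelyContinuous m _).ae_le hm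
  have hpi : ∀ᵐ x ∂(Measure.pi fun _ : Fin N => μ), x ∈ Set.univ.pi fun _ => B := by
    have : ∀ i : Fin N, ∀ᵐ x ∂(Measure.pi fun _ : Fin N => μ), x i ∈ B := fun i =>
      (Measure.quasiMeasurePreserving_eval (μ := fun _ : Fin N => μ) i).ae hμB
    filter_upwards [ae_all_iff.2 this] with x hx i _ using hx i
  have hBpi : IsCompact (Set.univ.pi fun _ : Fin N => B) := isCompact_univ_pi fun _ => hB
  have hi : ∀ {f : (Fin N → E) → ℝ}, Continuous f → Integrable f (Measure.pi fun _ => μ) :=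
    fun hf => integrable_of_ae_mem_isCompact hBpi hpi hf
  have hexp : Integrable (fun x => Real.exp (β * χ x)) m :=
    integrable_of_ae_mem_isCompact hB hm (by fun_prop)
  refine (integral_le_log_integral_exp (hi (by fun_prop)) (hi (by fun_prop))).trans (le_of_eq ?_)
  congr 1
  have hmeas : Measurable fun x : Fin N → E =>
      (∏ i, Real.exp (β * χ (x i))).toNNReal :=
    (Continuous.measurable (by fun_prop)).real_toNNReal
  rw [hμ, pi_withDensity_ofReal hexp fun _ => (Real.exp_pos _).le]
  refine (integral_withDensity_eq_integral_smul hmeas _).trans ?_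
  refine integral_congr_ae (ae_of_all _ fun x => ?_)
  have hpos : 0 < ∏ i, Real.exp (β * χ (x i)) := Finset.prod_pos fun _ _ => Real.exp_pos _
  simp only [NNReal.smul_def, smul_eq_mul, Real.coe_toNNReal _ hpos.le]
  rw [Real.exp_sub, Real.exp_log (gibbsWeight_pos q k β x), Finset.mul_sum, Real.exp_sum]
  field_simp

variable {B : Set E} {m κ : Measure E} [IsFiniteMeasure m] {β : ℝ}

/-- Under the trial measure the empirical sums of the finitely many potentials in the net `F` are
close to their means, and there the dual value is at least the one at `χ` by optimality. -/
theorem le_log_gibbsZ_of_net (hB : IsCompact B) (hBne : B.Nonempty) (hm : ∀ᵐ x ∂m, x ∈ B)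
    (hβ : 0 < β) {P : Set E} {χ : E → ℝ} (hχ : IsOptimalPotential P B m κ β χ)
    {C : NNReal} {N : ℕ} (hN : 0 < N) {q : Fin N → E} (hq : ∀ j, ‖q j‖ ≤ C) {k : ℝ} (hk : 0 < k)
    {ε : ℝ} (hε : 0 < ε) {F : Finset C(E, ℝ)}
    (hF : ∀ ψ ∈ lipClass E C 0, ∃ ψ' ∈ F, ∀ y ∈ B, |ψ y - ψ' y| < ε)
    {M : ℝ} (hM : ∀ ψ ∈ F, ∀ y ∈ B, |ψ y| ≤ M)
    (hR : ∀ ψ ∈ F, N * (∫ p, conjOn B ψ p ∂κ - ε) ≤ ∑ j, conjOn B ψ (q j)) :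
    β * (N * (∫ p, conjOn B χ p ∂κ - 4 * ε) - F.card * (√N * (1 + M ^ 2)))
      ≤ Real.log (gibbsZ q k β m) := by
  have hχc := hχ.continuous
  have hexp : Integrable (fun x => Real.exp (β * χ x)) m :=
    integrable_of_ae_mem_isCompact hB hm (by fun_prop)
  set μ := m.withDensity fun x => ENNReal.ofReal (Real.exp (β * χ x)) with hμ
  have : IsProbabilityMeasure μ := ⟨by
    rw [hμ, withDensity_apply _ MeasurableSet.univ, Measure.restrict_univ,
      ← ofReal_integral_eq_lintegral_ofReal hexp (ae_of_all _ fun _ => (Real.exp_pos _).le),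
      hχ.normalized,
      ENNReal.ofReal_one]⟩
  have hμint : ∀ f : E → ℝ, ∫ x, f x ∂μ = ∫ x, f x * Real.exp (β * χ x) ∂m := fun f => by
    have hmeas : Measurable fun x : E => (Real.exp (β * χ x)).toNNReal :=
      (Continuous.measurable (by fun_prop)).real_toNNReal
    refine (integral_withDensity_eq_integral_smul hmeas f).trans ?_
    refine integral_congr_ae (ae_of_all _ fun x => ?_)
    simp only [NNReal.smul_def, smul_eq_mul, Real.coe_toNNReal _ (Real.exp_pos _).le, mul_comm]
  have hμB : ∀ᵐ x ∂μ, x ∈ B := (withDensity_absolutelyContinuous m _).ae_le hm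
  have hpiB : ∀ᵐ x ∂(Measure.pi fun _ : Fin N => μ), ∀ i, x i ∈ B := ae_all_iff.2 fun i =>
    (Measure.quasiMeasurePreserving_eval (μ := fun _ : Fin N => μ) i).ae hμB
  have hi : ∀ {f : (Fin N → E) → ℝ}, Continuous f → Integrable f (Measure.pi fun _ => μ) := by
    intro f hf
    refine integrable_of_ae_mem_isCompact (isCompact_univ_pi fun _ : Fin N => hB) ?_ hf
    filter_upwards [hpiB] with x hx i _ using hx i
  refine le_trans ?_ (integral_log_gibbsWeight_le q k hB hm hχc hμ)
  set D : C(E, ℝ) → (Fin N → E) → ℝ := fun ψ x => ∑ i, (ψ (x i) - ∫ y, ψ y ∂μ) with hD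
  have hDc : ∀ ψ, Continuous (D ψ) := fun ψ => by fun_prop
  set T := ∫ x, χ x ∂μ + ∫ p, conjOn B χ p ∂κ with hT
  have hpt : ∀ᵐ x ∂(Measure.pi fun _ : Fin N => μ),
      β * (N * (T - 4 * ε) - ∑ ψ ∈ F, |D ψ x| - ∑ i, χ (x i))
        ≤ Real.log (gibbsWeight q k β x) - β * ∑ i, χ (x i) := by
    filter_upwards [hpiB] with x hx
    have : Nonempty (Fin N) := ⟨⟨0, hN⟩⟩
    obtain ⟨ψ, hψ, hle⟩ := exists_le_log_gibbsWeight hB hBne hq hk hβ hε hF hx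
    have h1 := hR ψ hψ
    have h2 := hχ.optimal ψ ψ.continuous
    rw [← hμint, ← hμint] at h2
    have h3 : |D ψ x| ≤ ∑ ψ ∈ F, |D ψ x| :=
      Finset.single_le_sum (f := fun ψ => |D ψ x|) (fun _ _ => abs_nonneg _) hψ
    have h4 : ∑ i, ψ (x i) = D ψ x + N * ∫ y, ψ y ∂μ := by
      simp [hD, Finset.sum_sub_distrib]
    rw [Fintype.card_fin, h4] at hle
    have h5 := neg_abs_le (D ψ x)
    have h6 : (N : ℝ) * T ≤ N * (∫ x, ψ x ∂μ + ∫ p, conjOn B ψ p ∂κ) := by gcongr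
    have h7 : N * (T - 4 * ε) - ∑ ψ ∈ F, |D ψ x|
        ≤ D ψ x + N * ∫ y, ψ y ∂μ + ∑ j, conjOn B ψ (q j) - 3 * N * ε := by
      nlinarith
    have h8 := mul_le_mul_of_nonneg_left h7 hβ.le
    linarith
  refine le_trans ?_ (integral_mono_ae (hi (by fun_prop)) ?_ hpt)
  · have hDabs : Integrable (fun x => ∑ ψ ∈ F, |D ψ x|) (Measure.pi fun _ : Fin N => μ) :=
      hi (by fun_prop)
    have hsum : Integrable (fun x : Fin N → E => ∑ i, χ (x i)) (Measure.pi fun _ => μ) :=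
      hi (by fun_prop)
    have hdiff : Integrable (fun x => N * (T - 4 * ε) - ∑ ψ ∈ F, |D ψ x|)
        (Measure.pi fun _ : Fin N => μ) := (integrable_const _).sub hDabs
    rw [integral_const_mul, integral_sub hdiff hsum,
      integral_sub (integrable_const _) hDabs]
    have h1 : ∫ x : Fin N → E, ∑ i, χ (x i) ∂(Measure.pi fun _ => μ) = N * ∫ x, χ x ∂μ := by
      rw [integral_finsetSum _ fun i _ => hi (by fun_prop)]
      simp_rw [integral_comp_eval (μ := fun _ : Fin N => μ) (f := χ) hχc.aestronglyMeasurable]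
      simp
    have h2 : ∫ x, ∑ ψ ∈ F, |D ψ x| ∂(Measure.pi fun _ : Fin N => μ)
        ≤ F.card * (√N * (1 + M ^ 2)) := by
      rw [integral_finsetSum _ fun ψ _ => hi (by fun_prop), ← nsmul_eq_mul]
      refine Finset.sum_le_card_nsmul _ _ _ fun ψ hψ => ?_
      have := integral_abs_sum_sub_le (ι := Fin N) (μ := μ) ψ.continuous.measurable
        (hμB.mono fun y hy => hM ψ hψ y hy)
      rwa [Fintype.card_fin] at this
    rw [h1]
    simp only [integral_const, probReal_univ, one_smul]
    refine mul_le_mul_of_nonneg_left ?_ hβ.le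
    rw [hT]
    linarith
  · exact hi ((((continuous_gibbsWeight q k β).log fun x => (gibbsWeight_pos q k β x).ne')).sub
      (by fun_prop))

/-- Lower bound for the partition function. The fluctuations are of order `√N` for a fixed net, hence
negligible with respect to `N`. -/
theorem eventually_le_log_gibbsZ (hB : IsCompact B) (hBne : B.Nonempty) (hm : ∀ᵐ x ∂m, x ∈ B)
    (hβ : 0 < β) {P : Set E} {χ : E → ℝ} (hχ : IsOptimalPotential P B m κ β χ)
    {C : NNReal} {N : ℕ → ℕ} (hN : Tendsto N atTop atTop) {q : ∀ k, Fin (N k) → E}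
    (hq : ∀ᶠ k in atTop, ∀ j, ‖q k j‖ ≤ C)
    (hR : ∀ f : E → ℝ, Continuous f →
      Tendsto (fun k => (∑ j, f (q k j)) / N k) atTop (𝓝 (∫ p, f p ∂κ)))
    {ε : ℝ} (hε : 0 < ε) :
    ∀ᶠ k : ℕ in atTop, N k * (β * ∫ p, conjOn B χ p ∂κ - ε) ≤ Real.log (gibbsZ (q k) k β m) := by
  set δ := ε / (5 * β) with hδ
  have hδ0 : 0 < δ := by positivity
  obtain ⟨F, hF⟩ := exists_finset_lipClass_net C 0 hB hδ0
  have hM : ∃ M : ℝ, ∀ ψ ∈ F, ∀ y ∈ B, |ψ y| ≤ M := by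
    choose M hM using fun ψ : C(E, ℝ) => hB.exists_bound_of_continuousOn ψ.continuous.continuousOn
    obtain ⟨M', hM'⟩ := (F.image M).exists_le
    exact ⟨M', fun ψ hψ y hy => (hM ψ y hy).trans (hM' _ (Finset.mem_image_of_mem M hψ))⟩
  obtain ⟨M, hM⟩ := hM
  have hRF : ∀ᶠ k in atTop, ∀ ψ ∈ F, ∫ p, conjOn B ψ p ∂κ - δ < (∑ j, conjOn B ψ (q k j)) / N k :=
    (Finset.eventually_all F).2 fun ψ _ =>
      (hR _ (continuous_conjOn hB hBne ψ.continuous)).eventually (lt_mem_nhds (by linarith))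
  have hsqrt : ∀ᶠ k in atTop, F.card * (1 + M ^ 2) / δ ≤ √(N k) :=
    (Real.tendsto_sqrt_atTop.comp (tendsto_natCast_atTop_atTop.comp hN)).eventually_ge_atTop _
  filter_upwards [hRF, hsqrt, hq, hN.eventually_gt_atTop 0, eventually_gt_atTop 0]
    with k h1 h2 h3 h4 h5
  have hNk : (0 : ℝ) < N k := by exact_mod_cast h4
  refine le_trans ?_ (le_log_gibbsZ_of_net hB hBne hm hβ hχ h4 h3
    (by exact_mod_cast h5) hδ0 hF hM fun ψ hψ => ?_)
  · rw [div_le_iff₀ hδ0] at h2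
    have h6 : F.card * (√(N k) * (1 + M ^ 2)) ≤ N k * δ := by
      calc F.card * (√(N k) * (1 + M ^ 2)) = √(N k) * (F.card * (1 + M ^ 2)) := by ring
        _ ≤ √(N k) * (√(N k) * δ) := by gcongr
        _ = N k * δ := by rw [← mul_assoc, Real.mul_self_sqrt hNk.le]
    have h7 : ε = 5 * β * δ := by rw [hδ]; field_simp
    rw [h7]
    have := mul_le_mul_of_nonneg_left h6 hβ.le
    linarith
  · have := (h1 ψ hψ).le
    rw [le_div_iff₀ hNk] at this
    linarith

omit [FiniteDimensional ℝ E] [BorelSpace E] in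
/-- Restricting the reference measure to `B` lowers the normalizing constant. -/
theorem gibbsZ_restrict_le {N : ℕ} {q : Fin N → E} {k : ℝ} {ν : Measure E} [SigmaFinite ν]
    (hint : Integrable (gibbsWeight q k β) (Measure.pi fun _ => ν)) :
    gibbsZ q k β (ν.restrict B) ≤ gibbsZ q k β ν := by
  unfold gibbsZ
  rw [← Measure.restrict_pi_pi]
  exact integral_mono_measure Measure.restrict_le_self
    (ae_of_all _ fun x => (gibbsWeight_pos q k β x).le) hint

end LowerBound

/-! ### Upper bound for the Gibbs measure and its consequences for the marginal -/

section UpperBound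

variable {E : Type*} [NormedAddCommGroup E] [InnerProductSpace ℝ E]

theorem log_factorial_le (N : ℕ) : Real.log (N.factorial : ℝ) ≤ N * Real.log N := by
  rw [← Real.log_pow]
  exact Real.log_le_log (by exact_mod_cast N.factorial_pos) (by exact_mod_cast N.factorial_le_pow)

/-- The permanent sums `N!` terms, but `(N!)^{β/k} = e^{o(N)}`, so the Gibbs density is bounded by a
product density up to a factor `e^{o(N)}`. -/
theorem eventually_gibbsWeight_le [MeasurableSpace E] {κ ν : Measure E} {β : ℝ} (hβ : 0 < β)
    {N : ℕ → ℕ} (hN : ∀ᶠ k in atTop, 0 < N k) {q : ∀ k, Fin (N k) → E}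
    (hlog : Tendsto (fun k : ℕ => Real.log (N k) / k) atTop (𝓝 0)) {χ f : E → ℝ}
    (hχf : ∀ᶠ k in atTop, ∀ x j, inner ℝ x (q k j) ≤ χ x + f (q k j))
    (hR : Tendsto (fun k => (∑ j, f (q k j)) / N k) atTop (𝓝 (∫ p, f p ∂κ)))
    (hZ0 : ∀ᶠ k : ℕ in atTop, 0 < gibbsZ (q k) k β ν)
    (hZ : ∀ ε > 0, ∀ᶠ k : ℕ in atTop,
      N k * (β * ∫ p, f p ∂κ - ε) ≤ Real.log (gibbsZ (q k) k β ν))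
    {ε : ℝ} (hε : 0 < ε) :
    ∀ᶠ k : ℕ in atTop, ∀ x, gibbsWeight (q k) k β x
      ≤ gibbsZ (q k) k β ν * Real.exp (N k * ε) * ∏ i, Real.exp (β * χ (x i)) := by
  have h1 : ∀ᶠ k : ℕ in atTop, Real.log (N k) / k < ε / 3 / β :=
    hlog.eventually (gt_mem_nhds (by positivity))
  have h2 : ∀ᶠ k in atTop, (∑ j, f (q k j)) / N k < ∫ p, f p ∂κ + ε / 3 / β :=
    hR.eventually (gt_mem_nhds (by linarith [show 0 < ε / 3 / β by positivity]))
  filter_upwards [h1, h2, hZ (ε / 3) (by positivity), hZ0, hχf, hN, eventually_gt_atTop 0]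
    with k h1 h2 h3 h4 h5 h6 h7 x
  have hk : (0 : ℝ) < k := by exact_mod_cast h7
  have hNk : (0 : ℝ) < N k := by exact_mod_cast h6
  have hw := gibbsWeight_le (q := q k) (k := k) (β := β) (x := x) (a := fun i => χ (x i))
    (b := fun j => f (q k j)) hk hβ fun i j => h5 (x i) j
  refine hw.trans ?_
  refine mul_le_mul_of_nonneg_right ?_ (Finset.prod_nonneg fun _ _ => (Real.exp_pos _).le)
  rw [Fintype.card_fin]
  have hfac : (0 : ℝ) < (N k).factorial := by exact_mod_cast (N k).factorial_pos
  rw [← Real.log_le_log_iff (by positivity) (by positivity), Real.log_mul (by positivity)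
    (by positivity), Real.log_mul h4.ne' (by positivity), Real.log_exp, Real.log_exp,
    Real.log_rpow hfac]
  have h8 : β / k * Real.log (N k).factorial ≤ N k * (ε / 3) := by
    have h9 := log_factorial_le (N k)
    rw [div_lt_div_iff₀ hk hβ] at h1
    calc β / k * Real.log (N k).factorial ≤ β / k * (N k * Real.log (N k)) := by gcongr
      _ = N k * (Real.log (N k) * β / k) := by ring
      _ ≤ N k * (ε / 3) := by
        refine mul_le_mul_of_nonneg_left ?_ hNk.le
        rw [div_le_iff₀ hk]
        exact h1.le
  have h10 : β * ∑ j, f (q k j) ≤ N k * (β * ∫ p, f p ∂κ + ε / 3) := by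
    rw [div_lt_iff₀ hNk] at h2
    calc β * ∑ j, f (q k j) ≤ β * ((∫ p, f p ∂κ + ε / 3 / β) * N k) := by gcongr
      _ = _ := by field_simp
  linarith

variable [FiniteDimensional ℝ E] [MeasurableSpace E] [BorelSpace E]
variable {P : Set E} {ν : Measure E} [SigmaFinite ν] [NeZero ν] {k β : ℝ} {N : ℕ} {q : Fin N → E}
  (hP : IsCompact P) (hq : ∀ j, q j ∈ P) (hk : 0 < k) (hβ : 0 < β)
  (hint : Integrable (fun x => Real.exp (β * conjOn P (fun _ => 0) x)) ν)

include hP hk hβ hint in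
/-- Fubini: the first marginal of the Gibbs measure has density `e^{βφ}` with respect to `ν`. -/
theorem integral_mul_exp_gibbsPotential_zero {m : ℕ} {q : Fin (m + 1) → E}
    (hq : ∀ j, q j ∈ P) {F : E → ℝ} {M : ℝ} (hF : Continuous F) (hM : ∀ x, |F x| ≤ M) :
    ∫ x, F x * Real.exp (β * gibbsPotential q k β ν x) ∂ν
      = ∫ x : Fin (m + 1) → E, F (x 0) * (1 / gibbsZ q k β ν * gibbsWeight q k β x)
        ∂(Measure.pi fun _ => ν) := by
  have hw := (integrable_gibbsWeight hP hq hk hβ hint).const_mul (1 / gibbsZ q k β ν)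
  have hG : Integrable (fun x : Fin (m + 1) → E =>
      F (x 0) * (1 / gibbsZ q k β ν * gibbsWeight q k β x)) (Measure.pi fun _ => ν) :=
    hw.bdd_mul (by fun_prop : Continuous fun x : Fin (m + 1) → E => F (x 0)).aestronglyMeasurable
      (ae_of_all _ fun x => hM (x 0))
  have hmp := (measurePreserving_piFinSuccAbove (fun _ : Fin (m + 1) => ν) 0).symm
  rw [← hmp.integral_comp', integral_prod]
  · refine integral_congr_ae (ae_of_all _ fun x => ?_)
    simp only [MeasurableEquiv.piFinSuccAbove_symm_apply, Fin.insertNthEquiv_zero,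
      Fin.consEquiv_apply, Fin.cons_zero]
    rw [integral_const_mul, exp_gibbsPotential hP hq hk hβ hint m.succ_pos]
    rfl
  · exact (hmp.integrable_comp_emb (MeasurableEquiv.measurableEmbedding _)).2 hG

include hP hq hk hβ hint in
/-- By symmetry all one-point marginals of the Gibbs measure agree. -/
theorem integral_mul_exp_gibbsPotential {F : E → ℝ} {M : ℝ} (hF : Continuous F)
    (hM : ∀ x, |F x| ≤ M) (i : Fin N) :
    ∫ x, F x * Real.exp (β * gibbsPotential q k β ν x) ∂ν
      = ∫ x : Fin N → E, F (x i) * (1 / gibbsZ q k β ν * gibbsWeight q k β x)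
        ∂(Measure.pi fun _ => ν) := by
  obtain ⟨m, rfl⟩ : ∃ m, N = m + 1 := ⟨N - 1, by have := i.2; omega⟩
  rw [integral_mul_exp_gibbsPotential_zero hP hk hβ hint hq hF hM]
  have hmp := measurePreserving_piCongrLeft (fun _ : Fin (m + 1) => ν) (Equiv.swap 0 i)
  rw [← hmp.integral_comp']
  refine integral_congr_ae (ae_of_all _ fun x => ?_)
  have hx : MeasurableEquiv.piCongrLeft (fun _ => E) (Equiv.swap 0 i) x
      = x ∘ Equiv.swap 0 i := by
    ext j
    rw [MeasurableEquiv.coe_piCongrLeft]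
    have := Equiv.piCongrLeft_apply_apply (fun _ => E) (Equiv.swap 0 i) x (Equiv.swap 0 i j)
    rwa [Equiv.swap_apply_self] at this
  simp only [hx, gibbsWeight_comp_perm, Function.comp_apply, Equiv.swap_apply_left]

include hP hq hk hβ hint in
theorem integral_exp_gibbsPotential (hN : 0 < N) :
    ∫ x, Real.exp (β * gibbsPotential q k β ν x) ∂ν = 1 := by
  have h := integral_mul_exp_gibbsPotential hP hq hk hβ hint (F := fun _ => 1) (M := 1)
    continuous_const (fun _ => by simp) ⟨0, hN⟩
  simp only [one_mul] at h
  rw [h, integral_const_mul]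
  exact one_div_mul_cancel (gibbsZ_pos hP hq hk hβ hint).ne'

include hP hq hk hβ hint in
/-- Entropy bound: if the Gibbs density is at most `e^{Nε}` times the product density
`∏ e^{βχ(x_i)}`, then Jensen's inequality bounds the integral of `u` against the marginal. -/
theorem integral_mul_exp_gibbsPotential_le (hN : 0 < N) {χ : E → ℝ}
    (hχint : Integrable (fun x => Real.exp (β * χ x)) ν) {ε : ℝ}
    (hw : ∀ x, gibbsWeight q k β x
      ≤ gibbsZ q k β ν * Real.exp (N * ε) * ∏ i, Real.exp (β * χ (x i)))
    {u : E → ℝ} {M : ℝ} (hu : Continuous u) (hM : ∀ x, |u x| ≤ M) :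
    ∫ x, u x * Real.exp (β * gibbsPotential q k β ν x) ∂ν
      ≤ ε + Real.log (∫ x, Real.exp (u x) * Real.exp (β * χ x) ∂ν) := by
  have hZ := gibbsZ_pos hP hq hk hβ hint
  have hNR : (0 : ℝ) < N := by exact_mod_cast hN
  set ρ : (Fin N → E) → ℝ := fun x => 1 / gibbsZ q k β ν * gibbsWeight q k β x with hρ
  have hρ0 : ∀ x, 0 < ρ x := fun x => mul_pos (one_div_pos.2 hZ) (gibbsWeight_pos q k β x)
  have hρi : Integrable ρ (Measure.pi fun _ => ν) :=
    (integrable_gibbsWeight hP hq hk hβ hint).const_mul _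
  have hρ1 : ∫ x, ρ x ∂(Measure.pi fun _ => ν) = 1 := by
    rw [hρ, integral_const_mul]; exact one_div_mul_cancel hZ.ne'
  set S : (Fin N → E) → ℝ := fun x => ∑ i, u (x i) with hS
  have hSc : Continuous S := by fun_prop
  have hSb : ∀ x, |S x| ≤ N * M := fun x => by
    refine (Finset.abs_sum_le_sum_abs _ _).trans ?_
    simpa using Finset.sum_le_card_nsmul Finset.univ (fun i => |u (x i)|) M fun i _ => hM (x i)
  have hSρ : Integrable (fun x => S x * ρ x) (Measure.pi fun _ => ν) :=
    hρi.bdd_mul hSc.aestronglyMeasurable (ae_of_all _ hSb)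
  have heSρ : Integrable (fun x => Real.exp (S x) * ρ x) (Measure.pi fun _ => ν) := by
    refine hρi.bdd_mul (c := Real.exp (N * M)) (by fun_prop : Continuous fun x =>
      Real.exp (S x)).aestronglyMeasurable (ae_of_all _ fun x => ?_)
    rw [Real.norm_of_nonneg (Real.exp_pos _).le]
    exact Real.exp_le_exp.2 ((le_abs_self _).trans (hSb x))
  have hsum : ∫ x, S x * ρ x ∂(Measure.pi fun _ => ν)
      = N * ∫ x, u x * Real.exp (β * gibbsPotential q k β ν x) ∂ν := by
    simp only [hS, Finset.sum_mul]
    rw [integral_finsetSum]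
    · rw [Finset.sum_congr rfl fun i _ =>
        (integral_mul_exp_gibbsPotential hP hq hk hβ hint hu hM i).symm]
      simp
    · intro i _
      exact hρi.bdd_mul (by fun_prop : Continuous fun x : Fin N → E => u (x i)).aestronglyMeasurable
        (ae_of_all _ fun x => hM (x i))
  have hI : Integrable (fun x => Real.exp (u x) * Real.exp (β * χ x)) ν := by
    refine hχint.bdd_mul (c := Real.exp M) (by fun_prop : Continuous fun x =>
      Real.exp (u x)).aestronglyMeasurable (ae_of_all _ fun x => ?_)
    rw [Real.norm_of_nonneg (Real.exp_pos _).le]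
    exact Real.exp_le_exp.2 ((le_abs_self _).trans (hM x))
  have hIpos : 0 < ∫ x, Real.exp (u x) * Real.exp (β * χ x) ∂ν := by
    simp only [← Real.exp_add] at hI ⊢
    exact integral_exp_pos hI
  set I := ∫ x, Real.exp (u x) * Real.exp (β * χ x) ∂ν with hIdef
  set J := ∫ x, Real.exp (S x) * ρ x ∂(Measure.pi fun _ => ν) with hJ
  have hJle : J ≤ Real.exp (N * ε) * I ^ N := by
    have : ∫ x : Fin N → E, Real.exp (N * ε) * ∏ i, (Real.exp (u (x i)) * Real.exp (β * χ (x i)))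
        ∂(Measure.pi fun _ => ν) = Real.exp (N * ε) * I ^ N := by
      rw [integral_const_mul, integral_fintype_prod_eq_pow
        fun x => Real.exp (u x) * Real.exp (β * χ x), Fintype.card_fin]
    rw [← this]
    refine integral_mono heSρ ((Integrable.fintype_prod fun _ => hI).const_mul _) fun x => ?_
    change Real.exp (S x) * ρ x ≤ _
    simp only [hρ, hS]
    rw [Real.exp_sum, Finset.prod_mul_distrib, mul_left_comm (Real.exp (N * ε))]
    have hpos : 0 < ∏ i, Real.exp (u (x i)) := Finset.prod_pos fun _ _ => Real.exp_pos _
    refine mul_le_mul_of_nonneg_left ?_ hpos.le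
    rw [one_div, inv_mul_le_iff₀ hZ, ← mul_assoc]
    exact hw x
  have hJpos : 0 < J := by
    have hbound : 0 < Real.exp (-(N * M)) := Real.exp_pos _
    refine hbound.trans_le ?_
    rw [← mul_one (Real.exp _), ← hρ1, ← integral_const_mul]
    refine integral_mono (hρi.const_mul _) heSρ fun x => ?_
    refine mul_le_mul_of_nonneg_right ?_ (hρ0 x).le
    exact Real.exp_le_exp.2 (abs_le.1 (hSb x)).1
  have hjensen : ∫ x, S x * ρ x ∂(Measure.pi fun _ => ν) ≤ Real.log J := by
    have h : ∫ x, S x * ρ x ∂(Measure.pi fun _ => ν)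
        ≤ ∫ x, ((Real.log J - 1) * ρ x + J⁻¹ * (Real.exp (S x) * ρ x))
          ∂(Measure.pi fun _ => ν) := by
      refine integral_mono hSρ ((hρi.const_mul _).add (heSρ.const_mul _)) fun x => ?_
      -- the tangent line of the exponential at `log J`
      have h1 := Real.add_one_le_exp (S x - Real.log J)
      rw [Real.exp_sub, Real.exp_log hJpos] at h1
      have h2 : S x ≤ (Real.log J - 1) + J⁻¹ * Real.exp (S x) := by
        rw [inv_mul_eq_div]; linarith
      calc S x * ρ x ≤ ((Real.log J - 1) + J⁻¹ * Real.exp (S x)) * ρ x := by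
            gcongr; exact (hρ0 x).le
        _ = _ := by ring
    rw [integral_add (hρi.const_mul _) (heSρ.const_mul _),
      integral_const_mul (Real.log J - 1), integral_const_mul J⁻¹, ← hJ, hρ1,
      inv_mul_cancel₀ hJpos.ne'] at h
    linarith
  have hlogJ : Real.log J ≤ N * (ε + Real.log I) := by
    calc Real.log J ≤ Real.log (Real.exp (N * ε) * I ^ N) := Real.log_le_log hJpos hJle
      _ = _ := by
        rw [Real.log_mul (Real.exp_pos _).ne' (pow_pos hIpos N).ne', Real.log_exp, Real.log_pow]
        ring
  rw [hsum] at hjensen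
  exact le_of_mul_le_mul_left (hjensen.trans hlogJ) hNR

end UpperBound

/-! ### Riemann sums over lattice points -/

section Lattice

variable {n : ℕ} (P : ConvexBody (EuclideanSpace ℝ (Fin n)))

/-- The rescaled lattice points `p_j / k ∈ P`. -/
noncomputable def scaledPoint (k : ℕ) (j : Fin (latticeNumber P k)) : EuclideanSpace ℝ (Fin n) :=
  (k : ℝ)⁻¹ • (latticeOrdering P k j : EuclideanSpace ℝ (Fin n))

variable {P}

theorem smul_scaledPoint {k : ℕ} (hk : 0 < k) (j : Fin (latticeNumber P k)) :
    (k : ℝ) • scaledPoint P k j = latticeOrdering P k j :=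
  smul_inv_smul₀ (by positivity) _

theorem scaledPoint_mem {k : ℕ} (hk : 0 < k) (j : Fin (latticeNumber P k)) :
    scaledPoint P k j ∈ (P : Set (EuclideanSpace ℝ (Fin n))) := by
  have h := (latticeOrdering P k j).2.1
  rwa [Set.mem_smul_set_iff_inv_smul_mem₀ (by positivity)] at h

theorem mem_latticePoints_iff {k : ℕ} (hk : 0 < k) (x : Fin n → ℝ) :
    (k : ℝ) • WithLp.toLp 2 x ∈ latticePoints P k ↔
      x ∈ (WithLp.toLp 2 ⁻¹' (P : Set (EuclideanSpace ℝ (Fin n))))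
        ∩ (k : ℝ)⁻¹ • (Submodule.span ℤ (Set.range (Pi.basisFun ℝ (Fin n))) : Set (Fin n → ℝ)) := by
  have hk0 : (k : ℝ) ≠ 0 := by positivity
  have : NeZero k := ⟨hk.ne'⟩
  have h1 : (k : ℝ) • WithLp.toLp 2 x ∈ (k : ℝ) • (P : Set (EuclideanSpace ℝ (Fin n)))
      ↔ x ∈ WithLp.toLp 2 ⁻¹' (P : Set (EuclideanSpace ℝ (Fin n))) := by
    rw [Set.smul_mem_smul_set_iff₀ hk0]; rfl
  have h2 := BoxIntegral.unitPartition.mem_smul_span_iff (n := k) (v := x)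
  rw [← SetLike.mem_coe, Submodule.coe_pointwise_smul] at h2
  rw [Set.mem_inter_iff, h2, ← h1]
  simp only [latticePoints, Set.mem_ofPred_eq, PiLp.smul_apply, smul_eq_mul, Set.mem_range,
    algebraMap_int_eq, eq_intCast, eq_comm]

/-- Lattice points of `kP` correspond to points of `P ∩ k⁻¹ ℤⁿ`. -/
noncomputable def latticePointsEquiv {k : ℕ} (hk : 0 < k) :
    ((WithLp.toLp 2 ⁻¹' (P : Set (EuclideanSpace ℝ (Fin n))))
        ∩ (k : ℝ)⁻¹ • (Submodule.span ℤ (Set.range (Pi.basisFun ℝ (Fin n))) : Set (Fin n → ℝ)) :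
      Set (Fin n → ℝ)) ≃ latticePoints P k where
  toFun x := ⟨(k : ℝ) • WithLp.toLp 2 x.1, (mem_latticePoints_iff hk _).2 x.2⟩
  invFun p := ⟨WithLp.ofLp ((k : ℝ)⁻¹ • p.1), (mem_latticePoints_iff hk _).1 (by
    have hk0 : (k : ℝ) ≠ 0 := by positivity
    rw [WithLp.toLp_ofLp, smul_inv_smul₀ hk0]
    exact p.2)⟩
  left_inv x := by
    have hk0 : (k : ℝ) ≠ 0 := by positivity
    ext1
    simp [inv_smul_smul₀ hk0]
  right_inv p := by
    have hk0 : (k : ℝ) ≠ 0 := by positivity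
    ext1
    simp [smul_inv_smul₀ hk0]

theorem sum_scaledPoint_eq {k : ℕ} (hk : 0 < k) (f : EuclideanSpace ℝ (Fin n) → ℝ) :
    ∑ j, f (scaledPoint P k j)
      = ∑' x : ((WithLp.toLp 2 ⁻¹' (P : Set (EuclideanSpace ℝ (Fin n))))
        ∩ (k : ℝ)⁻¹ • (Submodule.span ℤ (Set.range (Pi.basisFun ℝ (Fin n))) : Set (Fin n → ℝ)) :
      Set (Fin n → ℝ)), f (WithLp.toLp 2 x.1) := by
  have hk0 : (k : ℝ) ≠ 0 := by positivity
  rw [← tsum_fintype (L := .unconditional _),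
    ← ((latticePointsEquiv hk).trans (latticeOrdering P k).symm).tsum_eq]
  refine tsum_congr fun x => ?_
  simp only [scaledPoint, Equiv.trans_apply, Equiv.apply_symm_apply, latticePointsEquiv,
    Equiv.coe_fn_mk, inv_smul_smul₀ hk0]

theorem tendsto_sum_div_pow (f : EuclideanSpace ℝ (Fin n) → ℝ) (hf : Continuous f) :
    Tendsto (fun k : ℕ => (∑ j, f (scaledPoint P k j)) / (k : ℝ) ^ n) atTop
      (𝓝 (∫ p in (P : Set (EuclideanSpace ℝ (Fin n))), f p)) := by
  set s : Set (Fin n → ℝ) := WithLp.toLp 2 ⁻¹' (P : Set (EuclideanSpace ℝ (Fin n))) with hs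
  have hcomp : IsCompact s := by
    have : s = WithLp.ofLp '' (P : Set (EuclideanSpace ℝ (Fin n))) := by
      ext x
      constructor
      · exact fun hx => ⟨_, hx, rfl⟩
      · rintro ⟨p, hp, rfl⟩; exact hp
    rw [this]
    exact P.isCompact.image (PiLp.continuous_ofLp 2 _)
  have hconv : Convex ℝ s :=
    P.convex.linear_preimage (WithLp.linearEquiv 2 ℝ (Fin n → ℝ)).symm.toLinearMap
  have h := tendsto_tsum_div_pow_atTop_integral s (fun x => f (WithLp.toLp 2 x))
    (hf.comp (PiLp.continuous_toLp 2 _)) hcomp.isBounded hcomp.measurableSet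
    (hconv.addHaar_frontier volume)
  rw [hs, (PiLp.volume_preserving_toLp (Fin n)).setIntegral_preimage_emb
    (MeasurableEquiv.toLp 2 (Fin n → ℝ)).measurableEmbedding f] at h
  refine h.congr' ?_
  filter_upwards [eventually_gt_atTop 0] with k hk
  rw [sum_scaledPoint_eq hk, Fintype.card_fin]

variable (hP : volume (P : Set (EuclideanSpace ℝ (Fin n))) = 1)

include hP in
theorem tendsto_latticeNumber_div_pow :
    Tendsto (fun k : ℕ => (latticeNumber P k : ℝ) / (k : ℝ) ^ n) atTop (𝓝 1) := by
  have h := tendsto_sum_div_pow (P := P) (fun _ => 1) continuous_const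
  have h1 : volume.real (P : Set (EuclideanSpace ℝ (Fin n))) = 1 := by simp [measureReal_def, hP]
  simpa [h1] using h

include hP in
theorem tendsto_latticeNumber (hn : 0 < n) : Tendsto (latticeNumber P) atTop atTop := by
  rw [← tendsto_natCast_atTop_iff (R := ℝ)]
  have h1 : Tendsto (fun k : ℕ => (k : ℝ) ^ n) atTop atTop :=
    (tendsto_pow_atTop hn.ne').comp tendsto_natCast_atTop_atTop
  refine ((tendsto_latticeNumber_div_pow hP).pos_mul_atTop one_pos h1).congr' ?_
  filter_upwards [eventually_gt_atTop 0] with k hk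
  field_simp

include hP in
theorem tendsto_sum_scaledPoint_div (f : EuclideanSpace ℝ (Fin n) → ℝ) (hf : Continuous f) :
    Tendsto (fun k : ℕ => (∑ j, f (scaledPoint P k j)) / latticeNumber P k) atTop
      (𝓝 (∫ p in (P : Set (EuclideanSpace ℝ (Fin n))), f p)) := by
  have h := (tendsto_sum_div_pow (P := P) f hf).div (tendsto_latticeNumber_div_pow hP) one_ne_zero
  rw [div_one] at h
  refine h.congr' ?_
  filter_upwards [eventually_gt_atTop 0] with k hk
  exact div_div_div_cancel_right₀ (by positivity) _ _

include hP in
theorem tendsto_log_latticeNumber_div (hn : 0 < n) :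
    Tendsto (fun k : ℕ => Real.log (latticeNumber P k) / k) atTop (𝓝 0) := by
  have h1 : Tendsto (fun k : ℕ => Real.log ((latticeNumber P k : ℝ) / (k : ℝ) ^ n) / k) atTop
      (𝓝 0) :=
    ((tendsto_latticeNumber_div_pow hP).log one_ne_zero).div_atTop tendsto_natCast_atTop_atTop
  have h2 : Tendsto (fun k : ℕ => n * (Real.log k / k)) atTop (𝓝 (n * 0)) :=
    ((Real.isLittleO_log_id_atTop.tendsto_div_nhds_zero).comp
      tendsto_natCast_atTop_atTop).const_mul _
  have h3 := h1.add h2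
  rw [mul_zero, add_zero] at h3
  refine h3.congr' ?_
  filter_upwards [eventually_gt_atTop 0, (tendsto_latticeNumber hP hn).eventually_gt_atTop 0]
    with k hk hN
  have hN0 : (latticeNumber P k : ℝ) ≠ 0 := by positivity
  rw [Real.log_div hN0 (by positivity), Real.log_pow]
  ring

end Lattice

/-! ### Passing to the limit -/

section Limit

variable {E : Type*} [NormedAddCommGroup E] [InnerProductSpace ℝ E] [FiniteDimensional ℝ E]
  [MeasurableSpace E] [BorelSpace E]
  {P : Set E} {ν κ : Measure E} {β : ℝ}

section Bounds

variable (hP : IsCompact P) (hPne : P.Nonempty) (hβ : 0 < β)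
  (hint : Integrable (fun x => Real.exp (β * conjOn P (fun _ => 0) x)) ν)

include hP hPne hint in
omit [FiniteDimensional ℝ E] [BorelSpace E] in
theorem isFiniteMeasureOnCompacts_of_integrable : IsFiniteMeasureOnCompacts ν := by
  refine ⟨fun K hK => ?_⟩
  rcases K.eq_empty_or_nonempty with rfl | hne
  · simp
  have hc : Continuous fun x => Real.exp (β * conjOn P (fun _ => 0) x) := by
    have := continuous_conjOn hP hPne (f := fun _ => (0 : ℝ)) continuous_const
    fun_prop
  obtain ⟨x₀, -, hmin⟩ := hK.exists_isMinOn hne hc.continuousOn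
  refine lt_of_le_of_lt (measure_mono fun x hx => ?_)
    (hint.measure_norm_ge_lt_top (Real.exp_pos (β * conjOn P (fun _ => 0) x₀)))
  rw [Set.mem_ofPred_eq, Real.norm_of_nonneg (Real.exp_pos _).le]
  exact hmin hx

variable {χ : E → ℝ}

include hβ in
omit [FiniteDimensional ℝ E] [MeasurableSpace E] [BorelSpace E] in
theorem exp_le_of_increments (hχ : ∀ x y, χ y - χ x ≤ conjOn P (fun _ => 0) (y - x)) (x : E) :
    Real.exp (β * χ x) ≤ Real.exp (β * χ 0) * Real.exp (β * conjOn P (fun _ => 0) x) := by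
  rw [← Real.exp_add, ← mul_add, Real.exp_le_exp]
  have := hχ 0 x
  rw [sub_zero] at this
  exact mul_le_mul_of_nonneg_left (by linarith) hβ.le

include hβ hint in
omit [FiniteDimensional ℝ E] in
theorem integrable_exp_of_increments (hc : Continuous χ)
    (hχ : ∀ x y, χ y - χ x ≤ conjOn P (fun _ => 0) (y - x)) :
    Integrable (fun x => Real.exp (β * χ x)) ν := by
  refine Integrable.mono' (hint.const_mul (Real.exp (β * χ 0)))
    (by fun_prop : Continuous fun x => Real.exp (β * χ x)).aestronglyMeasurable
    (ae_of_all _ fun x => ?_)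
  rw [Real.norm_of_nonneg (Real.exp_pos _).le]
  exact exp_le_of_increments hβ hχ x

include hP hPne hβ hint in
/-- A normalization over a set containing the unit ball bounds the value at the origin of a function
whose increments are dominated by the support function. -/
theorem exists_abs_apply_zero_le [ν.IsOpenPosMeasure] :
    ∃ M : NNReal, ∀ χ : E → ℝ, Continuous χ →
      (∀ x y, χ y - χ x ≤ conjOn P (fun _ => 0) (y - x)) →
      ∀ S : Set E, MeasurableSet S → Metric.closedBall 0 1 ⊆ S →
        ∫ x in S, Real.exp (β * χ x) ∂ν = 1 → |χ 0| ≤ M := by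
  obtain ⟨C, hC⟩ := hP.isBounded.exists_norm_le
  have := isFiniteMeasureOnCompacts_of_integrable hP hPne hint
  have hν : ν ≠ 0 := fun h => by
    have := Metric.measure_closedBall_pos ν (0 : E) one_pos
    simp [h] at this
  have : NeZero ν := ⟨hν⟩
  set I := ∫ x, Real.exp (β * conjOn P (fun _ => 0) x) ∂ν
  have hI : 0 < I := integral_exp_pos hint
  set V := ν.real (Metric.closedBall (0 : E) 1)
  have hV : 0 < V := ENNReal.toReal_pos (Metric.measure_closedBall_pos ν 0 one_pos).ne'
    (isCompact_closedBall _ _).measure_lt_top.ne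
  obtain ⟨p₀, hp₀⟩ := id hPne
  have hC0 : 0 ≤ C := (norm_nonneg p₀).trans (hC p₀ hp₀)
  refine ⟨⟨|C - Real.log V / β| + |Real.log I / β|, by positivity⟩, fun χ hc hχ S hS h1S hnorm => ?_⟩
  have hi := integrable_exp_of_increments hβ hint hc hχ
  have hup : χ 0 ≤ C - Real.log V / β := by
    have h1 : Real.exp (β * (χ 0 - C)) * V ≤ 1 := by
      calc Real.exp (β * (χ 0 - C)) * V
          = ∫ _ in Metric.closedBall (0 : E) 1, Real.exp (β * (χ 0 - C)) ∂ν := by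
            rw [setIntegral_const, smul_eq_mul, mul_comm]
        _ ≤ ∫ x in Metric.closedBall (0 : E) 1, Real.exp (β * χ x) ∂ν := by
            refine setIntegral_mono_on (integrableOn_const
              (isCompact_closedBall _ _).measure_lt_top.ne) hi.integrableOn
              Metric.isClosed_closedBall.measurableSet fun x hx => ?_
            rw [mem_closedBall_zero_iff] at hx
            have h2 := (hχ x 0).trans (conjOn_zero_le hPne hC _)
            rw [zero_sub, norm_neg] at h2
            have h3 : C * ‖x‖ ≤ C := mul_le_of_le_one_right hC0 hx
            gcongr
            linarith
        _ ≤ ∫ x in S, Real.exp (β * χ x) ∂ν :=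
            setIntegral_mono_set hi.integrableOn (ae_of_all _ fun x => (Real.exp_pos _).le)
              h1S.eventuallyLE
        _ = 1 := hnorm
    have h4 := Real.log_le_log (by positivity) h1
    rw [Real.log_mul (Real.exp_pos _).ne' hV.ne', Real.log_exp, Real.log_one] at h4
    have h5 : Real.log V / β = Real.log V * (1 / β) := by ring
    have h6 : χ 0 - C ≤ -(Real.log V) / β := by
      rw [le_div_iff₀ hβ]; linarith
    rw [neg_div] at h6
    linarith
  have hlow : -(Real.log I / β) ≤ χ 0 := by
    have h1 : 1 ≤ Real.exp (β * χ 0) * I := by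
      calc 1 = ∫ x in S, Real.exp (β * χ x) ∂ν := hnorm.symm
        _ ≤ ∫ x, Real.exp (β * χ x) ∂ν :=
            setIntegral_le_integral hi (ae_of_all _ fun x => (Real.exp_pos _).le)
        _ ≤ ∫ x, Real.exp (β * χ 0) * Real.exp (β * conjOn P (fun _ => 0) x) ∂ν :=
            integral_mono hi (hint.const_mul _) fun x => exp_le_of_increments hβ hχ x
        _ = _ := integral_const_mul _ _
    have h4 := Real.log_le_log one_pos h1
    rw [Real.log_mul (Real.exp_pos _).ne' hI.ne', Real.log_exp, Real.log_one] at h4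
    rw [neg_le_iff_add_nonneg, ← sub_neg_eq_add, sub_nonneg, ← neg_div, div_le_iff₀ hβ]
    linarith
  change |χ 0| ≤ |C - Real.log V / β| + |Real.log I / β|
  rw [abs_le]
  constructor
  · linarith [le_abs_self (Real.log I / β), abs_nonneg (C - Real.log V / β)]
  · linarith [le_abs_self (C - Real.log V / β), abs_nonneg (Real.log I / β)]

include hβ hint in
omit [FiniteDimensional ℝ E] in
theorem tendsto_integral_mul_exp {χ : ℕ → E → ℝ} {φ : E → ℝ} (hc : ∀ j, Continuous (χ j))
    (hχ : ∀ j x y, χ j y - χ j x ≤ conjOn P (fun _ => 0) (y - x)) {M : NNReal}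
    (hM : ∀ j, |χ j 0| ≤ M) (hlim : ∀ x, Tendsto (fun j => χ j x) atTop (𝓝 (φ x)))
    {g : ℕ → E → ℝ} {g' : E → ℝ} {c : ℝ} (hg : ∀ j, Measurable (g j)) (hgc : ∀ j x, |g j x| ≤ c)
    (hglim : ∀ x, Tendsto (fun j => g j x) atTop (𝓝 (g' x))) :
    Tendsto (fun j => ∫ x, g j x * Real.exp (β * χ j x) ∂ν) atTop
      (𝓝 (∫ x, g' x * Real.exp (β * φ x) ∂ν)) := by
  refine tendsto_integral_of_dominated_convergence
    (fun x => c * (Real.exp (β * M) * Real.exp (β * conjOn P (fun _ => 0) x))) (fun j => ?_)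
    ((hint.const_mul _).const_mul _) (fun j => ae_of_all _ fun x => ?_)
    (ae_of_all _ fun x => ?_)
  · have : Continuous fun x => Real.exp (β * χ j x) := by
      have := hc j
      fun_prop
    exact ((hg j).mul this.measurable).aestronglyMeasurable
  · rw [norm_mul, Real.norm_of_nonneg (Real.exp_pos _).le]
    have h1 := exp_le_of_increments hβ (hχ j) x
    have h2 : Real.exp (β * χ j 0) ≤ Real.exp (β * M) := by
      gcongr
      exact (le_abs_self _).trans (hM j)
    have h3 : 0 ≤ c := (abs_nonneg _).trans (hgc j x)
    refine mul_le_mul (hgc j x) (h1.trans ?_) (Real.exp_pos _).le h3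
    gcongr
  · exact (hglim x).mul ((Real.continuous_exp.tendsto _).comp ((hlim x).const_mul β))

end Bounds

variable (hP : IsCompact P) (hPne : P.Nonempty) (hβ : 0 < β)
  (hint : Integrable (fun x => Real.exp (β * conjOn P (fun _ => 0) x)) ν)

/-- The potential `φ` is the locally uniform limit of optimal potentials `χ j` for the reference
measure `ν` restricted to the balls of radii `R j → ∞`; the values at the origin are bounded
by `M`. -/
structure IsLimitOfOptimal (P : Set E) (ν κ : Measure E) (β : ℝ) (φ : C(E, ℝ)) (χ : ℕ → C(E, ℝ))
    (R : ℕ → ℝ) (M : NNReal) : Prop where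
  tendsto_radius : Tendsto R atTop atTop
  one_le_radius : ∀ j, 1 ≤ R j
  abs_zero_le : ∀ j, |χ j 0| ≤ M
  optimal : ∀ j, IsOptimalPotential P (Metric.closedBall 0 (R j))
    (ν.restrict (Metric.closedBall 0 (R j))) κ β (χ j)
  tendsto : Tendsto χ atTop (𝓝 φ)

include hP hPne hβ hint in
/-- Optimal potentials on larger and larger balls subconverge locally uniformly. -/
theorem exists_limit_optimalPotential [ν.IsOpenPosMeasure] [IsProbabilityMeasure κ]
    (hκ : ∀ᵐ p ∂κ, p ∈ P) :
    ∃ φ χ R M, IsLimitOfOptimal P ν κ β φ χ R M := by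
  have := isFiniteMeasureOnCompacts_of_integrable hP hPne hint
  have hex : ∀ j : ℕ, ∃ χ : E → ℝ, IsOptimalPotential P (Metric.closedBall 0 (j + 1))
      (ν.restrict (Metric.closedBall 0 (j + 1))) κ β χ := fun j => by
    have hB : IsCompact (Metric.closedBall (0 : E) (j + 1)) := isCompact_closedBall _ _
    have hpos : (0 : ℝ) < j + 1 := by positivity
    have h1 : IsFiniteMeasure (ν.restrict (Metric.closedBall 0 ((j : ℝ) + 1))) :=
      ⟨by rw [Measure.restrict_apply_univ]; exact hB.measure_lt_top⟩
    have h2 : NeZero (ν.restrict (Metric.closedBall 0 ((j : ℝ) + 1))) := ⟨by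
      rw [← Measure.measure_univ_ne_zero, Measure.restrict_apply_univ]
      exact (Metric.measure_closedBall_pos ν 0 hpos).ne'⟩
    exact exists_isOptimalPotential hB (Metric.nonempty_closedBall.2 hpos.le) hP hPne
      (ae_restrict_mem hB.measurableSet) hκ hβ
  choose χ hχ using hex
  obtain ⟨M, hM⟩ := exists_abs_apply_zero_le hP hPne hβ hint
  obtain ⟨C, hC⟩ := hP.isBounded.exists_norm_le
  obtain ⟨p₀, hp₀⟩ := id hPne
  have hC0 : 0 ≤ C := (norm_nonneg p₀).trans (hC p₀ hp₀)
  have hχ0 : ∀ j, |χ j 0| ≤ M := fun j =>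
    hM _ (hχ j).continuous (hχ j).increments _ Metric.isClosed_closedBall.measurableSet
      (Metric.closedBall_subset_closedBall (by linarith [(j.cast_nonneg : (0 : ℝ) ≤ j)]))
      (hχ j).normalized
  have hmem : ∀ j, (⟨χ j, (hχ j).continuous⟩ : C(E, ℝ)) ∈ lipClass E ⟨C, hC0⟩ M := fun j =>
    ⟨lipschitzWith_of_increments hPne hC (hχ j).increments, hχ0 j⟩
  obtain ⟨φ, -, s, hs, hlim⟩ := (isCompact_lipClass (E := E) ⟨C, hC0⟩ M).tendsto_subseq hmem
  refine ⟨φ, fun j => ⟨χ (s j), (hχ (s j)).continuous⟩, fun j => (s j : ℝ) + 1, M, ?_, fun j => ?_,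
    fun j => hχ0 (s j), fun j => hχ (s j), hlim⟩
  · exact tendsto_atTop_add_const_right _ _ (tendsto_natCast_atTop_atTop.comp hs.tendsto_atTop)
  · linarith [((s j).cast_nonneg : (0 : ℝ) ≤ s j)]

omit [MeasurableSpace E] [BorelSpace E] [FiniteDimensional ℝ E] in
theorem ConvexOn.of_tendsto {χ : ℕ → E → ℝ} {φ : E → ℝ} (hχ : ∀ j, ConvexOn ℝ Set.univ (χ j))
    (hlim : ∀ x, Tendsto (fun j => χ j x) atTop (𝓝 (φ x))) : ConvexOn ℝ Set.univ φ :=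
  ⟨convex_univ, fun x _ y _ a b ha hb hab => le_of_tendsto_of_tendsto' (hlim _)
    (((hlim x).const_smul a).add ((hlim y).const_smul b))
    fun j => (hχ j).2 (Set.mem_univ x) (Set.mem_univ y) ha hb hab⟩

namespace IsLimitOfOptimal

variable {φ : C(E, ℝ)} {χ : ℕ → C(E, ℝ)} {R : ℕ → ℝ} {M : NNReal}
  (h : IsLimitOfOptimal P ν κ β φ χ R M)

include h

omit [FiniteDimensional ℝ E] [BorelSpace E]

theorem tendsto_apply (x : E) : Tendsto (fun j => χ j x) atTop (𝓝 (φ x)) :=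
  ((continuous_eval_const x).tendsto φ).comp h.tendsto

theorem convexOn : ConvexOn ℝ Set.univ φ :=
  ConvexOn.of_tendsto (fun j => (h.optimal j).convexOn) h.tendsto_apply

theorem increments (x y : E) : φ y - φ x ≤ conjOn P (fun _ => 0) (y - x) :=
  le_of_tendsto' ((h.tendsto_apply y).sub (h.tendsto_apply x)) fun j => (h.optimal j).increments x y

theorem eventually_mem_ball (x : E) : ∀ᶠ j in atTop, x ∈ Metric.closedBall (0 : E) (R j) := by
  filter_upwards [h.tendsto_radius.eventually_ge_atTop ‖x‖] with j hj
  rwa [mem_closedBall_zero_iff]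

omit h in
theorem tendsto_integral_mul_exp [BorelSpace E] (h : IsLimitOfOptimal P ν κ β φ χ R M) (hβ : 0 < β)
    (hint : Integrable (fun x => Real.exp (β * conjOn P (fun _ => 0) x)) ν)
    {g : ℕ → E → ℝ} {g' : E → ℝ} {c : ℝ} (hg : ∀ j, Measurable (g j)) (hgc : ∀ j x, |g j x| ≤ c)
    (hglim : ∀ x, Tendsto (fun j => g j x) atTop (𝓝 (g' x))) :
    Tendsto (fun j => ∫ x, g j x * Real.exp (β * χ j x) ∂ν) atTop
      (𝓝 (∫ x, g' x * Real.exp (β * φ x) ∂ν)) :=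
  PermanentMA.tendsto_integral_mul_exp hβ hint (fun j => (χ j).continuous)
    (fun j => (h.optimal j).increments) h.abs_zero_le h.tendsto_apply hg hgc hglim

/-- The mass of the sets `S ∩ B_{R j}` passes to the limit. -/
theorem tendsto_setIntegral [BorelSpace E] (hβ : 0 < β)
    (hint : Integrable (fun x => Real.exp (β * conjOn P (fun _ => 0) x)) ν)
    {S : Set E} (hS : MeasurableSet S) :
    Tendsto (fun j => ∫ x in S ∩ Metric.closedBall 0 (R j), Real.exp (β * χ j x) ∂ν) atTop
      (𝓝 (∫ x in S, Real.exp (β * φ x) ∂ν)) := by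
  have hm : ∀ j, MeasurableSet (S ∩ Metric.closedBall 0 (R j)) := fun j =>
    hS.inter Metric.isClosed_closedBall.measurableSet
  have := h.tendsto_integral_mul_exp hβ hint
    (g := fun j => (S ∩ Metric.closedBall 0 (R j)).indicator fun _ => 1)
    (g' := S.indicator fun _ => 1) (c := 1) (fun j => measurable_const.indicator (hm j))
    (fun j x => by by_cases hx : x ∈ S ∩ Metric.closedBall 0 (R j) <;> simp [hx])
    (fun x => by
      refine tendsto_const_nhds.congr' ?_
      filter_upwards [h.eventually_mem_ball x] with j hj
      by_cases hx : x ∈ S <;> simp [Set.indicator, hx, mem_closedBall_zero_iff.1 hj])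
  have hind : ∀ (T : Set E) (f : E → ℝ), MeasurableSet T →
      ∫ x, T.indicator (fun _ => 1) x * f x ∂ν = ∫ x in T, f x ∂ν := fun T f hT => by
    rw [← integral_indicator hT]
    congr 1 with x
    by_cases hx : x ∈ T <;> simp [hx]
  rw [hind S _ hS] at this
  exact this.congr fun j => hind _ _ (hm j)

theorem integral_exp_eq_one [BorelSpace E] (hβ : 0 < β)
    (hint : Integrable (fun x => Real.exp (β * conjOn P (fun _ => 0) x)) ν) :
    ∫ x, Real.exp (β * φ x) ∂ν = 1 := by
  have h1 := h.tendsto_setIntegral hβ hint MeasurableSet.univ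
  simp only [Set.univ_inter, fun j => (h.optimal j).normalized, Measure.restrict_univ] at h1
  exact tendsto_nhds_unique h1 tendsto_const_nhds

end IsLimitOfOptimal

omit [InnerProductSpace ℝ E] in
/-- In a Lipschitz class, weak convergence of the densities `e^{βψ}` implies locally uniform
convergence: two continuous functions with the same density on a measure charging all open sets are
equal, as testing with the difference of the densities shows. -/
theorem tendsto_of_tendsto_integral_exp [InnerProductSpace ℝ E] [FiniteDimensional ℝ E]
    [ν.IsOpenPosMeasure] [IsFiniteMeasureOnCompacts ν]
    (hβ : 0 < β) {C M : NNReal} {Φ : ℕ → C(E, ℝ)} {φ : C(E, ℝ)}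
    (hΦ : ∀ᶠ k in atTop, Φ k ∈ lipClass E C M)
    (h : ∀ u : E → ℝ, Continuous u → HasCompactSupport u →
      Tendsto (fun k => ∫ x, u x * Real.exp (β * Φ k x) ∂ν) atTop
        (𝓝 (∫ x, u x * Real.exp (β * φ x) ∂ν))) :
    Tendsto Φ atTop (𝓝 φ) := by
  refine (isCompact_lipClass C M).tendsto_nhds_of_unique_mapClusterPt hΦ fun ψ _ hψ => ?_
  have hint : ∀ u : E → ℝ, Continuous u → HasCompactSupport u → ∀ ψ : C(E, ℝ),
      Integrable (fun x => u x * Real.exp (β * ψ x)) ν := fun u hu hus ψ =>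
    (by fun_prop : Continuous fun x => u x * Real.exp (β * ψ x)).integrable_of_hasCompactSupport
      hus.mul_right
  have heq : ∀ u : E → ℝ, Continuous u → HasCompactSupport u →
      ∫ x, u x * Real.exp (β * ψ x) ∂ν = ∫ x, u x * Real.exp (β * φ x) ∂ν := by
    intro u hu hus
    have hcont : Tendsto (fun ψ' : C(E, ℝ) => ∫ x, u x * Real.exp (β * ψ' x) ∂ν) (𝓝 ψ)
        (𝓝 (∫ x, u x * Real.exp (β * ψ x) ∂ν)) := by
      refine tendsto_integral_filter_of_dominated_convergence
        (fun x => |u x| * Real.exp (β * (ψ x + 1))) (Eventually.of_forall fun ψ' =>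
          (hint u hu hus ψ').aestronglyMeasurable) ?_ ?_ (ae_of_all _ fun x => ?_)
      · filter_upwards [eventually_nhds_dist_lt hus ψ one_pos] with ψ' hψ'
        refine ae_of_all _ fun x => ?_
        rw [norm_mul, Real.norm_of_nonneg (Real.exp_pos _).le, Real.norm_eq_abs]
        by_cases hx : x ∈ tsupport u
        · have := (abs_lt.1 (hψ' x hx)).2
          gcongr
          linarith
        · simp [image_eq_zero_of_notMem_tsupport hx]
      · exact (by fun_prop : Continuous fun x =>
          |u x| * Real.exp (β * (ψ x + 1))).integrable_of_hasCompactSupport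
          (hus.norm.mul_right)
      · have h1 : Continuous fun ψ' : C(E, ℝ) => ψ' x := continuous_eval_const x
        have h2 : Continuous fun ψ' : C(E, ℝ) => u x * Real.exp (β * ψ' x) := by fun_prop
        exact h2.tendsto ψ
    have h1 := hψ.tendsto_comp hcont
    exact eq_of_nhds_neBot (h1.neBot.mono (inf_le_inf_left _ (h u hu hus)))
  ext x
  -- test with the difference of the densities times a cut-off function
  set r := ‖x‖ + 1
  set η : E → ℝ := fun y => max 0 (r - ‖y‖) with hη
  have hηc : Continuous η := by fun_prop
  have hηs : HasCompactSupport η := by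
    refine HasCompactSupport.intro (isCompact_closedBall (0 : E) r) fun y hy => ?_
    rw [mem_closedBall_zero_iff, not_le] at hy
    exact max_eq_left (by linarith)
  set d : E → ℝ := fun y => Real.exp (β * ψ y) - Real.exp (β * φ y) with hd
  have hdc : Continuous d := by fun_prop
  have hdηc : Continuous fun y => η y * d y := by fun_prop
  have hdηs : HasCompactSupport fun y => η y * d y := hηs.mul_right
  have h0 := heq _ hdηc hdηs
  have h1 : ∫ y, η y * d y ^ 2 ∂ν = 0 := by
    have : ∀ y, η y * d y ^ 2
        = η y * d y * Real.exp (β * ψ y) - η y * d y * Real.exp (β * φ y) := fun y => by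
      simp only [hd]; ring
    simp_rw [this]
    rw [integral_sub (hint _ hdηc hdηs ψ) (hint _ hdηc hdηs φ), h0, sub_self]
  have hc2 : Continuous fun y => η y * d y ^ 2 := by fun_prop
  have h2 := (integral_eq_zero_iff_of_nonneg (fun y => by positivity)
    (hc2.integrable_of_hasCompactSupport hηs.mul_right)).1 h1
  have h3 := congrFun (Measure.eq_of_ae_eq h2 hc2 continuous_const) x
  have hηx : η x = 1 := by simp [hη, r]
  simp only [hηx, one_mul, Pi.zero_apply] at h3
  have h4 : d x = 0 := pow_eq_zero_iff two_ne_zero |>.1 h3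
  have h5 := Real.exp_injective (sub_eq_zero.1 h4)
  exact mul_left_cancel₀ hβ.ne' h5

end Limit

/-! ### Convergence of the Gibbs potentials -/

section Convergence

variable {E : Type*} [NormedAddCommGroup E] [InnerProductSpace ℝ E] [FiniteDimensional ℝ E]
  [MeasurableSpace E] [BorelSpace E]
  {P : Set E} {ν κ : Measure E} {β : ℝ} (hP : IsCompact P) (hPne : P.Nonempty) (hβ : 0 < β)
  (hint : Integrable (fun x => Real.exp (β * conjOn P (fun _ => 0) x)) ν)
  [SigmaFinite ν] [ν.IsOpenPosMeasure] [NeZero ν]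
  {φ : C(E, ℝ)} {χ : ℕ → C(E, ℝ)} {R : ℕ → ℝ} {M : NNReal}
  (h : IsLimitOfOptimal P ν κ β φ χ R M)
  {N : ℕ → ℕ} (hN : Tendsto N atTop atTop) {q : ∀ k, Fin (N k) → E}
  (hq : ∀ᶠ k in atTop, ∀ j, q k j ∈ P)
  (hlog : Tendsto (fun k : ℕ => Real.log (N k) / k) atTop (𝓝 0))
  (hR : ∀ f : E → ℝ, Continuous f →
    Tendsto (fun k => (∑ j, f (q k j)) / N k) atTop (𝓝 (∫ p, f p ∂κ)))

include hP hPne hβ hint h hN hq hlog hR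

omit [ν.IsOpenPosMeasure] in
/-- The upper and the lower bound for the partition function match at an optimal potential, so the
Gibbs density is bounded by the corresponding product density up to a subexponential factor. -/
theorem eventually_gibbsWeight_le_prod (i : ℕ) {ε : ℝ} (hε : 0 < ε) :
    ∀ᶠ k : ℕ in atTop, ∀ x, gibbsWeight (q k) k β x
      ≤ gibbsZ (q k) k β ν * Real.exp (N k * ε) * ∏ j, Real.exp (β * χ i (x j)) := by
  have := isFiniteMeasureOnCompacts_of_integrable hP hPne hint
  set B := Metric.closedBall (0 : E) (R i)
  have hB : IsCompact B := isCompact_closedBall _ _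
  have hBne : B.Nonempty := Metric.nonempty_closedBall.2 (zero_le_one.trans (h.one_le_radius i))
  have hfin : IsFiniteMeasure (ν.restrict B) :=
    ⟨by rw [Measure.restrict_apply_univ]; exact hB.measure_lt_top⟩
  obtain ⟨C, hC⟩ := hP.isBounded.exists_norm_le
  obtain ⟨p₀, hp₀⟩ := id hPne
  have hC0 : 0 ≤ C := (norm_nonneg p₀).trans (hC p₀ hp₀)
  have hc := continuous_conjOn hB hBne (χ i).continuous
  have hZpos : ∀ᶠ k : ℕ in atTop, 0 < gibbsZ (q k) k β ν := by
    filter_upwards [hq, eventually_gt_atTop 0] with k h1 h2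
    exact gibbsZ_pos hP h1 (by exact_mod_cast h2) hβ hint
  refine eventually_gibbsWeight_le (κ := κ) (f := conjOn B (χ i)) hβ (hN.eventually_gt_atTop 0) hlog
    ?_ (hR _ hc) hZpos (fun δ hδ => ?_) hε
  · filter_upwards [hq] with k h1 x j
    exact (h.optimal i).inner_le x _ (h1 j)
  · have hm : ∀ᵐ x ∂(ν.restrict B), x ∈ B := ae_restrict_mem hB.measurableSet
    have hNZ : NeZero (ν.restrict B) := ⟨fun h0 => by
      have := (h.optimal i).normalized
      simp [B, h0] at this⟩
    filter_upwards [hq, eventually_gt_atTop 0, eventually_le_log_gibbsZ (C := ⟨C, hC0⟩) hB hBne hm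
      hβ (h.optimal i) hN (hq.mono fun k hk j => hC _ (hk j)) hR hδ] with k h1 h2 h3
    have hk : (0 : ℝ) < k := by exact_mod_cast h2
    refine h3.trans (Real.log_le_log ?_
      (gibbsZ_restrict_le (integrable_gibbsWeight hP h1 hk hβ hint)))
    exact gibbsZ_pos hP h1 hk hβ hint.restrict

omit [ν.IsOpenPosMeasure] in
theorem eventually_integral_le_log {u : E → ℝ} {c : ℝ} (hu : Continuous u) (huc : ∀ x, |u x| ≤ c)
    {ε : ℝ} (hε : 0 < ε) :
    ∀ᶠ k : ℕ in atTop, ∫ x, u x * Real.exp (β * gibbsPotential (q k) k β ν x) ∂ν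
      ≤ ε + Real.log (∫ x, Real.exp (u x) * Real.exp (β * φ x) ∂ν) := by
  have hφint := integrable_exp_of_increments hβ hint φ.continuous h.increments
  have hexpu : ∀ x, |Real.exp (u x)| ≤ Real.exp c := fun x => by
    rw [abs_of_pos (Real.exp_pos _)]
    exact Real.exp_le_exp.2 ((le_abs_self _).trans (huc x))
  have hpos : 0 < ∫ x, Real.exp (u x) * Real.exp (β * φ x) ∂ν := by
    have := hφint.bdd_mul (by fun_prop : Continuous fun x => Real.exp (u x)).aestronglyMeasurable
      (ae_of_all _ hexpu)
    simp only [← Real.exp_add] at this ⊢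
    exact integral_exp_pos this
  have hlim := (h.tendsto_integral_mul_exp hβ hint (g := fun _ x => Real.exp (u x))
    (fun _ => (by fun_prop : Continuous fun x => Real.exp (u x)).measurable) (fun _ => hexpu)
    (fun x => tendsto_const_nhds)).log hpos.ne'
  obtain ⟨i, hi⟩ := (hlim.eventually (gt_mem_nhds (lt_add_of_pos_right _ (half_pos hε)))).exists
  filter_upwards [eventually_gibbsWeight_le_prod hP hPne hβ hint h hN hq hlog hR i (half_pos hε), hq,
    hN.eventually_gt_atTop 0, eventually_gt_atTop 0] with k h1 h2 h3 h4
  have := integral_mul_exp_gibbsPotential_le hP h2 (by exact_mod_cast h4) hβ hint h3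
    (integrable_exp_of_increments hβ hint (χ i).continuous (h.optimal i).increments) h1 hu huc
  linarith

omit [ν.IsOpenPosMeasure] in
/-- Linearization of the entropy bound for small multiples of `u`. -/
theorem eventually_integral_le {u : E → ℝ} {c : ℝ} (hu : Continuous u) (huc : ∀ x, |u x| ≤ c)
    {ε : ℝ} (hε : 0 < ε) :
    ∀ᶠ k : ℕ in atTop, ∫ x, u x * Real.exp (β * gibbsPotential (q k) k β ν x) ∂ν
      ≤ ∫ x, u x * Real.exp (β * φ x) ∂ν + ε := by
  have hφint := integrable_exp_of_increments hβ hint φ.continuous h.increments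
  have hφone := h.integral_exp_eq_one hβ hint
  have hc : 0 ≤ c := (abs_nonneg _).trans (huc 0)
  obtain ⟨t, ht, ht1, ht2⟩ : ∃ t : ℝ, 0 < t ∧ t * c ≤ 1 ∧ t * c ^ 2 ≤ ε / 2 := by
    refine ⟨min (1 / (c + 1)) (ε / 2 / (c ^ 2 + 1)), by positivity, ?_, ?_⟩
    · calc _ ≤ 1 / (c + 1) * (c + 1) := by gcongr; exacts [min_le_left _ _, by linarith]
        _ = 1 := by field_simp
    · calc _ ≤ ε / 2 / (c ^ 2 + 1) * (c ^ 2 + 1) := by gcongr; exacts [min_le_right _ _, by linarith]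
        _ = _ := by field_simp
  have hub : ∀ x, |t * u x| ≤ t * c := fun x => by
    rw [abs_mul, abs_of_pos ht]
    exact mul_le_mul_of_nonneg_left (huc x) ht.le
  have huint : Integrable (fun x => u x * Real.exp (β * φ x)) ν :=
    hφint.bdd_mul hu.aestronglyMeasurable (ae_of_all _ huc)
  have hle : Real.log (∫ x, Real.exp (t * u x) * Real.exp (β * φ x) ∂ν)
      ≤ t * (∫ x, u x * Real.exp (β * φ x) ∂ν + ε / 2) := by
    have hexpint : Integrable (fun x => Real.exp (t * u x) * Real.exp (β * φ x)) ν := by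
      refine hφint.bdd_mul (c := Real.exp (t * c))
        (by fun_prop : Continuous fun x => Real.exp (t * u x)).aestronglyMeasurable
        (ae_of_all _ fun x => ?_)
      rw [Real.norm_of_nonneg (Real.exp_pos _).le]
      exact Real.exp_le_exp.2 ((le_abs_self _).trans (hub x))
    have hpos : 0 < ∫ x, Real.exp (t * u x) * Real.exp (β * φ x) ∂ν := by
      simp only [← Real.exp_add] at hexpint ⊢
      exact integral_exp_pos hexpint
    have h1 : ∫ x, Real.exp (t * u x) * Real.exp (β * φ x) ∂ν
        ≤ ∫ x, ((1 + (t * c) ^ 2) * Real.exp (β * φ x) + t * (u x * Real.exp (β * φ x))) ∂ν := by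
      refine integral_mono hexpint ((hφint.const_mul _).add (huint.const_mul _)) fun x => ?_
      have h2 := (abs_le.1 (Real.abs_exp_sub_one_sub_id_le ((hub x).trans ht1))).2
      have h3 : (t * u x) ^ 2 ≤ (t * c) ^ 2 :=
        sq_le_sq' (by linarith [(abs_le.1 (hub x)).1]) (abs_le.1 (hub x)).2
      have h4 : Real.exp (t * u x) ≤ 1 + (t * c) ^ 2 + t * u x := by linarith
      calc Real.exp (t * u x) * Real.exp (β * φ x)
          ≤ (1 + (t * c) ^ 2 + t * u x) * Real.exp (β * φ x) := by gcongr
        _ = _ := by ring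
    rw [integral_add (hφint.const_mul _) (huint.const_mul _), integral_const_mul,
      integral_const_mul, hφone] at h1
    have h5 : (t * c) ^ 2 ≤ t * (ε / 2) := by
      calc (t * c) ^ 2 = t * (t * c ^ 2) := by ring
        _ ≤ _ := by gcongr
    linarith [Real.log_le_sub_one_of_pos hpos]
  have hεt : 0 < t * (ε / 2) := by positivity
  filter_upwards [eventually_integral_le_log hP hPne hβ hint h hN hq hlog hR
    (u := fun x => t * u x) (by fun_prop) hub hεt] with k h1
  simp only [mul_assoc t] at h1
  rw [integral_const_mul] at h1
  have h2 : t * ∫ x, u x * Real.exp (β * gibbsPotential (q k) k β ν x) ∂ν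
      ≤ t * (∫ x, u x * Real.exp (β * φ x) ∂ν + ε) := by linarith
  exact le_of_mul_le_mul_left h2 ht

theorem tendsto_gibbsPotential {Φ : ℕ → C(E, ℝ)}
    (hΦ : ∀ᶠ k : ℕ in atTop, ∀ x, Φ k x = gibbsPotential (q k) k β ν x) :
    Tendsto Φ atTop (𝓝 φ) := by
  have := isFiniteMeasureOnCompacts_of_integrable hP hPne hint
  obtain ⟨C, hC⟩ := hP.isBounded.exists_norm_le
  obtain ⟨p₀, hp₀⟩ := id hPne
  have hC0 : 0 ≤ C := (norm_nonneg p₀).trans (hC p₀ hp₀)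
  obtain ⟨M', hM'⟩ := exists_abs_apply_zero_le hP hPne hβ hint
  refine tendsto_of_tendsto_integral_exp (ν := ν) hβ (C := ⟨C, hC0⟩) (M := M') ?_ fun u hu hus => ?_
  · filter_upwards [hΦ, hq, hN.eventually_gt_atTop 0, eventually_gt_atTop 0] with k h1 h2 h3 h4
    have hk : (0 : ℝ) < k := by exact_mod_cast h4
    have hinc : ∀ x y, Φ k y - Φ k x ≤ conjOn P (fun _ => 0) (y - x) := fun x y => by
      rw [h1, h1]
      exact gibbsPotential_sub_le hP h2 hk hβ hint h3 x y
    refine ⟨lipschitzWith_of_increments hPne hC hinc,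
      hM' _ (Φ k).continuous hinc Set.univ MeasurableSet.univ (Set.subset_univ _) ?_⟩
    simp_rw [Measure.restrict_univ, h1]
    exact integral_exp_gibbsPotential hP h2 hk hβ hint h3
  · obtain ⟨c, hc⟩ := hus.exists_bound_of_continuous hu
    refine Metric.tendsto_nhds.2 fun ε hε => ?_
    filter_upwards [hΦ, eventually_integral_le hP hPne hβ hint h hN hq hlog hR hu hc (half_pos hε),
      eventually_integral_le hP hPne hβ hint h hN hq hlog hR (u := fun x => -u x) hu.neg
        (fun x => by rw [abs_neg]; exact hc x) (half_pos hε)] with k h1 h2 h3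
    simp only [neg_mul, integral_neg] at h3
    simp_rw [h1, Real.dist_eq]
    rw [abs_lt]
    constructor <;> linarith

end Convergence

/-! ### The Monge-Ampère measure of the limit -/

section MongeAmpere

section Perturbation

variable {E : Type*} [NormedAddCommGroup E] [InnerProductSpace ℝ E] [FiniteDimensional ℝ E]
  [MeasurableSpace E] [BorelSpace E]

/-- Lowering an optimal potential by `t v` raises its conjugate by at most `t`, and only on the set
of slopes where the conjugate changes; optimality then bounds the mass of `v` by the measure
of that set. -/
theorem IsOptimalPotential.integral_mul_exp_le_measure {P B : Set E} {m κ : Measure E} {β : ℝ}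
    {χ : E → ℝ} [IsFiniteMeasure m] [IsProbabilityMeasure κ] (h : IsOptimalPotential P B m κ β χ)
    (hB : IsCompact B) (hBne : B.Nonempty) (hP : IsCompact P) (hm : ∀ᵐ x ∂m, x ∈ B)
    (hκ : ∀ᵐ p ∂κ, p ∈ P) {v : E → ℝ} (hv : Continuous v) (hv1 : ∀ x, v x ≤ 1) {t : ℝ} (ht : 0 < t) :
    ∫ x, v x * Real.exp (β * χ x) ∂m
      ≤ κ.real {p | conjOn B χ p < conjOn B (fun x => χ x - t * v x) p} := by
  have hχ := h.continuous
  have hψ : Continuous fun x => χ x - t * v x := by fun_prop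
  have hc1 := continuous_conjOn hB hBne hχ
  have hc2 := continuous_conjOn hB hBne hψ
  set W := {p | conjOn B χ p < conjOn B (fun x => χ x - t * v x) p} with hW
  have hWm : MeasurableSet W := (isOpen_lt hc1 hc2).measurableSet
  have hi : ∀ {f : E → ℝ}, Continuous f → Integrable f m := fun hf =>
    integrable_of_ae_mem_isCompact hB hm hf
  have hj : ∀ {f : E → ℝ}, Continuous f → Integrable f κ := fun hf =>
    integrable_of_ae_mem_isCompact hP hκ hf
  have h1 := h.optimal _ hψ
  have h2 : ∫ x, (χ x - t * v x) * Real.exp (β * χ x) ∂m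
      = ∫ x, χ x * Real.exp (β * χ x) ∂m - t * ∫ x, v x * Real.exp (β * χ x) ∂m := by
    rw [← integral_const_mul, ← integral_sub (hi (by fun_prop)) (hi (by fun_prop))]
    congr 1 with x
    ring
  have h3 : ∫ p, conjOn B (fun x => χ x - t * v x) p ∂κ - ∫ p, conjOn B χ p ∂κ
      ≤ t * κ.real W := by
    rw [← integral_sub (hj hc2) (hj hc1)]
    calc _ ≤ ∫ p, W.indicator (fun _ => t) p ∂κ := by
          refine integral_mono ((hj hc2).sub (hj hc1)) ((integrable_const t).indicator hWm)
            fun p => ?_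
          by_cases hp : p ∈ W
          · have := conjOn_le_conjOn_add (f := fun x => χ x - t * v x) (ε := t) hB hBne hχ
              (fun s _ => by nlinarith [hv1 s]) p
            simp only [Set.indicator_of_mem hp]
            linarith
          · simp only [Set.indicator_of_notMem hp]
            rw [hW, Set.mem_ofPred_eq, not_lt] at hp
            linarith
      _ = t * κ.real W := by
          rw [integral_indicator_const _ hWm, smul_eq_mul, mul_comm]
  have h4 : t * ∫ x, v x * Real.exp (β * χ x) ∂m ≤ t * κ.real W := by linarith
  exact le_of_mul_le_mul_left h4 ht

/-- The reverse Fatou inequality for a sequence of sets. -/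
theorem le_measureReal_limsup {Ω : Type*} [MeasurableSpace Ω] {κ : Measure Ω} [IsFiniteMeasure κ]
    {W : ℕ → Set Ω} (hW : ∀ j, MeasurableSet (W j)) {a : ℕ → ℝ} {c : ℝ}
    (ha : ∀ j, a j ≤ κ.real (W j)) (hlim : Tendsto a atTop (𝓝 c)) :
    c ≤ κ.real {p | ∃ᶠ j in atTop, p ∈ W j} := by
  have hset : {p | ∃ᶠ j in atTop, p ∈ W j} = ⋂ n, ⋃ j ≥ n, W j := by
    ext p; simp [frequently_atTop]
  rw [hset]
  have hanti : Antitone fun n => ⋃ j ≥ n, W j := fun n n' hnn' =>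
    Set.iUnion₂_mono' fun j hj => ⟨j, le_trans hnn' hj, le_rfl⟩
  have hmeas : ∀ n, NullMeasurableSet (⋃ j ≥ n, W j) κ := fun n =>
    (MeasurableSet.iUnion fun j => MeasurableSet.iUnion fun _ => hW j).nullMeasurableSet
  have h1 := tendsto_measure_iInter_atTop hmeas hanti ⟨0, measure_ne_top κ _⟩
  have h2 := (ENNReal.tendsto_toReal (measure_ne_top κ _)).comp h1
  refine le_of_tendsto_of_tendsto' hlim h2 fun n => (ha n).trans ?_
  exact measureReal_mono (Set.subset_iUnion₂_of_subset n le_rfl le_rfl) (measure_ne_top _ _)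

end Perturbation

variable {n : ℕ} {P : ConvexBody (EuclideanSpace ℝ (Fin n))}
  {ν : Measure (EuclideanSpace ℝ (Fin n))} {β : ℝ}
  {φ : C(EuclideanSpace ℝ (Fin n), ℝ)} {χ : ℕ → C(EuclideanSpace ℝ (Fin n), ℝ)} {R : ℕ → ℝ}
  {M : NNReal}

/-- Subgradients at almost maximal points: if `p` changes the conjugate of `χ j` for infinitely many
of the perturbations `t_j v_j`, with `v_j` supported near `K` and `t_j → 0`, then `p` is a
subgradient of the limit at a point of `K`. -/
theorem IsLimitOfOptimal.mem_subgradientImage {κ : Measure (EuclideanSpace ℝ (Fin n))}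
    (h : IsLimitOfOptimal (P : Set (EuclideanSpace ℝ (Fin n))) ν κ β φ χ R M)
    {K : Set (EuclideanSpace ℝ (Fin n))} (hK : IsCompact K) (hKne : K.Nonempty)
    {t : ℕ → ℝ} (ht : Tendsto t atTop (𝓝 0)) {v : ℕ → EuclideanSpace ℝ (Fin n) → ℝ}
    (hvc : ∀ j, Continuous (v j)) (hv1 : ∀ j x, v j x ≤ 1) (ht0 : ∀ j, 0 ≤ t j)
    (hvK : ∀ j x, 0 < v j x → Metric.infDist x K ≤ t j)
    {p : EuclideanSpace ℝ (Fin n)}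
    (hp : ∃ᶠ j in atTop, conjOn (Metric.closedBall 0 (R j)) (χ j) p
      < conjOn (Metric.closedBall 0 (R j)) (fun x => χ j x - t j * v j x) p) :
    p ∈ subgradientImage φ K := by
  have key : ∀ j, ∃ x y, conjOn (Metric.closedBall 0 (R j)) (χ j) p
      < conjOn (Metric.closedBall 0 (R j)) (fun x => χ j x - t j * v j x) p →
      y ∈ K ∧ dist x y ≤ t j ∧ ∀ z ∈ Metric.closedBall 0 (R j),
        χ j x + inner ℝ p (z - x) ≤ χ j z + t j := by
    intro j
    by_cases hlt : conjOn (Metric.closedBall 0 (R j)) (χ j) p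
      < conjOn (Metric.closedBall 0 (R j)) (fun x => χ j x - t j * v j x) p
    swap
    · exact ⟨0, 0, fun h => absurd h hlt⟩
    have hB : IsCompact (Metric.closedBall (0 : EuclideanSpace ℝ (Fin n)) (R j)) :=
      isCompact_closedBall _ _
    have hBne : (Metric.closedBall (0 : EuclideanSpace ℝ (Fin n)) (R j)).Nonempty :=
      Metric.nonempty_closedBall.2 (zero_le_one.trans (h.one_le_radius j))
    have hχc := (χ j).continuous
    have hvj := hvc j
    obtain ⟨x, hx, hxeq, -⟩ := exists_conjOn_eq (f := fun x => χ j x - t j * v j x) hB hBne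
      (by fun_prop) p
    rw [hxeq] at hlt
    have hvx : 0 < v j x := by
      by_contra hneg
      have := le_conjOn hB hχc hx p
      nlinarith [ht0 j]
    obtain ⟨y, hy, hxy⟩ := hK.exists_infDist_eq_dist hKne x
    refine ⟨x, y, fun _ => ⟨hy, hxy ▸ hvK j x hvx, fun z hz => ?_⟩⟩
    have h1 := le_conjOn hB hχc hz p
    have h2 : t j * v j x ≤ t j := mul_le_of_le_one_right (ht0 j) (hv1 j x)
    rw [inner_sub_right]
    linarith
  choose x y hxy using key
  set S := {j | conjOn (Metric.closedBall 0 (R j)) (χ j) p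
      < conjOn (Metric.closedBall 0 (R j)) (fun x => χ j x - t j * v j x) p} with hS
  have hne : (atTop ⊓ 𝓟 S).NeBot := frequently_mem_iff_neBot.1 hp
  set U := Ultrafilter.of (atTop ⊓ 𝓟 S)
  have hU : (U : Filter ℕ) ≤ atTop ⊓ 𝓟 S := Ultrafilter.of_le _
  have hUtop : (U : Filter ℕ) ≤ atTop := hU.trans inf_le_left
  have hUS : ∀ᶠ j in (U : Filter ℕ), j ∈ S := hU.trans inf_le_right (mem_principal_self S)
  obtain ⟨y₀, hy₀, hlim⟩ := hK.ultrafilter_le_nhds' (U.map y)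
    (hUS.mono fun j hj => (hxy j hj).1)
  have hylim : Tendsto y U (𝓝 y₀) := hlim
  have hdist : Tendsto (fun j => dist (x j) (y j)) U (𝓝 0) :=
    squeeze_zero' (Eventually.of_forall fun _ => dist_nonneg)
      (hUS.mono fun j hj => (hxy j hj).2.1) (ht.mono_left hUtop)
  have hxlim : Tendsto x U (𝓝 y₀) :=
    (tendsto_iff_of_dist hdist).2 hylim
  have hχx : Tendsto (fun j => χ j (x j)) U (𝓝 (φ y₀)) :=
    (continuous_eval.tendsto (φ, y₀)).comp ((h.tendsto.mono_left hUtop).prodMk_nhds hxlim)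
  refine Set.mem_iUnion₂.2 ⟨y₀, hy₀, fun z => ?_⟩
  have h1 : Tendsto (fun j => χ j (x j) + inner ℝ p (z - x j)) U
      (𝓝 (φ y₀ + inner ℝ p (z - y₀))) :=
    hχx.add (tendsto_const_nhds.inner (tendsto_const_nhds.sub hxlim))
  have h2 : Tendsto (fun j => χ j z + t j) U (𝓝 (φ z + 0)) :=
    ((h.tendsto_apply z).add ht).mono_left hUtop
  rw [add_zero] at h2
  refine le_of_tendsto_of_tendsto h1 h2 ?_
  filter_upwards [hUS, hUtop (h.eventually_mem_ball z)] with j hj hz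
  exact (hxy j hj).2.2 z hz

/-- The density of the limit is dominated by its Monge-Ampère measure on compact sets. -/
theorem IsLimitOfOptimal.setIntegral_le_measure_subgradientImage
    [IsFiniteMeasureOnCompacts ν]
    [IsProbabilityMeasure (volume.restrict (P : Set (EuclideanSpace ℝ (Fin n))))]
    (h : IsLimitOfOptimal (P : Set (EuclideanSpace ℝ (Fin n))) ν
      (volume.restrict (P : Set (EuclideanSpace ℝ (Fin n)))) β φ χ R M)
    (hβ : 0 < β)
    (hint : Integrable (fun x => Real.exp
      (β * conjOn (P : Set (EuclideanSpace ℝ (Fin n))) (fun _ => 0) x)) ν)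
    {K : Set (EuclideanSpace ℝ (Fin n))} (hK : IsCompact K) :
    ENNReal.ofReal (∫ x in K, Real.exp (β * φ x) ∂ν) ≤ volume (subgradientImage φ K) := by
  rcases K.eq_empty_or_nonempty with rfl | hKne
  · simp
  set κ := volume.restrict (P : Set (EuclideanSpace ℝ (Fin n)))
  have hκ : ∀ᵐ p ∂κ, p ∈ (P : Set (EuclideanSpace ℝ (Fin n))) :=
    ae_restrict_mem P.isCompact.measurableSet
  set t : ℕ → ℝ := fun j => 1 / ((j : ℝ) + 1) with ht
  have ht0 : ∀ j, 0 < t j := fun j => by positivity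
  set v : ℕ → EuclideanSpace ℝ (Fin n) → ℝ := fun j x => max 0 (1 - Metric.infDist x K / t j) with hv
  have hvc : ∀ j, Continuous (v j) := fun j => by
    have := Metric.continuous_infDist_pt K
    fun_prop
  have hv0 : ∀ j x, 0 ≤ v j x := fun j x => le_max_left _ _
  have hv1 : ∀ j x, v j x ≤ 1 := fun j x => max_le zero_le_one (by
    have : 0 ≤ Metric.infDist x K / t j := div_nonneg Metric.infDist_nonneg (ht0 j).le
    linarith)
  have hvK : ∀ j, ∀ x ∈ K, v j x = 1 := fun j x hx => by
    simp [hv, Metric.infDist_zero_of_mem hx]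
  have hvsupp : ∀ j x, 0 < v j x → Metric.infDist x K ≤ t j := fun j x hx => by
    rcases lt_max_iff.1 hx with h0 | h0
    · exact absurd h0 (lt_irrefl _)
    · have : Metric.infDist x K / t j < 1 := by linarith
      rw [div_lt_one (ht0 j)] at this
      exact this.le
  set B : ℕ → Set (EuclideanSpace ℝ (Fin n)) := fun j => Metric.closedBall 0 (R j) with hBdef
  have hB : ∀ j, IsCompact (B j) := fun j => isCompact_closedBall _ _
  have hBne : ∀ j, (B j).Nonempty := fun j =>
    Metric.nonempty_closedBall.2 (zero_le_one.trans (h.one_le_radius j))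
  set W : ℕ → Set (EuclideanSpace ℝ (Fin n)) := fun j =>
    {p | conjOn (B j) (χ j) p < conjOn (B j) (fun x => χ j x - t j * v j x) p} with hW
  have hWm : ∀ j, MeasurableSet (W j) := fun j => by
    refine (isOpen_lt (continuous_conjOn (hB j) (hBne j) (χ j).continuous)
      (continuous_conjOn (hB j) (hBne j) ?_)).measurableSet
    have := hvc j
    fun_prop
  have hle : ∀ j, ∫ x in K ∩ B j, Real.exp (β * χ j x) ∂ν ≤ κ.real (W j) := by
    intro j
    have hfin : IsFiniteMeasure (ν.restrict (B j)) :=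
      ⟨by rw [Measure.restrict_apply_univ]; exact (hB j).measure_lt_top⟩
    have hm : ∀ᵐ x ∂(ν.restrict (B j)), x ∈ B j := ae_restrict_mem (hB j).measurableSet
    refine le_trans ?_ ((h.optimal j).integral_mul_exp_le_measure (hB j) (hBne j) P.isCompact hm hκ
      (hvc j) (hv1 j) (ht0 j))
    have := hvc j
    have hi : Integrable (fun x => v j x * Real.exp (β * χ j x)) (ν.restrict (B j)) :=
      integrable_of_ae_mem_isCompact (hB j) hm (by fun_prop)
    rw [← Measure.restrict_restrict hK.measurableSet]
    calc ∫ x in K, Real.exp (β * χ j x) ∂(ν.restrict (B j))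
        = ∫ x in K, v j x * Real.exp (β * χ j x) ∂(ν.restrict (B j)) :=
          setIntegral_congr_fun hK.measurableSet fun x hx => by simp [hvK j x hx]
      _ ≤ _ := setIntegral_le_integral hi
          (ae_of_all _ fun x => mul_nonneg (hv0 j x) (Real.exp_pos _).le)
  have hlim := le_measureReal_limsup hWm hle (h.tendsto_setIntegral hβ hint hK.measurableSet)
  have hsub : {p | ∃ᶠ j in atTop, p ∈ W j} ⊆ subgradientImage φ K := fun p hp =>
    h.mem_subgradientImage hK hKne (tendsto_one_div_add_atTop_nhds_zero_nat) hvc hv1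
      (fun j => (ht0 j).le) hvsupp hp
  calc _ ≤ ENNReal.ofReal (κ.real {p | ∃ᶠ j in atTop, p ∈ W j}) := ENNReal.ofReal_le_ofReal hlim
    _ = κ {p | ∃ᶠ j in atTop, p ∈ W j} := ofReal_measureReal
    _ ≤ volume {p | ∃ᶠ j in atTop, p ∈ W j} := Measure.restrict_apply_le _ _
    _ ≤ _ := measure_mono hsub

end MongeAmpere

/-! ### From the inequality on compact sets to the second boundary value problem -/

section SecondBVP

variable {n : ℕ} {P : ConvexBody (EuclideanSpace ℝ (Fin n))}
  {φ : EuclideanSpace ℝ (Fin n) → ℝ}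

theorem subgradientImage_mono {A A' : Set (EuclideanSpace ℝ (Fin n))} (h : A ⊆ A') :
    subgradientImage φ A ⊆ subgradientImage φ A' :=
  Set.biUnion_subset_biUnion_left h

theorem isClosed_subgradientImage (hφ : Continuous φ) {K : Set (EuclideanSpace ℝ (Fin n))}
    (hK : IsCompact K) : IsClosed (subgradientImage φ K) := by
  have : CompactSpace K := isCompact_iff_compactSpace.1 hK
  have hcl : IsClosed {z : EuclideanSpace ℝ (Fin n) × K | ∀ y, φ z.2 + inner ℝ z.1 (y - z.2) ≤ φ y} := by
    simp only [Set.ofPred_forall]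
    exact isClosed_iInter fun y => isClosed_le (by fun_prop) continuous_const
  have himg : subgradientImage φ K = Prod.fst ''
      {z : EuclideanSpace ℝ (Fin n) × K | ∀ y, φ z.2 + inner ℝ z.1 (y - z.2) ≤ φ y} := by
    ext p
    simp [subgradientImage, subgradient]
  rw [himg]
  exact isClosedMap_fst_of_compactSpace _ hcl

/-- A slope that is a subgradient at two different points is a point of non-differentiability
of a local conjugate; by Rademacher's theorem such slopes form a null set. -/
theorem volume_subgradient_overlap (hφ : Continuous φ) :
    volume {p | ∃ x y, x ≠ y ∧ p ∈ subgradient φ x ∧ p ∈ subgradient φ y} = 0 := by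
  have hnull : ∀ r : ℕ, volume
      {p | ¬DifferentiableAt ℝ (conjOn (Metric.closedBall 0 (r : ℝ)) φ) p} = 0 := fun r => by
    have hlip := lipschitzWith_conjOn (C := r) (isCompact_closedBall (0 : EuclideanSpace ℝ (Fin n)) r)
      (Metric.nonempty_closedBall.2 r.cast_nonneg)
      (fun s hs => by simpa using hs) hφ
    exact ae_iff.1 hlip.ae_differentiableAt
  refine measure_mono_null ?_ (measure_iUnion_null hnull)
  rintro p ⟨x, y, hxy, hx, hy⟩
  obtain ⟨r, hr⟩ := exists_nat_ge (max ‖x‖ ‖y‖)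
  rw [Set.mem_iUnion]
  refine ⟨r, fun hd => hxy ?_⟩
  set f := conjOn (Metric.closedBall (0 : EuclideanSpace ℝ (Fin n)) (r : ℝ)) φ
  have hB : IsCompact (Metric.closedBall (0 : EuclideanSpace ℝ (Fin n)) (r : ℝ)) :=
    isCompact_closedBall _ _
  have key : ∀ z, ‖z‖ ≤ r → p ∈ subgradient φ z → ∀ w, inner ℝ w z = fderiv ℝ f p w := by
    intro z hz hpz w
    have hzB : z ∈ Metric.closedBall (0 : EuclideanSpace ℝ (Fin n)) (r : ℝ) :=
      mem_closedBall_zero_iff.2 hz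
    have hfp : f p ≤ inner ℝ p z - φ z := conjOn_le ⟨z, hzB⟩ fun s _ => by
      have := hpz s
      rw [inner_sub_right] at this
      linarith
    have hmin : IsLocalMin (fun p' => f p' - innerSL ℝ z p') p :=
      Eventually.of_forall fun p' => by
        have := le_conjOn hB hφ hzB p'
        simp only [innerSL_apply_apply, real_inner_comm _ z]
        linarith
    have hder : HasFDerivAt (fun p' => f p' - innerSL ℝ z p') (fderiv ℝ f p - innerSL ℝ z) p :=
      hd.hasFDerivAt.sub (innerSL ℝ z).hasFDerivAt
    have h0 := hmin.hasFDerivAt_eq_zero hder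
    have h1 := DFunLike.congr_fun h0 w
    simp only [sub_apply, innerSL_apply_apply, zero_apply] at h1
    rw [real_inner_comm]
    linarith
  refine ext_inner_left ℝ fun w => ?_
  rw [key x ((le_max_left _ _).trans hr) hx, key y ((le_max_right _ _).trans hr) hy]

variable (hP : volume (P : Set (EuclideanSpace ℝ (Fin n))) = 1)

include hP in
/-- If a probability measure is dominated by the Monge-Ampère measure on compact sets then the two
agree: the total mass of the latter is at most `|P| = 1`, and it is additive up to the overlap
of subgradients. -/
theorem mongeAmpere_eq_of_le_on_compacts (hφ : Continuous φ) (hgrad : HasGradientImageIn P φ)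
    {μ : Measure (EuclideanSpace ℝ (Fin n))} [IsProbabilityMeasure μ]
    (hle : ∀ K, IsCompact K → μ K ≤ volume (subgradientImage φ K))
    {A : Set (EuclideanSpace ℝ (Fin n))} (hA : MeasurableSet A) : mongeAmpere φ A = μ A := by
  apply le_antisymm
  · have h1 : ∀ K ⊆ Aᶜ, IsCompact K → volume (subgradientImage φ A) + μ K ≤ 1 := by
      intro K hKA hK
      have hm := (isClosed_subgradientImage hφ hK).measurableSet
      have h0 : volume (subgradientImage φ A ∩ subgradientImage φ K) = 0 := by
        refine measure_mono_null ?_ (volume_subgradient_overlap hφ)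
        rintro p ⟨hp1, hp2⟩
        obtain ⟨x, hx, hpx⟩ := Set.mem_iUnion₂.1 hp1
        obtain ⟨y, hy, hpy⟩ := Set.mem_iUnion₂.1 hp2
        exact ⟨x, y, fun he => hKA hy (he ▸ hx), hpx, hpy⟩
      calc volume (subgradientImage φ A) + μ K
          ≤ volume (subgradientImage φ A \ subgradientImage φ K)
            + volume (subgradientImage φ K) := by
            gcongr ?_ + ?_
            · rw [← measure_inter_add_sdiff (subgradientImage φ A) hm, h0, zero_add]
            · exact hle K hK
        _ = volume ((subgradientImage φ A \ subgradientImage φ K) ∪ subgradientImage φ K) :=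
            (measure_union Set.disjoint_sdiff_left hm).symm
        _ ≤ volume (P : Set (EuclideanSpace ℝ (Fin n))) := by
            refine measure_mono (Set.union_subset ?_ ?_)
            · exact Set.sdiff_subset.trans ((subgradientImage_mono (Set.subset_univ _)).trans
                hgrad.subset)
            · exact (subgradientImage_mono (Set.subset_univ _)).trans hgrad.subset
        _ = 1 := hP
    have h2 : volume (subgradientImage φ A) + μ Aᶜ ≤ 1 := by
      have hle1 : volume (subgradientImage φ A) ≤ 1 := by
        simpa using h1 ∅ (Set.empty_subset _) isCompact_empty
      have hsub : μ Aᶜ ≤ 1 - volume (subgradientImage φ A) := by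
        rw [hA.compl.measure_eq_iSup_isCompact μ]
        exact iSup₂_le fun K hKA => iSup_le fun hK => ENNReal.le_sub_of_add_le_left
          (ne_top_of_le_ne_top ENNReal.one_ne_top hle1) (h1 K hKA hK)
      exact (add_le_add_right hsub _).trans_eq (add_tsub_cancel_of_le hle1)
    have h3 : μ A + μ Aᶜ = 1 := by rw [measure_add_measure_compl hA, measure_univ]
    rw [← h3] at h2
    exact (ENNReal.add_le_add_iff_right (measure_ne_top μ _)).1 h2
  · rw [hA.measure_eq_iSup_isCompact μ]
    exact iSup₂_le fun K hKA => iSup_le fun hK => (hle K hK).trans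
      (measure_mono (subgradientImage_mono hKA))

include hP in
/-- The slopes with finite conjugate form a convex set. If the subgradients fill `P` up to a null
set, this set contains the interior of `P`, and at its interior points the supremum defining the
conjugate is attained. -/
theorem interior_subset_subgradientImage (hφ : Continuous φ)
    (hfull : volume (subgradientImage φ Set.univ) = 1) (hgrad : HasGradientImageIn P φ) :
    interior (P : Set (EuclideanSpace ℝ (Fin n))) ⊆ subgradientImage φ Set.univ := by
  set D : Set (EuclideanSpace ℝ (Fin n)) := {p | ∃ c : ℝ, ∀ x, inner ℝ p x - φ x ≤ c} with hD
  have hDconv : Convex ℝ D := by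
    rintro p ⟨c, hc⟩ q ⟨d, hd⟩ a b ha hb hab
    refine ⟨a * c + b * d, fun x => ?_⟩
    rw [inner_add_left, real_inner_smul_left, real_inner_smul_left]
    have h1 := mul_le_mul_of_nonneg_left (hc x) ha
    have h2 := mul_le_mul_of_nonneg_left (hd x) hb
    have h3 : φ x = a * φ x + b * φ x := by rw [← add_mul, hab, one_mul]
    linarith
  have hsubD : subgradientImage φ Set.univ ⊆ D := by
    intro p hp
    obtain ⟨x, -, hpx⟩ := Set.mem_iUnion₂.1 hp
    refine ⟨inner ℝ p x - φ x, fun y => ?_⟩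
    have := hpx y
    rw [inner_sub_right] at this
    linarith
  have hDint : (interior D).Nonempty := by
    by_contra hne
    rw [Set.not_nonempty_iff_eq_empty] at hne
    have h1 : D ⊆ frontier D := by
      rw [frontier, hne, Set.sdiff_empty]; exact subset_closure
    have h2 := measure_mono_null (hsubD.trans h1) (hDconv.addHaar_frontier volume)
    rw [hfull] at h2
    exact one_ne_zero h2
  have hPD : interior (P : Set (EuclideanSpace ℝ (Fin n))) ⊆ interior D := by
    rw [← hDconv.interior_closure_eq_interior_of_nonempty_interior hDint]
    refine interior_maximal (fun p hp => ?_) isOpen_interior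
    by_contra hpD
    set O := interior (P : Set (EuclideanSpace ℝ (Fin n))) ∩ (closure D)ᶜ
    have hO : IsOpen O := isOpen_interior.inter isClosed_closure.isOpen_compl
    have hOpos : 0 < volume O := hO.measure_pos volume ⟨p, hp, hpD⟩
    have hdisj : Disjoint (subgradientImage φ Set.univ) O :=
      Set.disjoint_left.2 fun q hq hqO => hqO.2 (subset_closure (hsubD hq))
    have h1 : volume (subgradientImage φ Set.univ) + volume O ≤ 1 := by
      rw [← measure_union hdisj hO.measurableSet, ← hP]
      exact measure_mono (Set.union_subset hgrad.subset
        (Set.inter_subset_left.trans interior_subset))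
    rw [hfull] at h1
    exact absurd h1 (not_le.2 (ENNReal.lt_add_right ENNReal.one_ne_top hOpos.ne'))
  intro p hp
  have hpD := hPD hp
  obtain ⟨δ, hδ, hball⟩ := Metric.isOpen_iff.1 isOpen_interior p hpD
  -- finiteness of the conjugate at `p ± (δ/2) e_i` bounds the superlevel sets at `p`
  have hex : ∀ i : Fin n, ∃ c : ℝ, ∀ x, inner ℝ p x - φ x + δ / 2 * |x i| ≤ c := by
    intro i
    have hmem : ∀ s : ℝ, |s| < δ → p + EuclideanSpace.single i s ∈ D := fun s hs => by
      refine interior_subset (hball ?_)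
      rw [Metric.mem_ball, dist_eq_norm, add_sub_cancel_left, PiLp.norm_single]
      exact hs
    have hδ2 : |δ / 2| < δ := by rw [abs_of_pos (half_pos hδ)]; linarith
    obtain ⟨c, hc⟩ := hmem (δ / 2) hδ2
    obtain ⟨d, hd⟩ := hmem (-(δ / 2)) (by rwa [abs_neg])
    refine ⟨max c d, fun x => ?_⟩
    have h1 := hc x
    have h2 := hd x
    simp only [inner_add_left, EuclideanSpace.inner_single_left, conj_trivial] at h1 h2
    rcases abs_cases (x i) with ⟨h, -⟩ | ⟨h, -⟩ <;> rw [h]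
    · exact le_trans (by linarith) (le_max_left c d)
    · exact le_trans (by linarith) (le_max_right c d)
  choose c hc using hex
  have hbdd : Bornology.IsBounded {x | φ x - inner ℝ p x ≤ φ 0 - inner ℝ p 0} := by
    have hcomp : IsCompact (WithLp.toLp 2 '' Set.univ.pi fun i : Fin n =>
        Set.Icc (-((c i + φ 0) / (δ / 2))) ((c i + φ 0) / (δ / 2))) :=
      (isCompact_univ_pi fun _ => isCompact_Icc).image (PiLp.continuous_toLp 2 _)
    refine hcomp.isBounded.subset fun x hx => ⟨WithLp.ofLp x, fun i _ => ?_, rfl⟩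
    rw [Set.mem_ofPred_eq, inner_zero_right, sub_zero] at hx
    rw [Set.mem_Icc, ← abs_le, le_div_iff₀ (half_pos hδ)]
    linarith [hc i x]
  obtain ⟨x, hx⟩ := (by fun_prop : Continuous fun x => φ x - inner ℝ p x).exists_forall_le_of_isBounded
    0 hbdd
  refine Set.mem_iUnion₂.2 ⟨x, Set.mem_univ x, fun y => ?_⟩
  have := hx y
  rw [inner_sub_right]
  linarith

/-! ### Uniqueness -/

/-- On the set `U` where `ψ₁ > ψ₂`, slopes of `ψ₁` that are slopes of `ψ₂` anywhere are slopes of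
`ψ₂` on `U`. -/
theorem subgradientImage_inter_subset {ψ₁ ψ₂ : EuclideanSpace ℝ (Fin n) → ℝ} :
    subgradientImage ψ₁ {x | ψ₂ x < ψ₁ x} ∩ subgradientImage ψ₂ Set.univ
      ⊆ subgradientImage ψ₂ {x | ψ₂ x < ψ₁ x} := by
  rintro p ⟨h1, h2⟩
  obtain ⟨x, hx, hpx⟩ := Set.mem_iUnion₂.1 h1
  obtain ⟨y, -, hpy⟩ := Set.mem_iUnion₂.1 h2
  refine Set.mem_iUnion₂.2 ⟨y, ?_, hpy⟩
  have h3 := hpx y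
  have h4 := hpy x
  rw [inner_sub_right] at h3 h4
  simp only [Set.mem_ofPred_eq] at hx ⊢
  linarith

variable {β : ℝ} {φ₀ : EuclideanSpace ℝ (Fin n) → ℝ} {μ₀ : Measure (EuclideanSpace ℝ (Fin n))}

theorem HasGradientImageIn.continuous (h : HasGradientImageIn P φ) : Continuous φ := by
  have := h.convexOn.continuousOn_interior
  rw [interior_univ] at this
  exact continuousOn_univ.1 this

include hP in
/-- Comparison principle. -/
theorem SolvesSecondBVP.le [μ₀.IsOpenPosMeasure] (hβ : 0 < β) (hφ₀ : Continuous φ₀)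
    {ψ₁ ψ₂ : EuclideanSpace ℝ (Fin n) → ℝ} (h₁ : SolvesSecondBVP P β φ₀ μ₀ ψ₁)
    (h₂ : SolvesSecondBVP P β φ₀ μ₀ ψ₂) : ψ₁ ≤ ψ₂ := by
  have hc1 := h₁.gradient.continuous
  have hc2 := h₂.gradient.continuous
  set U := {x | ψ₂ x < ψ₁ x} with hU
  have hUo : IsOpen U := isOpen_lt hc2 hc1
  have hfront : volume (frontier (P : Set (EuclideanSpace ℝ (Fin n)))) = 0 :=
    P.convex.addHaar_frontier volume
  have hMA : mongeAmpere ψ₁ U ≤ mongeAmpere ψ₂ U := by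
    refine (measure_mono (t := subgradientImage ψ₂ U
      ∪ frontier (P : Set (EuclideanSpace ℝ (Fin n)))) fun p hp => ?_).trans
      ((measure_union_le _ _).trans (by rw [hfront, add_zero]; rfl))
    by_cases hpi : p ∈ interior (P : Set (EuclideanSpace ℝ (Fin n)))
    · exact Or.inl (subgradientImage_inter_subset ⟨hp, h₂.onto hpi⟩)
    · exact Or.inr ⟨subset_closure (h₁.gradient.subset
        (subgradientImage_mono (Set.subset_univ _) hp)), hpi⟩
  have hfin : mongeAmpere ψ₂ U ≠ ⊤ := by
    have : mongeAmpere ψ₂ U ≤ 1 := hP ▸ measure_mono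
      ((subgradientImage_mono (Set.subset_univ _)).trans h₂.gradient.subset)
    exact ne_top_of_le_ne_top ENNReal.one_ne_top this
  rw [h₁.equation U hUo.measurableSet, h₂.equation U hUo.measurableSet] at hMA
  rw [h₂.equation U hUo.measurableSet] at hfin
  by_contra hne
  have hUne : U.Nonempty := by
    by_contra he
    exact hne fun x => not_lt.1 fun hx => he ⟨x, hx⟩
  refine absurd hMA (not_le.2 ?_)
  refine setLIntegral_strict_mono hUo.measurableSet (hUo.measure_pos μ₀ hUne).ne'
    (by fun_prop) hfin (ae_of_all _ fun x hx => ?_)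
  rw [ENNReal.ofReal_lt_ofReal_iff (Real.exp_pos _), Real.exp_lt_exp]
  exact mul_lt_mul_of_pos_left (sub_lt_sub_right hx _) hβ

end SecondBVP

/-! ### The weighted measure and the lattice Gibbs potentials -/

section Lattice

variable {n : ℕ} {P : ConvexBody (EuclideanSpace ℝ (Fin n))} {β : ℝ}
  {φ₀ : EuclideanSpace ℝ (Fin n) → ℝ} {μ₀ : Measure (EuclideanSpace ℝ (Fin n))}

theorem setLIntegral_weightedMeasure (hφ₀ : Continuous φ₀) {ψ : EuclideanSpace ℝ (Fin n) → ℝ}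
    (hψ : Continuous ψ) {A : Set (EuclideanSpace ℝ (Fin n))} (hA : MeasurableSet A) :
    ∫⁻ x in A, ENNReal.ofReal (Real.exp (β * ψ x)) ∂(weightedMeasure β φ₀ μ₀)
      = ∫⁻ x in A, ENNReal.ofReal (Real.exp (β * (ψ x - φ₀ x))) ∂μ₀ := by
  rw [weightedMeasure, setLIntegral_withDensity_eq_setLIntegral_mul _ (by fun_prop) (by fun_prop) hA]
  refine lintegral_congr fun x => ?_
  rw [Pi.mul_apply, ← ENNReal.ofReal_mul (Real.exp_pos _).le, ← Real.exp_add]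
  congr 2
  ring

theorem integrable_exp_supportFunction (hφ₀ : Continuous φ₀)
    (hfin : ∫⁻ x, ENNReal.ofReal (Real.exp (β * (supportFunction P x - φ₀ x))) ∂μ₀ < ⊤) :
    Integrable (fun x => Real.exp
      (β * conjOn (P : Set (EuclideanSpace ℝ (Fin n))) (fun _ => 0) x))
      (weightedMeasure β φ₀ μ₀) := by
  have hc := continuous_conjOn P.isCompact P.nonempty (f := fun _ => (0 : ℝ)) continuous_const
  refine ⟨(by fun_prop : Continuous fun x => Real.exp
    (β * conjOn (P : Set (EuclideanSpace ℝ (Fin n))) (fun _ => 0) x)).aestronglyMeasurable, ?_⟩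
  rw [hasFiniteIntegral_iff_ofReal (ae_of_all _ fun x => (Real.exp_pos _).le),
    ← setLIntegral_univ, setLIntegral_weightedMeasure hφ₀ hc MeasurableSet.univ, setLIntegral_univ]
  simpa only [supportFunction_eq_conjOn] using hfin

theorem absolutelyContinuous_withDensity_ofReal {μ : Measure (EuclideanSpace ℝ (Fin n))}
    {f : EuclideanSpace ℝ (Fin n) → ℝ} (hf : Measurable f) (hpos : ∀ x, 0 < f x) :
    μ ≪ μ.withDensity fun x => ENNReal.ofReal (f x) :=
  withDensity_absolutelyContinuous' (by fun_prop)
    (ae_of_all _ fun x => (ENNReal.ofReal_pos.2 (hpos x)).ne')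

theorem isOpenPosMeasure_weightedMeasure [μ₀.IsOpenPosMeasure] (hφ₀ : Continuous φ₀) :
    (weightedMeasure β φ₀ μ₀).IsOpenPosMeasure :=
  (absolutelyContinuous_withDensity_ofReal (f := fun x => Real.exp (-(β * φ₀ x))) (by fun_prop)
    fun _ => Real.exp_pos _).isOpenPosMeasure

theorem sigmaFinite_weightedMeasure [SigmaFinite μ₀] :
    SigmaFinite (weightedMeasure β φ₀ μ₀) :=
  SigmaFinite.withDensity_ofReal _

theorem per_rpow_eq_gibbsWeight {k : ℕ} (hk : 0 < k)
    (x : Fin (latticeNumber P k) → EuclideanSpace ℝ (Fin n)) :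
    per P k x ^ (β / k) = gibbsWeight (scaledPoint P k) k β x := by
  simp only [per, gibbsWeight, expPermanent, smul_scaledPoint hk]

theorem partitionFunction_eq_gibbsZ {k : ℕ} (hk : 0 < k) :
    partitionFunction P β φ₀ μ₀ k = gibbsZ (scaledPoint P k) k β (weightedMeasure β φ₀ μ₀) := by
  simp only [partitionFunction, gibbsZ, per_rpow_eq_gibbsWeight hk]

theorem approxPotential_eq_gibbsPotential {k : ℕ} (hk : 0 < k) :
    approxPotential P β φ₀ μ₀ k
      = gibbsPotential (scaledPoint P k) k β (weightedMeasure β φ₀ μ₀) := by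
  funext x
  simp only [approxPotential, gibbsPotential, per_rpow_eq_gibbsWeight hk,
    partitionFunction_eq_gibbsZ hk]

section Properties

variable (hβ : 0 < β)
  (hint : Integrable (fun x => Real.exp
    (β * conjOn (P : Set (EuclideanSpace ℝ (Fin n))) (fun _ => 0) x)) (weightedMeasure β φ₀ μ₀))
  [SigmaFinite (weightedMeasure β φ₀ μ₀)] [NeZero (weightedMeasure β φ₀ μ₀)]

include hβ hint

theorem hasGradientImageIn_approxPotential {k : ℕ} (hk : 0 < k) (hN : 0 < latticeNumber P k) :
    HasGradientImageIn P (approxPotential P β φ₀ μ₀ k) := by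
  have hk' : (0 : ℝ) < k := by positivity
  rw [approxPotential_eq_gibbsPotential hk]
  exact .of_increments
    (convexOn_gibbsPotential P.isCompact (scaledPoint_mem hk) hk' hβ hint hN)
    (gibbsPotential_sub_le P.isCompact (scaledPoint_mem hk) hk' hβ hint hN)

variable (hP : volume (P : Set (EuclideanSpace ℝ (Fin n))) = 1) (hn : 0 < n)

include hP hn in
theorem tendstoLocallyUniformly_approxPotential [(weightedMeasure β φ₀ μ₀).IsOpenPosMeasure]
    {φ : C(EuclideanSpace ℝ (Fin n), ℝ)} {χ : ℕ → C(EuclideanSpace ℝ (Fin n), ℝ)} {R : ℕ → ℝ}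
    {M : NNReal}
    (h : IsLimitOfOptimal (P : Set (EuclideanSpace ℝ (Fin n))) (weightedMeasure β φ₀ μ₀)
      (volume.restrict (P : Set (EuclideanSpace ℝ (Fin n)))) β φ χ R M) :
    TendstoLocallyUniformly (fun k => approxPotential P β φ₀ μ₀ k) φ atTop := by
  classical
  have hcont : ∀ᶠ k : ℕ in atTop, Continuous (approxPotential P β φ₀ μ₀ k) := by
    filter_upwards [eventually_gt_atTop 0,
      (tendsto_latticeNumber hP hn).eventually_gt_atTop 0] with k hk hN
    exact (hasGradientImageIn_approxPotential hβ hint hk hN).continuous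
  -- for small `k` there may be no lattice points; those terms are replaced by `0`
  set Φ : ℕ → C(EuclideanSpace ℝ (Fin n), ℝ) := fun k =>
    if hc : Continuous (approxPotential P β φ₀ μ₀ k) then ⟨_, hc⟩ else 0
  have hΦ : ∀ᶠ k in atTop, ∀ x, Φ k x = approxPotential P β φ₀ μ₀ k x := by
    filter_upwards [hcont] with k hc x
    simp only [Φ, dif_pos hc, ContinuousMap.coe_mk]
  have hlim : Tendsto Φ atTop (𝓝 φ) := by
    refine tendsto_gibbsPotential P.isCompact P.nonempty hβ hint h (tendsto_latticeNumber hP hn)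
      (q := scaledPoint P) ?_ (tendsto_log_latticeNumber_div hP hn)
      (tendsto_sum_scaledPoint_div hP) ?_
    · filter_upwards [eventually_gt_atTop 0] with k hk using scaledPoint_mem hk
    · filter_upwards [hΦ, eventually_gt_atTop 0] with k h hk x
      rw [h x, approxPotential_eq_gibbsPotential hk]
  intro u hu x
  obtain ⟨t, ht, h⟩ := ContinuousMap.tendsto_iff_tendstoLocallyUniformly.1 hlim u hu x
  refine ⟨t, ht, ?_⟩
  filter_upwards [h, hΦ] with k h h' y hy
  rw [← h' y]
  exact h y hy

end Properties

/-- A limit of optimal potentials solves the second boundary value problem. -/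
theorem IsLimitOfOptimal.solvesSecondBVP (hβ : 0 < β) (hφ₀ : Continuous φ₀)
    (hint : Integrable (fun x => Real.exp
      (β * conjOn (P : Set (EuclideanSpace ℝ (Fin n))) (fun _ => 0) x)) (weightedMeasure β φ₀ μ₀))
    (hP : volume (P : Set (EuclideanSpace ℝ (Fin n))) = 1)
    {φ : C(EuclideanSpace ℝ (Fin n), ℝ)} {χ : ℕ → C(EuclideanSpace ℝ (Fin n), ℝ)} {R : ℕ → ℝ}
    {M : NNReal}
    (h : IsLimitOfOptimal (P : Set (EuclideanSpace ℝ (Fin n))) (weightedMeasure β φ₀ μ₀)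
      (volume.restrict (P : Set (EuclideanSpace ℝ (Fin n)))) β φ χ R M) :
    SolvesSecondBVP P β φ₀ μ₀ φ := by
  have := isFiniteMeasureOnCompacts_of_integrable P.isCompact P.nonempty hint
  have : IsProbabilityMeasure (volume.restrict (P : Set (EuclideanSpace ℝ (Fin n)))) :=
    ⟨by rw [Measure.restrict_apply_univ, hP]⟩
  have hgrad : HasGradientImageIn P φ := .of_increments h.convexOn h.increments
  have hi := integrable_exp_of_increments hβ hint φ.continuous h.increments
  set μ := (weightedMeasure β φ₀ μ₀).withDensity fun x => ENNReal.ofReal (Real.exp (β * φ x))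
  have : IsProbabilityMeasure μ := ⟨by
    rw [withDensity_apply _ MeasurableSet.univ, setLIntegral_univ,
      ← ofReal_integral_eq_lintegral_ofReal hi (ae_of_all _ fun x => (Real.exp_pos _).le),
      h.integral_exp_eq_one hβ hint, ENNReal.ofReal_one]⟩
  have hMA : ∀ A, MeasurableSet A → mongeAmpere φ A = μ A := fun A hA => by
    refine mongeAmpere_eq_of_le_on_compacts hP φ.continuous hgrad (fun K hK => ?_) hA
    rw [withDensity_apply _ hK.measurableSet,
      ← ofReal_integral_eq_lintegral_ofReal hi.integrableOn (ae_of_all _ fun x => (Real.exp_pos _).le)]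
    exact h.setIntegral_le_measure_subgradientImage hβ hint hK
  refine ⟨hgrad, interior_subset_subgradientImage hP φ.continuous ?_ hgrad, fun A hA => ?_⟩
  · exact (hMA _ MeasurableSet.univ).trans measure_univ
  · rw [hMA A hA, withDensity_apply _ hA, setLIntegral_weightedMeasure hφ₀ φ.continuous hA]

end Lattice

end PermanentMA

theorem mainTheorem3 {n : ℕ} (hn : 0 < n)
    (P : ConvexBody (EuclideanSpace ℝ (Fin n)))
    (hP : volume (P : Set (EuclideanSpace ℝ (Fin n))) = 1)
    (β : ℝ) (hβ : 0 < β)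
    (ρ₀ : EuclideanSpace ℝ (Fin n) → ℝ) (hρ_meas : Measurable ρ₀) (hρ_pos : ∀ x, 0 < ρ₀ x)
    (μ₀ : Measure (EuclideanSpace ℝ (Fin n)))
    (hμ₀ : μ₀ = volume.withDensity fun x => ENNReal.ofReal (ρ₀ x))
    (φ₀ : EuclideanSpace ℝ (Fin n) → ℝ) (hφ₀ : PermanentMA.IsWeightFunction P φ₀)
    (hfin : ∫⁻ x, ENNReal.ofReal
      (Real.exp (β * (PermanentMA.supportFunction P x - φ₀ x))) ∂μ₀ < ⊤) :
    (∀ k : ℕ, 0 < k → 0 < PermanentMA.latticeNumber P k →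
      Integrable (fun x => PermanentMA.per P k x ^ (β / k))
        (Measure.pi fun _ => PermanentMA.weightedMeasure β φ₀ μ₀) ∧
      0 < PermanentMA.partitionFunction P β φ₀ μ₀ k ∧
      (∀ x, Integrable (fun y => PermanentMA.per P k (PermanentMA.consConfig x y) ^ (β / k))
        (Measure.pi fun _ => PermanentMA.weightedMeasure β φ₀ μ₀)) ∧
      PermanentMA.HasGradientImageIn P (PermanentMA.approxPotential P β φ₀ μ₀ k)) ∧
    ∃ φ : EuclideanSpace ℝ (Fin n) → ℝ,
      PermanentMA.SolvesSecondBVP P β φ₀ μ₀ φ ∧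
      (∀ ψ, PermanentMA.SolvesSecondBVP P β φ₀ μ₀ ψ → ψ = φ) ∧
      TendstoLocallyUniformly (fun k => PermanentMA.approxPotential P β φ₀ μ₀ k) φ atTop := by
  have hc₀ := hφ₀.continuous
  have hμ_pos : μ₀.IsOpenPosMeasure := hμ₀ ▸
    (PermanentMA.absolutelyContinuous_withDensity_ofReal (μ := volume) hρ_meas
      hρ_pos).isOpenPosMeasure
  set ν := PermanentMA.weightedMeasure β φ₀ μ₀ with hν
  have hν_pos : ν.IsOpenPosMeasure := PermanentMA.isOpenPosMeasure_weightedMeasure hc₀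
  have hμ_fin : SigmaFinite μ₀ := by
    rw [hμ₀]; exact SigmaFinite.withDensity_ofReal ρ₀
  have hν_fin : SigmaFinite ν := PermanentMA.sigmaFinite_weightedMeasure
  have hν_ne : NeZero ν := ⟨fun h0 => isOpen_univ.measure_ne_zero ν Set.univ_nonempty (by simp [h0])⟩
  have hint := PermanentMA.integrable_exp_supportFunction (P := P) hc₀ hfin
  refine ⟨fun k hk hN => ?_, ?_⟩
  · have hk' : (0 : ℝ) < k := by positivity
    have hq := PermanentMA.scaledPoint_mem (P := P) hk
    simp only [PermanentMA.per_rpow_eq_gibbsWeight hk, PermanentMA.partitionFunction_eq_gibbsZ hk]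
    exact ⟨PermanentMA.integrable_gibbsWeight P.isCompact hq hk' hβ hint,
      PermanentMA.gibbsZ_pos P.isCompact hq hk' hβ hint,
      PermanentMA.integrable_gibbsWeight_consConfig P.isCompact hq hk' hβ hint hN,
      PermanentMA.hasGradientImageIn_approxPotential hβ hint hk hN⟩
  · have hκ : IsProbabilityMeasure (volume.restrict (P : Set (EuclideanSpace ℝ (Fin n)))) :=
      ⟨by rw [Measure.restrict_apply_univ, hP]⟩
    obtain ⟨φ, χ, R, M, h⟩ := PermanentMA.exists_limit_optimalPotential
      (κ := volume.restrict (P : Set (EuclideanSpace ℝ (Fin n)))) P.isCompact P.nonempty hβ hint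
      (ae_restrict_mem P.isCompact.measurableSet)
    have hφ := h.solvesSecondBVP hβ hc₀ hint hP
    exact ⟨φ, hφ, fun ψ hψ => le_antisymm (hψ.le hP hβ hc₀ hφ) (hφ.le hP hβ hc₀ hψ),
      PermanentMA.tendstoLocallyUniformly_approxPotential hβ hint hP hn h⟩
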